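/- Let $n\ge 1$ and $\gamma>1$, and let $g:[0,\infty)\to[1,\infty)$ be nondecreasing. For $t>0$ let $e^{t\mathcal L}$ be the Fourier multiplier on $\mathbb R^n$ with symbol $e^{-t|\xi|^\gamma/g(|\xi|)}$, where $\xi$ is the frequency variable in $e^{ix\cdot\xi}$, and let $H^{s,p}=H^{s,p}(\mathbb R^n)$ be the (Bessel potential) Sobolev space of complex-valued tempered distributions. Assume: (i) for every $t\in(0,1)$ the function $r\mapsto r^{n-1}e^{-r^\gamma/g(rt^{-1/\gamma})}$ is $n+1$ times differentiable on $(0,\infty)$, and $$\sup_{t\in(0,1)}\int_0^\infty\left|\partial_r^{\,n+1}\left(r^{n-1}e^{-r^\gamma/g(rt^{-1/\gamma})}\right)\right|dr<\infty;$$ (ii) for some $p\in(1,\infty)$, the Fourier multiplier $G$ with symbol $g(|\xi|)$ is bounded on $L^p(\mathbb R^n)$: $\|Gf\|_{L^p}\le C\|f\|_{L^p}$ for all $f\in L^p(\mathbb R^n)$. Let $s_1\le s_2$ be real, $1<p_1\le p_2<\infty$ and $0<T<\infty$. Then there is a constant $C$, independent of $t$ and $f$, such that for every $t\in(0,T]$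 the operator $e^{t\mathcal L}$ (defined on Schwartz functions by its symbol, and extended by density) is bounded from $H^{s_1,p_1}$ to $H^{s_2,p_2}$, and $$\|e^{t\mathcal L}f\|_{H^{s_2,p_2}}\le C\,t^{-(s_2-s_1+n/p_1-n/p_2)/\gamma}\,\|f\|_{H^{s_1,p_1}}\qquad\text{for all } f\in H^{s_1,p_1}.$$ -/

import Mathlib

open MeasureTheory Set FourierTransform TemperedDistribution
open scoped SchwartzMap ENNReal

noncomputable section

namespace FractionalHeat

/-- The Sobolev (Bessel potential) space `H^{s,p}(ℝⁿ)` as a space of tempered distributions: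
those `f` for which `J^s f` is an `L^p` function, `J^s` being the Bessel potential operator. -/
def sobolevSubmodule (n : ℕ) (s : ℝ) (p : ℝ≥0∞) [Fact (1 ≤ p)] :
    Submodule ℂ 𝓢'(EuclideanSpace ℝ (Fin n), ℂ) where
  carrier := {f | MemSobolev s p f}
  zero_mem' := memSobolev_fun_zero _ _ s p
  add_mem' := fun hf hg => hf.add hg
  smul_mem' := fun c _ hf => hf.smul c

/-- The type of elements of `H^{s,p}(ℝⁿ)`. Its topology is that of the Sobolev norm below, not
the one it inherits from the tempered distributions. -/
def SobolevSpace (n : ℕ) (s : ℝ) (p : ℝ≥0∞) [Fact (1 ≤ p)] : Type :=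
  ↥(sobolevSubmodule n s p)

instance (n : ℕ) (s : ℝ) (p : ℝ≥0∞) [Fact (1 ≤ p)] : AddCommGroup (SobolevSpace n s p) :=
  inferInstanceAs (AddCommGroup ↥(sobolevSubmodule n s p))

instance (n : ℕ) (s : ℝ) (p : ℝ≥0∞) [Fact (1 ≤ p)] : Module ℂ (SobolevSpace n s p) :=
  inferInstanceAs (Module ℂ ↥(sobolevSubmodule n s p))

namespace SobolevSpace

variable {n : ℕ} {s : ℝ} {p : ℝ≥0∞} [Fact (1 ≤ p)]

/-- The tempered distribution underlying an element of `H^{s,p}`. -/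
def toDistribution : SobolevSpace n s p →ₗ[ℂ] 𝓢'(EuclideanSpace ℝ (Fin n), ℂ) :=
  (sobolevSubmodule n s p).subtype

theorem toDistribution_injective :
    Function.Injective (toDistribution : SobolevSpace n s p →ₗ[ℂ] _) :=
  Subtype.val_injective

theorem memSobolev (f : SobolevSpace n s p) : MemSobolev s p (toDistribution f) := f.2

/-- A Schwartz function, as an element of `H^{s,p}`. -/
def ofSchwartz (φ : 𝓢(EuclideanSpace ℝ (Fin n), ℂ)) : SobolevSpace n s p :=
  ⟨(φ : 𝓢'(EuclideanSpace ℝ (Fin n), ℂ)), φ.memSobolev⟩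

theorem lp_ext {u v : Lp ℂ p (volume : Measure (EuclideanSpace ℝ (Fin n)))}
    (h : (u : 𝓢'(EuclideanSpace ℝ (Fin n), ℂ)) = v) : u = v := by
  have hk := Lp.ker_toTemperedDistributionCLM_eq_bot (E := EuclideanSpace ℝ (Fin n)) (F := ℂ)
    (μ := volume) (p := p)
  exact LinearMap.ker_eq_bot.mp hk h

/-- The `L^p` function that represents `J^s f`. -/
def lpRep : SobolevSpace n s p →ₗ[ℂ] Lp ℂ p (volume : Measure (EuclideanSpace ℝ (Fin n))) where
  toFun f := (memSobolev f).choose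
  map_add' f g := by
    apply lp_ext
    rw [← (memSobolev (f + g)).choose_spec, ← Lp.toTemperedDistributionCLM_apply, map_add,
      map_add, map_add, Lp.toTemperedDistributionCLM_apply, Lp.toTemperedDistributionCLM_apply,
      ← (memSobolev f).choose_spec, ← (memSobolev g).choose_spec]
  map_smul' c f := by
    apply lp_ext
    rw [← (memSobolev (c • f)).choose_spec, ← Lp.toTemperedDistributionCLM_apply, RingHom.id_apply,
      map_smul, map_smul, map_smul, Lp.toTemperedDistributionCLM_apply,
      ← (memSobolev f).choose_spec]

theorem lpRep_spec (f : SobolevSpace n s p) :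
    besselPotential (EuclideanSpace ℝ (Fin n)) ℂ s (toDistribution f) =
      (lpRep f : 𝓢'(EuclideanSpace ℝ (Fin n), ℂ)) :=
  (memSobolev f).choose_spec

theorem lpRep_injective :
    Function.Injective (lpRep : SobolevSpace n s p →ₗ[ℂ] _) := by
  intro f g h
  apply toDistribution_injective
  have h1 : besselPotential (EuclideanSpace ℝ (Fin n)) ℂ s (toDistribution f) =
      besselPotential (EuclideanSpace ℝ (Fin n)) ℂ s (toDistribution g) := by
    rw [lpRep_spec, lpRep_spec, h]
  have h2 := congrArg (besselPotential (EuclideanSpace ℝ (Fin n)) ℂ (-s)) h1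
  simpa using h2

end SobolevSpace

/-- The Sobolev norm `‖f‖_{H^{s,p}} = ‖J^s f‖_{L^p}`. -/
instance (n : ℕ) (s : ℝ) (p : ℝ≥0∞) [Fact (1 ≤ p)] : NormedAddCommGroup (SobolevSpace n s p) :=
  NormedAddCommGroup.induced (SobolevSpace n s p)
    (Lp ℂ p (volume : Measure (EuclideanSpace ℝ (Fin n))))
    SobolevSpace.lpRep SobolevSpace.lpRep_injective

instance (n : ℕ) (s : ℝ) (p : ℝ≥0∞) [Fact (1 ≤ p)] : NormedSpace ℂ (SobolevSpace n s p) :=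
  NormedSpace.induced ℂ (SobolevSpace n s p)
    (Lp ℂ p (volume : Measure (EuclideanSpace ℝ (Fin n)))) SobolevSpace.lpRep

theorem SobolevSpace.norm_def {n : ℕ} {s : ℝ} {p : ℝ≥0∞} [Fact (1 ≤ p)]
    (f : SobolevSpace n s p) : ‖f‖ = ‖SobolevSpace.lpRep f‖ := rfl

/-- `u` is the image of the Schwartz function `φ` under the Fourier multiplier with radial symbol
`ξ ↦ a |ξ|`: the Fourier transform of `u` is the function `a |ξ| · φ̂(ξ)`. The symbol is a
function of the frequency `ξ` in `e^{i x·ξ}`; the Fourier transform `𝓕` uses `e^{2πi x·ξ}`, hence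
the factor `2π`. -/
def IsMultiplierImage {n : ℕ} (a : ℝ → ℝ) (φ : 𝓢(EuclideanSpace ℝ (Fin n), ℂ))
    (u : 𝓢'(EuclideanSpace ℝ (Fin n), ℂ)) : Prop :=
  ∀ ψ : 𝓢(EuclideanSpace ℝ (Fin n), ℂ),
    Integrable (fun ξ => ψ ξ * ((a (2 * Real.pi * ‖ξ‖) : ℂ) * (𝓕 φ) ξ)) ∧
    (𝓕 u) ψ = ∫ ξ, ψ ξ * ((a (2 * Real.pi * ‖ξ‖) : ℂ) * (𝓕 φ) ξ)

/-- The Fourier multiplier with symbol `a |ξ|` is bounded on `L^p(ℝⁿ)`: it extends from the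
Schwartz functions, which are dense for `p < ∞`, to a bounded operator. -/
def IsLpBoundedMultiplier (n : ℕ) (p : ℝ≥0∞) [Fact (1 ≤ p)] (a : ℝ → ℝ) : Prop :=
  ∃ A : Lp ℂ p (volume : Measure (EuclideanSpace ℝ (Fin n))) →L[ℂ]
      Lp ℂ p (volume : Measure (EuclideanSpace ℝ (Fin n))),
    ∀ φ : 𝓢(EuclideanSpace ℝ (Fin n), ℂ),
      IsMultiplierImage a φ (A (φ.toLp p) : 𝓢'(EuclideanSpace ℝ (Fin n), ℂ))

/-- The bounded operator `A : H^{s₁,p₁} → H^{s₂,p₂}` is the Fourier multiplier with symbol `a |ξ|`.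
For `p₁ < ∞` the Schwartz functions are dense in `H^{s₁,p₁}`, so there is at most one such `A`. -/
def IsSobolevMultiplier {n : ℕ} {s₁ s₂ : ℝ} {p₁ p₂ : ℝ≥0∞} [Fact (1 ≤ p₁)] [Fact (1 ≤ p₂)]
    (a : ℝ → ℝ) (A : SobolevSpace n s₁ p₁ →L[ℂ] SobolevSpace n s₂ p₂) : Prop :=
  ∀ φ : 𝓢(EuclideanSpace ℝ (Fin n), ℂ),
    IsMultiplierImage a φ (SobolevSpace.toDistribution (A (SobolevSpace.ofSchwartz φ)))

/-- The radial profile of the symbol `exp (-t |ξ|^γ / g(|ξ|))` of `e^{tL}`. -/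
def heatSymbol (γ : ℝ) (g : ℝ → ℝ) (t r : ℝ) : ℝ :=
  Real.exp (-(t * r ^ γ / g r))

/-- The function `r ^ (n-1) * exp (-r^γ / g(r t^{-1/γ}))` of the kernel condition. -/
def kernelProfile (n : ℕ) (γ : ℝ) (g : ℝ → ℝ) (t r : ℝ) : ℝ :=
  r ^ (n - 1) * Real.exp (-(r ^ γ / g (r * t ^ (-1 / γ))))

/-- The kernel condition: for `0 < t < 1` the profile is `n + 1` times differentiable on `(0, ∞)`,
and `∫₀^∞ |∂_r^{n+1} (r^{n-1} exp (-r^γ / g(r t^{-1/γ})))| dr` is finite and bounded in `t`. -/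
def KernelCondition (n : ℕ) (γ : ℝ) (g : ℝ → ℝ) : Prop :=
  ∃ M : ℝ, ∀ t ∈ Ioo (0 : ℝ) 1,
    (∀ k ≤ n, DifferentiableOn ℝ (iteratedDeriv k (kernelProfile n γ g t)) (Ioi 0)) ∧
    IntegrableOn (iteratedDeriv (n + 1) (kernelProfile n γ g t)) (Ioi 0) ∧
    ∫ r in Ioi (0 : ℝ), |iteratedDeriv (n + 1) (kernelProfile n γ g t) r| ≤ M

end FractionalHeat

end

/-! Write J^s for the Bessel potential, 2α = s₂ - s₁ and θ = 1/p₁ - 1/p₂. Since J^s identifies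
H^{s,p} with L^p, the claim is an L^{p₁} → L^{p₂} bound for J^{2α} e^{tL}, which is convolution with
K = 𝓕⁻ m, where m is `besselHeatSymbol`. Young's inequality, in the form ‖K ∗ f‖_{p₂} ≤ ‖K‖₁^{1-θ}
‖K‖_∞^θ ‖f‖_{p₁} (`exists_convolution_operator`), reduces it to ‖K‖₁ ≲ t^{-2α/γ} and ‖K‖_∞ ≤ ‖m‖₁ ≲
t^{-(2α+n)/γ} (`exists_kernel_bound`); interpolating the two exponents gives (2α + nθ)/γ.

The multiplier hypothesis on G serves to show that g is bounded: testing G on translates of a bump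
bounds the local averages of g, and g is monotone (`IsLpBoundedMultiplier.bounded`). With g ≤ B the
rescaled profile exp(-r^γ/g) decays faster than any power, uniformly in t. This gives the bound for
‖m‖₁ after scaling.

The bound for ‖K‖₁ is the main work. In the variable u = |ξ|², Taylor's formula with base point at
infinity writes a decaying radial symbol F as an integral of Bochner–Riesz symbols (1 - u/v)₊^n with
density ± v^n F^{(n+1)}(v)/n! (`eq_integral_of_decay`). The Bochner–Riesz kernel of order n on ℝⁿ is
integrable, and dilations preserve its L¹ norm, so ‖K‖₁ is controlled by the L¹ norm of the density.

To bound the density, the kernel condition controls only the derivative of order n + 1 of r^{n-1}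
exp(-r^γ/g), and only in L¹. A Landau–Kolmogorov inequality on [r, 2r] recovers the lower
derivatives pointwise, with a gain r + r^γ at the origin (`exists_derivBound_one_sub_profile`).
These estimates say nothing about decay at infinity, so the semigroup law e^{tL} = (e^{(t/N)L})^N is
used: differentiating an N-th power n + 1 times with N ≥ n + 2 leaves an undifferentiated factor of
the profile, and that factor supplies the decay (`DerivBound.pow_mul`, `exists_superposition`).
Taking N > T also brings every t ≤ T into the range t/N < 1 of the kernel condition. -/

namespace FractionalHeat

/-! ### Calculus of weighted derivative bounds on the half-line -/

/-- `f` is `k + 1` times differentiable on `(0, ∞)`, its derivatives of order `j ≤ k` are bounded by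
`w r / r ^ j`, and the derivative of order `k + 1` is bounded by `w r * q r / r ^ (k + 1)`. -/
def DerivBound (q : ℝ → ℝ) : ℕ → (ℝ → ℝ) → (ℝ → ℝ) → Prop
  | 0, f, w => (∀ r, 0 < r → |f r| ≤ w r) ∧
      ∃ f' : ℝ → ℝ, (∀ r, 0 < r → HasDerivAt f (f' r) r) ∧ ∀ r, 0 < r → |f' r| ≤ w r * q r / r
  | k + 1, f, w => (∀ r, 0 < r → |f r| ≤ w r) ∧
      ∃ f' : ℝ → ℝ, (∀ r, 0 < r → HasDerivAt f (f' r) r) ∧ DerivBound q k f' fun r => w r / r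

namespace DerivBound

variable {q : ℝ → ℝ} {k : ℕ} {f g w w₁ w₂ : ℝ → ℝ}

theorem abs_le (h : DerivBound q k f w) {r : ℝ} (hr : 0 < r) : |f r| ≤ w r := by
  cases k with
  | zero => exact h.1 r hr
  | succ k => exact h.1 r hr

theorem nonneg (h : DerivBound q k f w) {r : ℝ} (hr : 0 < r) : 0 ≤ w r :=
  (abs_nonneg _).trans (h.abs_le hr)

theorem mono (hq : ∀ r, 0 < r → 0 ≤ q r) (h : DerivBound q k f w₁)
    (hw : ∀ r, 0 < r → w₁ r ≤ w₂ r) : DerivBound q k f w₂ := by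
  induction k generalizing f w₁ w₂ with
  | zero =>
    obtain ⟨h1, f', h2, h3⟩ := h
    refine ⟨fun r hr => (h1 r hr).trans (hw r hr), f', h2, fun r hr => (h3 r hr).trans ?_⟩
    have := hq r hr
    have := hw r hr
    gcongr
  | succ k ih =>
    obtain ⟨h1, f', h2, h3⟩ := h
    refine ⟨fun r hr => (h1 r hr).trans (hw r hr), f', h2, ih h3 fun r hr => ?_⟩
    have := hw r hr
    gcongr

theorem congr_fun (h : DerivBound q k f w) (hfg : ∀ r, 0 < r → f r = g r) :
    DerivBound q k g w := by
  have key : ∀ f' : ℝ → ℝ, (∀ r, 0 < r → HasDerivAt f (f' r) r) →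
      ∀ r, 0 < r → HasDerivAt g (f' r) r := fun f' h r hr =>
    (h r hr).congr_of_eventuallyEq
      (Filter.eventuallyEq_of_mem (Ioi_mem_nhds hr) fun x hx => (hfg x hx).symm)
  cases k with
  | zero =>
    obtain ⟨h1, f', h2, h3⟩ := h
    exact ⟨fun r hr => hfg r hr ▸ h1 r hr, f', key _ h2, h3⟩
  | succ k =>
    obtain ⟨h1, f', h2, h3⟩ := h
    exact ⟨fun r hr => hfg r hr ▸ h1 r hr, f', key _ h2, h3⟩

/-- The extra factor q is at least 1, so a pointwise bound without it is stronger than what the top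
derivative needs. -/
theorem of_succ (hq : ∀ r, 0 < r → 1 ≤ q r) (h : DerivBound q (k + 1) f w) :
    DerivBound q k f w := by
  induction k generalizing f w with
  | zero =>
    obtain ⟨h1, f', h2, h3⟩ := h
    refine ⟨h1, f', h2, fun r hr => (h3.abs_le hr).trans ?_⟩
    have := hq r hr
    have := (abs_nonneg _).trans (h1 r hr)
    gcongr
    nlinarith
  | succ k ih =>
    obtain ⟨h1, f', h2, h3⟩ := h
    exact ⟨h1, f', h2, ih h3⟩

theorem add (hf : DerivBound q k f w₁) (hg : DerivBound q k g w₂) :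
    DerivBound q k (fun r => f r + g r) fun r => w₁ r + w₂ r := by
  induction k generalizing f g w₁ w₂ with
  | zero =>
    obtain ⟨h1, f', h2, h3⟩ := hf
    obtain ⟨k1, g', k2, k3⟩ := hg
    refine ⟨fun r hr => (abs_add_le _ _).trans (add_le_add (h1 r hr) (k1 r hr)),
      fun r => f' r + g' r, fun r hr => (h2 r hr).add (k2 r hr), fun r hr =>
      (abs_add_le _ _).trans ((add_le_add (h3 r hr) (k3 r hr)).trans (le_of_eq (by ring)))⟩
  | succ k ih =>
    obtain ⟨h1, f', h2, h3⟩ := hf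
    obtain ⟨k1, g', k2, k3⟩ := hg
    refine ⟨fun r hr => (abs_add_le _ _).trans (add_le_add (h1 r hr) (k1 r hr)),
      fun r => f' r + g' r, fun r hr => (h2 r hr).add (k2 r hr), ?_⟩
    have := ih h3 k3
    simpa only [add_div] using this

theorem const_mul (c : ℝ) (hf : DerivBound q k f w) :
    DerivBound q k (fun r => c * f r) fun r => |c| * w r := by
  induction k generalizing f w with
  | zero =>
    obtain ⟨h1, f', h2, h3⟩ := hf
    refine ⟨fun r hr => ?_, fun r => c * f' r, fun r hr => (h2 r hr).const_mul c, fun r hr => ?_⟩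
    · rw [abs_mul]
      exact mul_le_mul_of_nonneg_left (h1 r hr) (abs_nonneg _)
    · rw [abs_mul, mul_assoc, mul_div_assoc]
      exact mul_le_mul_of_nonneg_left (h3 r hr) (abs_nonneg _)
  | succ k ih =>
    obtain ⟨h1, f', h2, h3⟩ := hf
    refine ⟨fun r hr => ?_, fun r => c * f' r, fun r hr => (h2 r hr).const_mul c, ?_⟩
    · rw [abs_mul]
      exact mul_le_mul_of_nonneg_left (h1 r hr) (abs_nonneg _)
    · simpa only [mul_div_assoc] using ih h3

theorem abs_mul_le (hf : DerivBound q k f w₁) (hg : DerivBound q k g w₂) {r : ℝ} (hr : 0 < r) :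
    |f r * g r| ≤ 2 ^ (k + 1) * (w₁ r * w₂ r) := by
  have h1 := hf.nonneg hr
  have h2 := hg.nonneg hr
  have h3 : (1 : ℝ) ≤ 2 ^ (k + 1) := one_le_pow₀ (by norm_num)
  rw [abs_mul]
  calc |f r| * |g r| ≤ w₁ r * w₂ r := by
        gcongr
        · exact hf.abs_le hr
        · exact hg.abs_le hr
    _ ≤ _ := by nlinarith [mul_nonneg h1 h2]

/-- Leibniz' rule by induction: each differentiation doubles the number of terms, hence the power of
2. The undifferentiated factor is lowered one level by `of_succ`, which is where q ≥ 1 is used. -/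
theorem mul (hq : ∀ r, 0 < r → 1 ≤ q r) (hf : DerivBound q k f w₁) (hg : DerivBound q k g w₂) :
    DerivBound q k (fun r => f r * g r) fun r => 2 ^ (k + 1) * (w₁ r * w₂ r) := by
  induction k generalizing f g w₁ w₂ with
  | zero =>
    have hf' := hf
    have hg' := hg
    obtain ⟨h1, f', h2, h3⟩ := hf
    obtain ⟨k1, g', k2, k3⟩ := hg
    refine ⟨fun r hr => hf'.abs_mul_le hg' hr, fun r => f' r * g r + f r * g' r, fun r hr => (h2 r hr).mul (k2 r hr),
      fun r hr => ?_⟩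
    have := (abs_nonneg _).trans (h3 r hr)
    have := (abs_nonneg _).trans (h1 r hr)
    calc |f' r * g r + f r * g' r| ≤ |f' r| * |g r| + |f r| * |g' r| := by
          rw [← abs_mul, ← abs_mul]; exact abs_add_le _ _
      _ ≤ (w₁ r * q r / r) * w₂ r + w₁ r * (w₂ r * q r / r) := by
          gcongr
          · exact h3 r hr
          · exact k1 r hr
          · exact h1 r hr
          · exact k3 r hr
      _ = _ := by ring
  | succ k ih =>
    have hf0 := hf.of_succ hq
    have hg0 := hg.of_succ hq
    have hf' := hf
    have hg' := hg
    obtain ⟨h1, f', h2, h3⟩ := hf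
    obtain ⟨k1, g', k2, k3⟩ := hg
    refine ⟨fun r hr => hf'.abs_mul_le hg' hr, fun r => f' r * g r + f r * g' r, fun r hr => (h2 r hr).mul (k2 r hr), ?_⟩
    have := (ih h3 hg0).add (ih hf0 k3)
    refine this.mono (fun r hr => zero_le_one.trans (hq r hr)) fun r hr => le_of_eq ?_
    ring

/-- Powers of a shifted variable. -/
theorem add_rpow (k : ℕ) (a : ℝ) :
    ∃ C : ℝ, 0 ≤ C ∧ ∀ q : ℝ → ℝ, (∀ r, 0 < r → 1 ≤ q r) → ∀ c : ℝ, 0 ≤ c →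
      DerivBound q k (fun r => (c + r) ^ a) fun r => C * (c + r) ^ a := by
  have hd : ∀ a c : ℝ, 0 ≤ c → ∀ r, 0 < r →
      HasDerivAt (fun r => (c + r) ^ a) (a * (c + r) ^ (a - 1)) r := fun a c hc r hr => by
    have h := ((hasDerivAt_id r).const_add c).rpow_const (p := a) (Or.inl (by simp; positivity))
    simpa [mul_comm, mul_assoc] using h
  -- Because r ≤ c + r, each derivative costs at most 1/r whatever the shift is; this makes the
  -- constant uniform in c.
  have hle : ∀ a c : ℝ, 0 ≤ c → ∀ r, 0 < r → (c + r) ^ (a - 1) ≤ (c + r) ^ a / r :=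
    fun a c hc r hr => by
      rw [Real.rpow_sub_one (by positivity)]
      gcongr
      linarith
  induction k generalizing a with
  | zero =>
    refine ⟨1 + |a|, by positivity, fun q hq c hc => ⟨fun r hr => ?_, _, hd a c hc, fun r hr => ?_⟩⟩
    · rw [abs_of_nonneg (by positivity)]
      nlinarith [abs_nonneg a, Real.rpow_nonneg (show 0 ≤ c + r by positivity) a]
    · have hq1 := hq r hr
      rw [abs_mul, abs_of_nonneg (a := (c + r) ^ (a - 1)) (by positivity)]
      calc |a| * (c + r) ^ (a - 1) ≤ |a| * ((c + r) ^ a / r) := by gcongr; exact hle a c hc r hr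
        _ ≤ (1 + |a|) * ((c + r) ^ a / r) * 1 := by
          rw [mul_one]; gcongr; linarith
        _ ≤ (1 + |a|) * ((c + r) ^ a / r) * q r := by gcongr
        _ = _ := by ring
  | succ k ih =>
    obtain ⟨C, hC, h⟩ := ih (a - 1)
    refine ⟨1 + |a| * C, by positivity, fun q hq c hc => ⟨fun r hr => ?_, _, hd a c hc, ?_⟩⟩
    · rw [abs_of_nonneg (by positivity)]
      nlinarith [mul_nonneg (abs_nonneg a) hC, Real.rpow_nonneg (show 0 ≤ c + r by positivity) a]
    · refine ((h q hq c hc).const_mul a).mono (fun r hr => zero_le_one.trans (hq r hr)) fun r hr => ?_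
      calc |a| * (C * (c + r) ^ (a - 1)) ≤ |a| * (C * ((c + r) ^ a / r)) := by
            gcongr; exact hle a c hc r hr
        _ ≤ (1 + |a| * C) * ((c + r) ^ a / r) := by
            rw [← mul_assoc]; gcongr; linarith
        _ = _ := by ring

/-- The bounds are stable under the change of variables `r = √u`. -/
theorem comp_sqrt (k : ℕ) : ∃ C : ℝ, 0 ≤ C ∧ ∀ q : ℝ → ℝ, (∀ r, 0 < r → 1 ≤ q r) →
    ∀ f w : ℝ → ℝ, DerivBound q k f w →
      DerivBound (fun u => q (√u)) k (fun u => f (√u)) fun u => C * w (√u) := by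
  have hd : ∀ f f' : ℝ → ℝ, (∀ r, 0 < r → HasDerivAt f (f' r) r) → ∀ u, 0 < u →
      HasDerivAt (fun u => f (√u)) (f' (√u) * (2⁻¹ * (0 + √u) ^ (-1 : ℝ))) u :=
    fun f f' h u hu => by
      have h1 := (h (√u) (Real.sqrt_pos.2 hu)).comp u (Real.hasDerivAt_sqrt hu.ne')
      -- Written as a shifted power with shift 0, so that `add_rpow` supplies its derivative bounds.
      have h2 : (1 / (2 * √u)) = 2⁻¹ * (0 + √u) ^ (-1 : ℝ) := by
        rw [Real.rpow_neg_one, zero_add]; field_simp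
      rw [← h2]
      exact h1
  induction k with
  | zero =>
    refine ⟨1, zero_le_one, fun q hq f w hf => ?_⟩
    obtain ⟨h1, f', h2, h3⟩ := hf
    refine ⟨fun u hu => by simpa using h1 _ (Real.sqrt_pos.2 hu), _, hd f f' h2, fun u hu => ?_⟩
    have hs := Real.sqrt_pos.2 hu
    have h0 := (abs_nonneg _).trans (h3 _ hs)
    rw [abs_mul, Real.rpow_neg_one, zero_add, abs_of_nonneg (a := 2⁻¹ * (√u)⁻¹) (by positivity)]
    calc |f' √u| * (2⁻¹ * (√u)⁻¹) ≤ (w √u * q √u / √u) * (1 * (√u)⁻¹) := by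
          gcongr
          · exact h3 _ hs
          · norm_num
      _ = 1 * w √u * q √u / (√u * √u) := by field_simp
      _ = _ := by rw [Real.mul_self_sqrt hu.le]
  | succ k ih =>
    obtain ⟨C, hC, h⟩ := ih
    obtain ⟨D, hD, hD'⟩ := add_rpow k (-1)
    refine ⟨1 + C * (2 ^ (k + 1) * D), by positivity, fun q hq f w hf => ?_⟩
    obtain ⟨h1, f', h2, h3⟩ := hf
    refine ⟨fun u hu => ?_, _, hd f f' h2, ?_⟩
    · have := h1 _ (Real.sqrt_pos.2 hu)
      have h0 := (abs_nonneg _).trans this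
      have : 0 ≤ C * (2 ^ (k + 1) * D) * w √u := by positivity
      linarith
    · have h4 := h q hq _ _ (mul hq h3 ((hD' q hq 0 le_rfl).const_mul 2⁻¹))
      refine h4.mono (fun r hr => zero_le_one.trans (hq _ (Real.sqrt_pos.2 hr))) fun u hu => ?_
      have hs := Real.sqrt_pos.2 hu
      have h0 := (abs_nonneg _).trans (h1 _ hs)
      -- One factor 1/√u comes from differentiating f, the other from the chain rule; together they
      -- are the 1/u that a derivative in u should cost.
      have e : (w √u / √u) * (√u)⁻¹ = w √u / u := by
        rw [← div_eq_mul_inv, div_div, Real.mul_self_sqrt hu.le]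
      rw [Real.rpow_neg_one, zero_add, abs_of_nonneg (by norm_num : (0 : ℝ) ≤ 2⁻¹)]
      calc C * (2 ^ (k + 1) * (w √u / √u * (2⁻¹ * (D * (√u)⁻¹))))
          = 2⁻¹ * (C * (2 ^ (k + 1) * D)) * ((w √u / √u) * (√u)⁻¹) := by ring
        _ ≤ (1 + C * (2 ^ (k + 1) * D)) * ((w √u / √u) * (√u)⁻¹) := by
          gcongr
          have : 0 ≤ C * (2 ^ (k + 1) * D) := by positivity
          linarith
        _ = _ := by rw [e]; ring

/-- High powers of a function with values in `[0, 1]` keep a factor of the function itself in all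
the derivatives. -/
theorem pow_mul (k : ℕ) : ∀ m : ℕ, k + 2 ≤ m → ∃ C : ℝ, 0 ≤ C ∧ ∀ q E H wE w : ℝ → ℝ,
    (∀ r, 0 < r → 1 ≤ q r) → (∀ r, 0 < r → 0 ≤ E r) → (∀ r, 0 < r → E r ≤ 1) →
    (∀ r, 0 < r → 1 ≤ wE r) → DerivBound q k E wE → DerivBound q k H w →
    DerivBound q k (fun r => E r ^ m * H r) fun r => C * E r * w r * wE r ^ (k + 1) := by
  have hb : ∀ (k m : ℕ), 1 ≤ m → ∀ C : ℝ, 1 ≤ C → ∀ E H wE w : ℝ → ℝ, (∀ r, 0 < r → 0 ≤ E r) →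
      (∀ r, 0 < r → E r ≤ 1) → (∀ r, 0 < r → 1 ≤ wE r) → (∀ r, 0 < r → |H r| ≤ w r) →
      ∀ r, 0 < r → |E r ^ m * H r| ≤ C * E r * w r * wE r ^ (k + 1) := by
    intro k m hm C hC E H wE w h0 h1 h2 h3 r hr
    have hE := h0 r hr
    have hw := (abs_nonneg _).trans (h3 r hr)
    rw [abs_mul, abs_of_nonneg (pow_nonneg hE m)]
    calc E r ^ m * |H r| ≤ E r * w r := by
          gcongr
          · calc E r ^ m ≤ E r ^ 1 := pow_le_pow_of_le_one hE (h1 r hr) hm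
              _ = E r := pow_one _
          · exact h3 r hr
      _ = 1 * E r * w r * 1 := by ring
      _ ≤ _ := by
          gcongr
          exact one_le_pow₀ (h2 r hr)
  -- A derivative removes one power of E and leaves a cofactor of the same type as H. After k + 1
  -- derivatives the condition m ≥ k + 2 still leaves a factor E.
  have hd : ∀ (m : ℕ) (E E' H H' : ℝ → ℝ) (r : ℝ), HasDerivAt E (E' r) r → HasDerivAt H (H' r) r →
      HasDerivAt (fun r => E r ^ (m + 1) * H r)
        (E r ^ m * ((m + 1 : ℝ) * (E' r * H r) + E r * H' r)) r := by
    intro m E E' H H' r h1 h2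
    refine ((h1.fun_pow (m + 1)).fun_mul h2).congr_deriv ?_
    rw [Nat.add_sub_cancel]
    push_cast
    ring
  induction k with
  | zero =>
    intro m hm
    obtain ⟨m, rfl⟩ : ∃ l, m = l + 1 := ⟨m - 1, by omega⟩
    refine ⟨m + 2, by positivity, fun q E H wE w hq h0 h1 h2 hE hH => ?_⟩
    refine ⟨hb 0 (m + 1) (by omega) _ (by linarith [show (0 : ℝ) ≤ m by positivity])
      E H wE w h0 h1 h2 fun r hr => hH.abs_le hr, ?_⟩
    obtain ⟨a1, E', a2, a3⟩ := hE
    obtain ⟨b1, H', b2, b3⟩ := hH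
    refine ⟨_, fun r hr => hd m E E' H H' r (a2 r hr) (b2 r hr), fun r hr => ?_⟩
    have hE0 := h0 r hr
    have hE1 := h1 r hr
    have hwE := h2 r hr
    have hw := (abs_nonneg _).trans (b1 r hr)
    have hqr := hq r hr
    rw [abs_mul, abs_of_nonneg (pow_nonneg hE0 m)]
    have i1 : E r ^ m ≤ E r := by
      calc E r ^ m ≤ E r ^ 1 := pow_le_pow_of_le_one hE0 hE1 (by omega)
        _ = E r := pow_one _
    have i2 : |(m + 1 : ℝ) * (E' r * H r) + E r * H' r| ≤ (m + 2) * (wE r * w r * q r / r) := by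
      calc |(m + 1 : ℝ) * (E' r * H r) + E r * H' r|
          ≤ (m + 1 : ℝ) * (|E' r| * |H r|) + |E r| * |H' r| := by
            refine (abs_add_le _ _).trans ?_
            rw [abs_mul, abs_mul, abs_mul, abs_of_nonneg (show (0 : ℝ) ≤ m + 1 by positivity)]
        _ ≤ (m + 1 : ℝ) * ((wE r * q r / r) * w r) + wE r * (w r * q r / r) := by
            gcongr
            · exact a3 r hr
            · exact b1 r hr
            · rw [abs_of_nonneg hE0]; linarith
            · exact b3 r hr
        _ = _ := by ring
    calc E r ^ m * |(m + 1 : ℝ) * (E' r * H r) + E r * H' r|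
        ≤ E r * ((m + 2) * (wE r * w r * q r / r)) := by gcongr
      _ = _ := by ring
  | succ k ih =>
    intro m hm
    obtain ⟨m, rfl⟩ : ∃ l, m = l + 1 := ⟨m - 1, by omega⟩
    obtain ⟨C, hC, h⟩ := ih m (by omega)
    refine ⟨1 + C * ((m + 2) * 2 ^ (k + 1)), by positivity,
      fun q E H wE w hq h0 h1 h2 hE hH => ?_⟩
    have hq0 : ∀ r, 0 < r → 0 ≤ q r := fun r hr => zero_le_one.trans (hq r hr)
    refine ⟨hb (k + 1) (m + 1) (by omega) _ (by
        have : 0 ≤ C * ((m + 2) * 2 ^ (k + 1)) := by positivity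
        linarith) E H wE w h0 h1 h2 fun r hr => hH.abs_le hr, ?_⟩
    have hE' := hE.of_succ hq
    have hH' := hH.of_succ hq
    obtain ⟨a1, E', a2, a3⟩ := hE
    obtain ⟨b1, H', b2, b3⟩ := hH
    refine ⟨_, fun r hr => hd m E E' H H' r (a2 r hr) (b2 r hr), ?_⟩
    have h5 := h q E _ wE _ hq h0 h1 h2 hE'
      (((mul hq a3 hH').const_mul (m + 1)).add (mul hq hE' b3))
    refine h5.mono hq0 fun r hr => ?_
    have hE0 := h0 r hr
    have hw := (abs_nonneg _).trans (b1 r hr)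
    have hwE := h2 r hr
    rw [abs_of_nonneg (show (0 : ℝ) ≤ m + 1 by positivity)]
    calc C * E r * ((m + 1 : ℝ) * (2 ^ (k + 1) * (wE r / r * w r)) + 2 ^ (k + 1) *
          (wE r * (w r / r))) * wE r ^ (k + 1)
        = (C * ((m + 2) * 2 ^ (k + 1))) * (E r * (w r / r) * wE r ^ (k + 1 + 1)) := by ring
      _ ≤ (1 + C * ((m + 2) * 2 ^ (k + 1))) * (E r * (w r / r) * wE r ^ (k + 1 + 1)) := by
        gcongr
        linarith
      _ = _ := by ring

/-- With its converse `of_seq`, this passes between the recursive form, suited to inductions, and an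
explicit list of derivatives, suited to Taylor's formula. -/
theorem exists_seq (h : DerivBound q k f w) : ∃ D : ℕ → ℝ → ℝ, D 0 = f ∧
    (∀ j ≤ k, ∀ r, 0 < r → HasDerivAt (D j) (D (j + 1) r) r) ∧
    (∀ j ≤ k, ∀ r, 0 < r → |D j r| ≤ w r / r ^ j) ∧
    ∀ r, 0 < r → |D (k + 1) r| ≤ w r * q r / r ^ (k + 1) := by
  induction k generalizing f w with
  | zero =>
    obtain ⟨h1, f', h2, h3⟩ := h
    refine ⟨fun j => if j = 0 then f else f', by simp, ?_, ?_, ?_⟩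
    · intro j hj r hr
      obtain rfl : j = 0 := by omega
      simpa using h2 r hr
    · intro j hj r hr
      obtain rfl : j = 0 := by omega
      simpa using h1 r hr
    · intro r hr
      simpa using h3 r hr
  | succ k ih =>
    obtain ⟨h1, f', h2, h3⟩ := h
    obtain ⟨D, hD0, hD1, hD2, hD3⟩ := ih h3
    refine ⟨fun j => Nat.casesOn j f D, rfl, ?_, ?_, ?_⟩
    · intro j hj r hr
      cases j with
      | zero => simpa [hD0] using h2 r hr
      | succ j => simpa using hD1 j (by omega) r hr
    · intro j hj r hr
      cases j with
      | zero => simpa using h1 r hr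
      | succ j =>
        have := hD2 j (by omega) r hr
        rwa [div_div, ← pow_succ'] at this
    · intro r hr
      have := hD3 r hr
      rwa [div_mul_eq_mul_div, div_div, ← pow_succ'] at this

theorem of_seq {D : ℕ → ℝ → ℝ}
    (h1 : ∀ j ≤ k, ∀ r, 0 < r → HasDerivAt (D j) (D (j + 1) r) r)
    (h2 : ∀ j ≤ k, ∀ r, 0 < r → |D j r| ≤ w r / r ^ j)
    (h3 : ∀ r, 0 < r → |D (k + 1) r| ≤ w r * q r / r ^ (k + 1)) : DerivBound q k (D 0) w := by
  induction k generalizing D w with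
  | zero =>
    exact ⟨fun r hr => by simpa using h2 0 le_rfl r hr, _, h1 0 le_rfl,
      fun r hr => by simpa using h3 r hr⟩
  | succ k ih =>
    refine ⟨fun r hr => by simpa using h2 0 (by omega) r hr, _, h1 0 (by omega), ?_⟩
    refine ih (D := fun j => D (j + 1)) (fun j hj => h1 (j + 1) (by omega)) (fun j hj r hr => ?_)
      fun r hr => ?_
    · rw [div_div, ← pow_succ']
      exact h2 (j + 1) (by omega) r hr
    · rw [div_mul_eq_mul_div, div_div, ← pow_succ']
      exact h3 r hr

end DerivBound


/-! ### Taylor's formula and a Landau–Kolmogorov inequality -/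

/-- Differentiating the Taylor sum in its base point telescopes to the last term. Integrated over
[a, b] this gives the remainder on a bounded interval; integrated up to infinity it gives the
Bochner–Riesz representation. -/
theorem hasDerivAt_sum_taylor {D : ℕ → ℝ → ℝ} {n : ℕ} {v : ℝ} (b : ℝ)
    (h : ∀ j ≤ n, HasDerivAt (D j) (D (j + 1) v) v) :
    HasDerivAt (fun v => ∑ j ∈ Finset.range (n + 1), (b - v) ^ j / (j.factorial : ℝ) * D j v)
      ((b - v) ^ n / (n.factorial : ℝ) * D (n + 1) v) v := by
  induction n with
  | zero => simpa using h 0 le_rfl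
  | succ n ih =>
    simp_rw [Finset.sum_range_succ _ (n + 1)]
    have h1 := ih fun j hj => h j (by omega)
    have h2 : HasDerivAt (fun v : ℝ => (b - v) ^ (n + 1) / ((n + 1).factorial : ℝ))
        (-((b - v) ^ n / (n.factorial : ℝ))) v := by
      refine ((((hasDerivAt_id v).const_sub b).fun_pow (n + 1)).div_const _).congr_deriv ?_
      rw [Nat.factorial_succ, Nat.add_sub_cancel]
      push_cast
      simp only [id]
      have : (n.factorial : ℝ) ≠ 0 := by positivity
      have : (n + 1 : ℝ) ≠ 0 := by positivity
      field_simp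
    refine (h1.fun_add (h2.fun_mul (h (n + 1) le_rfl))).congr_deriv ?_
    ring

theorem abs_sub_taylor_le {D : ℕ → ℝ → ℝ} {n : ℕ} {a b : ℝ} (hab : a ≤ b)
    (h : ∀ j ≤ n, ∀ v ∈ Icc a b, HasDerivAt (D j) (D (j + 1) v) v)
    (hi : IntervalIntegrable (D (n + 1)) volume a b) :
    |D 0 b - ∑ j ∈ Finset.range (n + 1), (b - a) ^ j / (j.factorial : ℝ) * D j a| ≤
      (b - a) ^ n * ∫ v in a..b, |D (n + 1) v| := by
  have hint : IntervalIntegrable (fun v => (b - v) ^ n / (n.factorial : ℝ) * D (n + 1) v)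
      volume a b := hi.continuousOn_mul (by fun_prop)
  have h1 := intervalIntegral.integral_eq_sub_of_hasDerivAt
    (fun v hv => hasDerivAt_sum_taylor (D := D) (n := n) b
      fun j hj => h j hj v (by rwa [uIcc_of_le hab] at hv)) hint
  have h2 : ∑ j ∈ Finset.range (n + 1), (b - b) ^ j / (j.factorial : ℝ) * D j b = D 0 b := by
    rw [Finset.sum_range_succ']
    simp
  simp only [h2] at h1
  rw [← h1, ← intervalIntegral.integral_const_mul]
  refine (intervalIntegral.abs_integral_le_integral_abs hab).trans ?_
  refine intervalIntegral.integral_mono_on hab hint.abs (hi.abs.const_mul _) fun v hv => ?_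
  have h0 : 0 ≤ b - v := by linarith [hv.2]
  rw [abs_mul, abs_of_nonneg (by positivity)]
  gcongr
  calc (b - v) ^ n / (n.factorial : ℝ) ≤ (b - v) ^ n := by
        apply div_le_self (by positivity)
        exact_mod_cast Nat.one_le_iff_ne_zero.2 n.factorial_ne_zero
    _ ≤ (b - a) ^ n := by gcongr; exact hv.1

/-- The coefficients of a polynomial of degree at most `n` are bounded by its values at `n + 1`
points. -/
theorem exists_abs_coeff_le (n : ℕ) : ∃ C : ℝ, 0 ≤ C ∧ ∀ (c : Fin (n + 1) → ℝ) (K : ℝ),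
    (∀ i : Fin (n + 1), |∑ j, c j * ((i : ℕ) / (n + 1 : ℝ)) ^ (j : ℕ)| ≤ K) →
    ∀ j, |c j| ≤ C * K := by
  -- The nodes i/(n+1) are distinct, so the Vandermonde matrix is invertible and the coefficients
  -- are V⁻¹ applied to the values. The constant is the sum of the absolute values of the entries of
  -- V⁻¹.
  set V : Matrix (Fin (n + 1)) (Fin (n + 1)) ℝ :=
    Matrix.vandermonde fun i => ((i : ℕ) / (n + 1 : ℝ)) with hV
  have hdet : IsUnit V.det := by
    rw [isUnit_iff_ne_zero, hV, Matrix.det_vandermonde_ne_zero_iff]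
    intro i j hij
    have : (n + 1 : ℝ) ≠ 0 := by positivity
    simp only [div_left_inj' this] at hij
    exact Fin.ext (by exact_mod_cast hij)
  refine ⟨∑ j, ∑ i, |V⁻¹ j i|, by positivity, fun c K hK j => ?_⟩
  have hK0 : 0 ≤ K := (abs_nonneg _).trans (hK 0)
  have hc : c = V⁻¹.mulVec (V.mulVec c) := by
    rw [Matrix.mulVec_mulVec, Matrix.nonsing_inv_mul _ hdet, Matrix.one_mulVec]
  have hVc : ∀ i, |V.mulVec c i| ≤ K := fun i => by
    refine le_of_eq_of_le ?_ (hK i)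
    simp only [Matrix.mulVec, dotProduct, hV, Matrix.vandermonde_apply]
    congr 1
    exact Finset.sum_congr rfl fun j _ => mul_comm _ _
  calc |c j| = |∑ i, V⁻¹ j i * V.mulVec c i| := by
        conv_lhs => rw [hc]
        rfl
    _ ≤ ∑ i, |V⁻¹ j i| * K := by
        refine (Finset.abs_sum_le_sum_abs _ _).trans (Finset.sum_le_sum fun i _ => ?_)
        rw [abs_mul]
        exact mul_le_mul_of_nonneg_left (hVc i) (abs_nonneg _)
    _ = (∑ i, |V⁻¹ j i|) * K := by rw [Finset.sum_mul]
    _ ≤ _ := by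
        refine mul_le_mul_of_nonneg_right ?_ hK0
        exact Finset.single_le_sum (f := fun j => ∑ i, |V⁻¹ j i|)
          (fun _ _ => by positivity) (Finset.mem_univ j)

/-- A Landau–Kolmogorov inequality on `[r, 2 r]`. -/
theorem exists_abs_deriv_le (n : ℕ) : ∃ C : ℝ, 0 ≤ C ∧ ∀ (D : ℕ → ℝ → ℝ) (r S I : ℝ), 0 < r →
    (∀ j ≤ n, ∀ v ∈ Icc r (2 * r), HasDerivAt (D j) (D (j + 1) v) v) →
    IntervalIntegrable (D (n + 1)) volume r (2 * r) →
    (∀ v ∈ Icc r (2 * r), |D 0 v| ≤ S) → ∫ v in r..2 * r, |D (n + 1) v| ≤ I →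
    ∀ j ≤ n, |D j r| ≤ C * (S + r ^ n * I) / r ^ j := by
  obtain ⟨C, hC, h⟩ := exists_abs_coeff_le n
  refine ⟨n.factorial * C, by positivity, fun D r S I hr hd hi hS hI j hj => ?_⟩
  have hI0 : 0 ≤ I := le_trans
    (intervalIntegral.integral_nonneg (by linarith) fun _ _ => abs_nonneg _) hI
  have hn1 : (0 : ℝ) < n + 1 := by positivity
  -- The polynomial is the Taylor polynomial of D 0 at r, as a function of x through the point r + x
  -- r. Its values are at most S plus the remainder r^n I, and its coefficients are the derivatives
  -- sought, up to r^j/j!.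
  have key := h (fun j => r ^ (j : ℕ) / ((j : ℕ).factorial : ℝ) * D j r) (S + r ^ n * I)
    (fun i => ?_) ⟨j, by omega⟩
  · simp only at key
    have hjf : (0 : ℝ) < (j.factorial : ℝ) := by positivity
    rw [abs_mul, abs_of_nonneg (by positivity), div_mul_eq_mul_div, div_le_iff₀ hjf] at key
    rw [le_div_iff₀ (by positivity)]
    have hS0 : 0 ≤ S := (abs_nonneg _).trans (hS r ⟨le_rfl, by linarith⟩)
    have hle : (j.factorial : ℝ) ≤ n.factorial := by exact_mod_cast Nat.factorial_le hj
    calc |D j r| * r ^ j = r ^ j * |D j r| := mul_comm _ _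
      _ ≤ C * (S + r ^ n * I) * j.factorial := key
      _ ≤ C * (S + r ^ n * I) * n.factorial := by gcongr
      _ = _ := by ring
  · set x : ℝ := (i : ℕ) / (n + 1 : ℝ) with hx
    have hx0 : 0 ≤ x := by positivity
    have hx1 : x ≤ 1 := by
      rw [hx, div_le_one hn1]
      exact_mod_cast i.2.le
    have hxr : x * r ≤ r := by nlinarith
    have hxr0 : 0 ≤ x * r := by positivity
    have hsub : Icc r (r + x * r) ⊆ Icc r (2 * r) := Icc_subset_Icc le_rfl (by linarith)
    have hsub' : uIcc r (r + x * r) ⊆ uIcc r (2 * r) := by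
      rwa [uIcc_of_le (by linarith), uIcc_of_le (by linarith)]
    have h1 := abs_sub_taylor_le (D := D) (n := n) (a := r) (b := r + x * r) (by linarith)
      (fun j hj v hv => hd j hj v (hsub hv)) (hi.mono_set hsub')
    have h2 : ∫ v in r..r + x * r, |D (n + 1) v| ≤ I := by
      refine le_trans ?_ hI
      refine intervalIntegral.integral_mono_interval le_rfl (by linarith) (by linarith)
        (Filter.Eventually.of_forall fun _ => abs_nonneg _) hi.abs
    have h3 : ∑ j : Fin (n + 1), r ^ (j : ℕ) / ((j : ℕ).factorial : ℝ) * D j r * x ^ (j : ℕ) =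
        ∑ j ∈ Finset.range (n + 1), (r + x * r - r) ^ j / (j.factorial : ℝ) * D j r := by
      rw [Finset.sum_range]
      refine Finset.sum_congr rfl fun j _ => ?_
      rw [add_sub_cancel_left, mul_pow]
      ring
    rw [h3]
    set P := ∑ j ∈ Finset.range (n + 1), (r + x * r - r) ^ j / (j.factorial : ℝ) * D j r
    have h4 : |P| ≤ |D 0 (r + x * r)| + |D 0 (r + x * r) - P| := by
      have := abs_sub (D 0 (r + x * r)) (D 0 (r + x * r) - P)
      simpa using this
    have h5 := hS (r + x * r) ⟨by linarith, by linarith⟩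
    have h6 : (r + x * r - r) ^ n * ∫ v in r..r + x * r, |D (n + 1) v| ≤ r ^ n * I := by
      have : 0 ≤ ∫ v in r..r + x * r, |D (n + 1) v| :=
        intervalIntegral.integral_nonneg (by linarith) fun _ _ => abs_nonneg _
      gcongr
      · linarith
      · linarith
    linarith

/-! ### Derivative bounds for the rescaled profile -/

/-- The rescaled profile `exp (-r ^ γ / g (r t ^ (-1/γ)))`. -/
noncomputable def profile (γ : ℝ) (g : ℝ → ℝ) (t r : ℝ) : ℝ :=
  Real.exp (-(r ^ γ / g (r * t ^ (-1 / γ))))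

/-- Subtracting the profile from 1 gains smallness at the origin: 1 - e^{-x} ≤ x and g ≥ 1 give r^γ.
The Landau–Kolmogorov inequality applied to r^{n-1}(1 - profile) then bounds the derivatives up to
order n, the L¹ bound M contributing the term r. The top derivative has no pointwise bound and is
stored in the weight q. -/
theorem exists_derivBound_one_sub_profile {n : ℕ} (hn : 0 < n) {γ : ℝ} (hγ : 0 ≤ γ) (M : ℝ) :
    ∃ C : ℝ, 0 ≤ C ∧ ∀ (g : ℝ → ℝ) (t : ℝ), 0 < t → (∀ r, 0 ≤ r → 1 ≤ g r) →
      (∀ k ≤ n, DifferentiableOn ℝ (iteratedDeriv k (kernelProfile n γ g t)) (Ioi 0)) →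
      IntegrableOn (iteratedDeriv (n + 1) (kernelProfile n γ g t)) (Ioi 0) →
      ∫ r in Ioi (0 : ℝ), |iteratedDeriv (n + 1) (kernelProfile n γ g t) r| ≤ M →
      DerivBound (fun r => 1 + r * |iteratedDeriv (n + 1) (kernelProfile n γ g t) r|) n
        (fun r => 1 - profile γ g t r) fun r => C * (r + r ^ γ) := by
  obtain ⟨C₀, hC₀, hL⟩ := exists_abs_deriv_le n
  obtain ⟨C₁, hC₁, hP⟩ := DerivBound.add_rpow n (-(n - 1 : ℕ))
  -- The summand 1 is for the top derivative, where r |φ^{(n+1)}| ≤ q enters with coefficient 1; the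
  -- rest is the Landau–Kolmogorov constant with S = (2r)^{n-1}(2r)^γ and I = |M|.
  set C₂ : ℝ := 1 + C₀ * (2 ^ (n - 1) * 2 ^ γ + |M|) with hC₂
  have hC₂1 : 1 ≤ C₂ := by
    have : 0 ≤ C₀ * (2 ^ (n - 1) * 2 ^ γ + |M|) := by positivity
    linarith
  refine ⟨2 ^ (n + 1) * (C₁ * C₂), by positivity, fun g t ht hg hdiff hint hM => ?_⟩
  set φ := kernelProfile n γ g t with hφ
  set q : ℝ → ℝ := fun r => 1 + r * |iteratedDeriv (n + 1) φ r| with hqdef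
  have hq1 : ∀ r, 0 < r → 1 ≤ q r := fun r hr => by
    have : 0 ≤ r * |iteratedDeriv (n + 1) φ r| := by positivity
    linarith
  set D : ℕ → ℝ → ℝ := fun j r => iteratedDeriv j (fun r : ℝ => r ^ (n - 1)) r -
    iteratedDeriv j φ r with hD
  have hDd : ∀ j ≤ n, ∀ r, 0 < r → HasDerivAt (D j) (D (j + 1) r) r := fun j hj r hr => by
    refine HasDerivAt.sub ?_ ?_
    · rw [iteratedDeriv_succ]
      refine (ContDiff.differentiable_iteratedDeriv (n := ⊤) j (by fun_prop) ?_ r).hasDerivAt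
      exact WithTop.coe_lt_top _
    · rw [iteratedDeriv_succ]
      exact ((hdiff j hj).differentiableAt (Ioi_mem_nhds hr)).hasDerivAt
  -- The monomial r^{n-1} is killed by n + 1 derivatives, so replacing the profile by 1 - profile
  -- only changes the sign of the derivative in the kernel condition.
  have hDtop : ∀ r, D (n + 1) r = -iteratedDeriv (n + 1) φ r := fun r => by
    have : iteratedDeriv (n + 1) (fun r : ℝ => r ^ (n - 1)) r = 0 := by
      rw [iteratedDeriv_eq_iterate, iter_deriv_pow,
        Finset.prod_eq_zero (Finset.mem_range.2 (show n - 1 < n + 1 by omega)) (sub_self _),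
        zero_mul]
    simp only [hD, this, zero_sub]
  have hD0 : ∀ r, D 0 r = r ^ (n - 1) * (1 - profile γ g t r) := fun r => by
    simp only [hD, iteratedDeriv_zero, hφ, kernelProfile, profile]
    ring
  have hb : ∀ r, 0 < r → |1 - profile γ g t r| ≤ r ^ γ := fun r hr => by
    have h1 := hg (r * t ^ (-1 / γ)) (by positivity)
    have h2 : r ^ γ / g (r * t ^ (-1 / γ)) ≤ r ^ γ := div_le_self (by positivity) h1
    have h3 : 0 ≤ r ^ γ / g (r * t ^ (-1 / γ)) := by positivity
    have h4 := Real.add_one_le_exp (-(r ^ γ / g (r * t ^ (-1 / γ))))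
    have h5 : Real.exp (-(r ^ γ / g (r * t ^ (-1 / γ)))) ≤ 1 := Real.exp_le_one_iff.2 (by linarith)
    rw [profile, abs_of_nonneg (by linarith)]
    linarith
  have hDb : ∀ j ≤ n, ∀ r, 0 < r → |D j r| ≤ C₂ * (r ^ (n - 1) * (r + r ^ γ)) / r ^ j := by
    intro j hj r hr
    have hsub : uIcc r (2 * r) ⊆ Ioi 0 := by
      rw [uIcc_of_le (by linarith)]
      exact fun v hv => hr.trans_le hv.1
    have hsub' : Ioc r (2 * r) ⊆ Ioi 0 := fun v hv => hr.trans hv.1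
    have hDi : IntervalIntegrable (D (n + 1)) volume r (2 * r) := by
      have : D (n + 1) = -iteratedDeriv (n + 1) φ := funext hDtop
      rw [this]
      exact ((hint.mono_set hsub).intervalIntegrable).neg
    refine (hL D r ((2 * r) ^ (n - 1) * (2 * r) ^ γ) |M| hr
      (fun j hj v hv => hDd j hj v (hr.trans_le hv.1)) hDi (fun v hv => ?_) ?_ j hj).trans ?_
    · have hv0 : 0 < v := hr.trans_le hv.1
      rw [hD0, abs_mul, abs_of_nonneg (a := v ^ (n - 1)) (by positivity)]
      have h1 : v ^ γ ≤ (2 * r) ^ γ := Real.rpow_le_rpow hv0.le hv.2 hγ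
      have h2 := hb v hv0
      gcongr
      · exact hv.2
      · exact h2.trans h1
    · refine le_trans ?_ (hM.trans (le_abs_self M))
      simp_rw [hDtop, abs_neg]
      rw [intervalIntegral.integral_of_le (by linarith)]
      exact setIntegral_mono_set hint.abs (Filter.Eventually.of_forall fun _ => abs_nonneg _)
        (Filter.Eventually.of_forall hsub')
    · have e : r ^ n = r ^ (n - 1) * r := by rw [← pow_succ, Nat.sub_add_cancel hn]
      rw [Real.mul_rpow (by norm_num) hr.le, mul_pow, e]
      refine div_le_div_of_nonneg_right ?_ (by positivity)
      have h1 : 0 ≤ r ^ (n - 1) * r := by positivity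
      have h2 : 0 ≤ r ^ (n - 1) * r ^ γ := by positivity
      have h3 : 0 ≤ (2 : ℝ) ^ (n - 1) * 2 ^ γ := by positivity
      calc C₀ * (2 ^ (n - 1) * r ^ (n - 1) * (2 ^ γ * r ^ γ) + r ^ (n - 1) * r * |M|)
          = C₀ * ((2 ^ (n - 1) * 2 ^ γ) * (r ^ (n - 1) * r ^ γ) + |M| * (r ^ (n - 1) * r)) := by
            ring
        _ ≤ C₀ * ((2 ^ (n - 1) * 2 ^ γ + |M|) * (r ^ (n - 1) * r ^ γ + r ^ (n - 1) * r)) := by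
            gcongr
            nlinarith [mul_nonneg h3 h1, mul_nonneg (abs_nonneg M) h2]
        _ ≤ C₂ * (r ^ (n - 1) * (r + r ^ γ)) := by
            rw [← mul_assoc]
            have : r ^ (n - 1) * r ^ γ + r ^ (n - 1) * r = r ^ (n - 1) * (r + r ^ γ) := by ring
            rw [this]
            gcongr
            linarith
  have hDB : DerivBound q n (D 0) fun r => C₂ * (r ^ (n - 1) * (r + r ^ γ)) := by
    refine DerivBound.of_seq hDd hDb fun r hr => ?_
    rw [hDtop, abs_neg, le_div_iff₀ (by positivity)]
    have e : r ^ (n + 1) = r ^ (n - 1) * r * r := by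
      rw [← pow_succ, Nat.sub_add_cancel hn, pow_succ]
    have h1 : 0 ≤ r ^ γ := by positivity
    calc |iteratedDeriv (n + 1) φ r| * r ^ (n + 1)
        = 1 * (r ^ (n - 1) * r) * (r * |iteratedDeriv (n + 1) φ r|) := by rw [e]; ring
      _ ≤ C₂ * (r ^ (n - 1) * (r + r ^ γ)) * q r := by
        gcongr
        · linarith
        · simp only [hqdef]; linarith
  -- The factor r^{n-1} is removed by multiplying with the power r^{-(n-1)}, whose derivative bounds
  -- are known.
  have hfin := DerivBound.mul hq1 (hP q hq1 0 le_rfl) hDB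
  have hcan : ∀ r : ℝ, 0 < r → (0 + r) ^ (-(n - 1 : ℕ) : ℝ) * r ^ (n - 1) = 1 := fun r hr => by
    rw [zero_add, Real.rpow_neg hr.le, Real.rpow_natCast, inv_mul_cancel₀ (by positivity)]
  refine (hfin.congr_fun fun r hr => ?_).mono (fun r hr => zero_le_one.trans (hq1 r hr))
    fun r hr => le_of_eq ?_
  · rw [hD0, ← mul_assoc, hcan r hr, one_mul]
  · calc 2 ^ (n + 1) * (C₁ * (0 + r) ^ (-(n - 1 : ℕ) : ℝ) * (C₂ * (r ^ (n - 1) * (r + r ^ γ))))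
        = 2 ^ (n + 1) * (C₁ * C₂) * (r + r ^ γ) *
          ((0 + r) ^ (-(n - 1 : ℕ) : ℝ) * r ^ (n - 1)) := by ring
      _ = _ := by rw [hcan r hr, mul_one]


/-! ### Radial symbols as superpositions of Bochner–Riesz symbols -/

/-- A function that decays at infinity is a superposition of the functions `(1 - u / v)₊ ^ n`. -/
theorem eq_integral_of_decay {A : ℕ → ℝ → ℝ} {n : ℕ} (hn : 0 < n)
    (hd : ∀ j ≤ n, ∀ v, 0 < v → HasDerivAt (A j) (A (j + 1) v) v)
    (hlim : ∀ j ≤ n, Filter.Tendsto (fun v => v ^ j * |A j v|) Filter.atTop (nhds 0))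
    (hint : IntegrableOn (fun v => v ^ n * A (n + 1) v) (Ioi 0)) {u : ℝ} (hu : 0 < u) :
    A 0 u = ∫ v in Ioi (0 : ℝ), (max (1 - u / v) 0) ^ n *
      (-(-1) ^ n / (n.factorial : ℝ) * (v ^ n * A (n + 1) v)) := by
  have hpow : ∀ v, u < v → (u - v) ^ n = (-1) ^ n * v ^ n * (max (1 - u / v) 0) ^ n := by
    intro v hv
    have hv0 : 0 < v := hu.trans hv
    have : 0 ≤ 1 - u / v := by
      rw [sub_nonneg, div_le_one hv0]; exact hv.le
    rw [max_eq_left this, ← mul_pow, ← mul_pow]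
    congr 1
    field_simp
    ring
  -- The evaluation point u is fixed and the base point v runs from u to infinity: at v = u the
  -- Taylor sum is A 0 u, and at infinity it vanishes by the decay hypothesis.
  have h1 : ∫ v in Ioi u, (u - v) ^ n / (n.factorial : ℝ) * A (n + 1) v =
      0 - ∑ j ∈ Finset.range (n + 1), (u - u) ^ j / (j.factorial : ℝ) * A j u := by
    refine integral_Ioi_of_hasDerivAt_of_tendsto'
      (fun v hv => hasDerivAt_sum_taylor u fun j hj => hd j hj v (hu.trans_le hv)) ?_ ?_
    · have h2 : IntegrableOn (fun v => (max (1 - u / v) 0) ^ n *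
          ((-1) ^ n / (n.factorial : ℝ) * (v ^ n * A (n + 1) v))) (Ioi u) := by
        refine Integrable.bdd_mul (c := 1)
          ((hint.mono_set (Ioi_subset_Ioi hu.le)).const_mul _) ?_ ?_
        · exact (by fun_prop : Measurable fun v : ℝ => (max (1 - u / v) 0) ^ n).aestronglyMeasurable
        · refine (ae_restrict_mem measurableSet_Ioi).mono fun v hv => ?_
          have hv0 : 0 < v := hu.trans hv
          rw [Real.norm_eq_abs, abs_of_nonneg (by positivity)]
          refine pow_le_one₀ (by positivity) (max_le ?_ zero_le_one)
          have : 0 ≤ u / v := by positivity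
          linarith
      refine h2.congr_fun (fun v hv => ?_) measurableSet_Ioi
      simp only
      rw [hpow v hv]
      ring
    · have h0 : (0 : ℝ) = ∑ j ∈ Finset.range (n + 1), 0 := by simp
      rw [h0]
      refine tendsto_finsetSum _ fun j hj => ?_
      rw [Finset.mem_range] at hj
      refine squeeze_zero_norm' ?_ (hlim j (by omega))
      filter_upwards [Filter.eventually_ge_atTop u] with v hv
      rw [Real.norm_eq_abs, abs_mul]
      gcongr
      rw [abs_div, abs_pow, abs_of_pos (show (0 : ℝ) < j.factorial by positivity)]
      refine (div_le_self (by positivity) ?_).trans ?_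
      · exact_mod_cast Nat.one_le_iff_ne_zero.2 j.factorial_ne_zero
      · gcongr
        rw [abs_le]; constructor <;> linarith
  have h2 : ∑ j ∈ Finset.range (n + 1), (u - u) ^ j / (j.factorial : ℝ) * A j u = A 0 u := by
    rw [Finset.sum_range_succ']
    simp
  rw [h2, zero_sub] at h1
  rw [← neg_neg (A 0 u), ← h1, ← integral_neg]
  symm
  refine (setIntegral_eq_of_subset_of_forall_sdiff_eq_zero measurableSet_Ioi
    (Ioi_subset_Ioi hu.le) fun v hv => ?_).trans ?_
  · have hv0 : 0 < v := hv.1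
    have hvu : v ≤ u := not_lt.1 hv.2
    have : 1 - u / v ≤ 0 := by
      rw [sub_nonpos, one_le_div hv0]; exact hvu
    rw [max_eq_right this, zero_pow hn.ne', zero_mul]
  · refine setIntegral_congr_fun measurableSet_Ioi fun v hv => ?_
    rw [hpow v hv]
    ring

theorem integrableOn_rpow_mul_one_add_rpow {σ : ℝ} (hσ : 0 < σ) (hσ1 : σ ≤ 1) :
    IntegrableOn (fun v : ℝ => v ^ (σ - 1) * (1 + v) ^ (-2 : ℝ)) (Ioi 0) := by
  have hm : Measurable fun v : ℝ => v ^ (σ - 1) * (1 + v) ^ (-2 : ℝ) := by fun_prop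
  rw [← Ioc_union_Ioi_eq_Ioi zero_le_one]
  refine IntegrableOn.union ?_ ?_
  · have h := (intervalIntegral.intervalIntegrable_rpow' (a := 0) (b := 1)
      (show -1 < σ - 1 by linarith)).1
    refine h.mono' hm.aestronglyMeasurable ((ae_restrict_mem measurableSet_Ioc).mono fun v hv => ?_)
    have hv0 : 0 < v := hv.1
    rw [Real.norm_eq_abs, abs_of_nonneg (by positivity)]
    refine mul_le_of_le_one_right (by positivity) ?_
    exact Real.rpow_le_one_of_one_le_of_nonpos (by linarith) (by norm_num)
  · refine (integrableOn_Ioi_rpow_of_lt (show (-2 : ℝ) < -1 by norm_num) one_pos).mono'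
      hm.aestronglyMeasurable ((ae_restrict_mem measurableSet_Ioi).mono fun v hv => ?_)
    have hv1 : 1 < v := hv
    have hv0 : 0 < v := by linarith
    rw [Real.norm_eq_abs, abs_of_nonneg (by positivity)]
    have h1 : v ^ (σ - 1) ≤ 1 := Real.rpow_le_one_of_one_le_of_nonpos hv1.le (by linarith)
    have h2 : (1 + v) ^ (-2 : ℝ) ≤ v ^ (-2 : ℝ) :=
      Real.rpow_le_rpow_of_nonpos hv0 (by linarith) (by norm_num)
    calc v ^ (σ - 1) * (1 + v) ^ (-2 : ℝ) ≤ 1 * v ^ (-2 : ℝ) := by gcongr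
      _ = _ := one_mul _

theorem profile_nonneg (γ : ℝ) (g : ℝ → ℝ) (t r : ℝ) : 0 ≤ profile γ g t r :=
  (Real.exp_pos _).le

theorem profile_le_one {γ : ℝ} {g : ℝ → ℝ} (hg : ∀ r, 0 ≤ r → 1 ≤ g r) {t : ℝ} (ht : 0 < t)
    {r : ℝ} (hr : 0 ≤ r) : profile γ g t r ≤ 1 := by
  have h1 := hg (r * t ^ (-1 / γ)) (by positivity)
  refine Real.exp_le_one_iff.2 (neg_nonpos.2 ?_)
  positivity

/-- The profile decays faster than any power, uniformly in `t`. -/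
theorem exists_profile_le {γ : ℝ} (hγ : 1 ≤ γ) {B : ℝ} (hB : 1 ≤ B) (m : ℕ) : ∃ C : ℝ, 0 ≤ C ∧
    ∀ (g : ℝ → ℝ) (t : ℝ), (∀ r, 0 ≤ r → 1 ≤ g r) → (∀ r, 0 ≤ r → g r ≤ B) → 0 < t →
    ∀ r, 0 ≤ r → profile γ g t r * (1 + r) ^ m ≤ C := by
  have hB0 : 0 < B := by linarith
  refine ⟨2 ^ m * (1 + B ^ m * m.factorial), by positivity, fun g t hg hgB ht r hr => ?_⟩
  rcases le_total r 1 with h1 | h1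
  · have h2 : (1 + r) ^ m ≤ 2 ^ m := by gcongr; linarith
    calc profile γ g t r * (1 + r) ^ m ≤ 1 * 2 ^ m :=
          mul_le_mul (profile_le_one hg ht hr) h2 (by positivity) zero_le_one
      _ ≤ _ := by
        rw [mul_comm]
        gcongr
        have : 0 ≤ B ^ m * m.factorial := by positivity
        linarith
  · have h0 := hg (r * t ^ (-1 / γ)) (by positivity)
    have h2 : r / B ≤ r ^ γ / g (r * t ^ (-1 / γ)) := by
      have : r ≤ r ^ γ := Real.self_le_rpow_of_one_le h1 hγ
      have := hgB (r * t ^ (-1 / γ)) (by positivity)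
      gcongr
    have h3 : (r / B) ^ m / m.factorial ≤ Real.exp (r ^ γ / g (r * t ^ (-1 / γ))) :=
      (Real.pow_div_factorial_le_exp _ (by positivity) m).trans (Real.exp_le_exp.2 h2)
    have hmf : (0 : ℝ) < m.factorial := by positivity
    have h4 : r ^ m ≤ B ^ m * m.factorial * Real.exp (r ^ γ / g (r * t ^ (-1 / γ))) := by
      rw [div_pow, div_div, div_le_iff₀ (by positivity)] at h3
      linarith
    have h5 : (1 + r) ^ m ≤ 2 ^ m * r ^ m := by
      rw [← mul_pow]; gcongr; linarith
    rw [profile, Real.exp_neg, inv_mul_le_iff₀ (Real.exp_pos _)]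
    calc (1 + r) ^ m ≤ 2 ^ m * (B ^ m * m.factorial * Real.exp (r ^ γ / g (r * t ^ (-1 / γ)))) :=
          h5.trans (by gcongr)
      _ ≤ 2 ^ m * ((1 + B ^ m * m.factorial) * Real.exp (r ^ γ / g (r * t ^ (-1 / γ)))) := by
          gcongr; linarith
      _ = _ := by ring

/-- The weight that controls the derivatives of the profile and its primitive is dominated by an
integrable power at `0` and a polynomial at infinity. -/
theorem exists_weight_le (γ : ℝ) (hγ : 1 ≤ γ) (α : ℝ) (hα : 0 ≤ α) (Λ : ℝ) (hΛ : 0 ≤ Λ) (n : ℕ)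
    (a₁ a₂ a₃ a₄ : ℝ) (h₁ : 0 ≤ a₁) (h₂ : 0 ≤ a₂) (h₃ : 0 ≤ a₃) (h₄ : 0 ≤ a₄) :
    ∃ σ : ℝ, 0 < σ ∧ σ ≤ 1 ∧ ∃ (k : ℕ) (K : ℝ), 0 ≤ K ∧ ∀ c, 0 ≤ c → c ≤ Λ → ∀ u, 0 < u →
      (a₁ * ((√u + √u ^ γ) / u * (c + u) ^ α) +
        α * a₂ * ((a₃ + a₄ * (√u + √u ^ γ)) * (c + u) ^ (α - 1))) *
        (a₃ + a₄ * (√u + √u ^ γ)) ^ n ≤ K * u ^ (σ - 1) * (1 + u) ^ k := by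
  obtain ⟨k, hk⟩ := exists_nat_ge (max γ α)
  have hkγ : γ ≤ k := (le_max_left _ _).trans hk
  have hkα : α ≤ k := (le_max_right _ _).trans hk
  -- Near 0 the singularities are √u/u = u^{-1/2} and, in the worst case, (c + u)^{α-1} ≤ u^{α-1}.
  -- The second carries the coefficient α, so it is absent for α = 0.
  set σ : ℝ := if α = 0 then 1 / 2 else min (1 / 2) α with hσ
  have hσ0 : 0 < σ := by
    rw [hσ]
    split_ifs with h
    · norm_num
    · exact lt_min (by norm_num) (lt_of_le_of_ne hα (Ne.symm h))
  have hσ2 : σ ≤ 1 / 2 := by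
    rw [hσ]
    split_ifs with h
    · exact le_rfl
    · exact min_le_left _ _
  set L : ℝ := (1 + Λ) ^ k with hL
  have hL0 : 0 ≤ L := by positivity
  refine ⟨σ, hσ0, by linarith, (k + 1 + k) + k * n,
    (a₁ * 2 * L + α * a₂ * (a₃ + 2 * a₄) * L) * (a₃ + 2 * a₄) ^ n, by positivity,
    fun c hc hcΛ u hu => ?_⟩
  have hu1 : 1 ≤ 1 + u := by linarith
  have hsu : √u ≤ 1 + u := by
    rw [Real.sqrt_le_left (by linarith)]; nlinarith
  have hs0 : 0 < √u := Real.sqrt_pos.2 hu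
  have hP1 : (1 : ℝ) ≤ (1 + u) ^ k := one_le_pow₀ hu1
  have hβ : √u + √u ^ γ ≤ 2 * (√u * (1 + u) ^ k) := by
    have h1 : √u ^ γ = √u * √u ^ (γ - 1) := by
      rw [Real.rpow_sub_one hs0.ne', mul_div_cancel₀ _ hs0.ne']
    have h2 : √u ^ (γ - 1) ≤ (1 + u) ^ k := by
      calc √u ^ (γ - 1) ≤ (1 + u) ^ (γ - 1) := Real.rpow_le_rpow hs0.le hsu (by linarith)
        _ ≤ (1 + u) ^ (k : ℝ) := Real.rpow_le_rpow_of_exponent_le hu1 (by linarith)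
        _ = _ := Real.rpow_natCast _ _
    rw [h1, two_mul]
    gcongr
    nlinarith
  have hβ' : √u + √u ^ γ ≤ 2 * (1 + u) ^ k := by
    have h1 : √u ≤ (1 + u) ^ (k : ℝ) := by
      calc √u ≤ 1 + u := hsu
        _ = (1 + u) ^ (1 : ℝ) := (Real.rpow_one _).symm
        _ ≤ _ := Real.rpow_le_rpow_of_exponent_le hu1 (by linarith)
    have h2 : √u ^ γ ≤ (1 + u) ^ (k : ℝ) := by
      calc √u ^ γ ≤ (1 + u) ^ γ := Real.rpow_le_rpow hs0.le hsu (by linarith)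
        _ ≤ _ := Real.rpow_le_rpow_of_exponent_le hu1 hkγ
    rw [Real.rpow_natCast] at h1 h2
    linarith
  have hsu' : √u / u ≤ u ^ (σ - 1) * (1 + u) := by
    have h1 : √u / u = u ^ (σ - 1) * u ^ (1 / 2 - σ) := by
      rw [← Real.rpow_add hu, Real.sqrt_eq_rpow, ← Real.rpow_sub_one hu.ne']
      congr 1
      ring
    rw [h1]
    gcongr
    calc u ^ (1 / 2 - σ) ≤ (1 + u) ^ (1 / 2 - σ) :=
          Real.rpow_le_rpow hu.le (by linarith) (by linarith)
      _ ≤ (1 + u) ^ (1 : ℝ) := Real.rpow_le_rpow_of_exponent_le hu1 (by linarith)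
      _ = _ := Real.rpow_one _
  have hcu : c + u ≤ (1 + Λ) * (1 + u) := by nlinarith
  have hcu1 : 1 ≤ (1 + Λ) * (1 + u) := by nlinarith
  have hG : ∀ e : ℝ, 0 ≤ e → e ≤ k → (c + u) ^ e ≤ L * (1 + u) ^ k := fun e he hek => by
    calc (c + u) ^ e ≤ ((1 + Λ) * (1 + u)) ^ e := Real.rpow_le_rpow (by linarith) hcu he
      _ ≤ ((1 + Λ) * (1 + u)) ^ (k : ℝ) := Real.rpow_le_rpow_of_exponent_le hcu1 hek
      _ = _ := by rw [Real.rpow_natCast, mul_pow]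
  have hG1 : α * (c + u) ^ (α - 1) ≤ α * (u ^ (σ - 1) * (L * (1 + u) ^ k)) := by
    rcases hα.eq_or_lt with h0 | h0
    · simp [← h0]
    · have hσα : σ ≤ α := by
        rw [hσ, if_neg h0.ne']; exact min_le_right _ _
      gcongr
      have h1 : (c + u) ^ (α - 1) = (c + u) ^ (σ - 1) * (c + u) ^ (α - σ) := by
        rw [← Real.rpow_add (by linarith)]
        congr 1
        ring
      rw [h1]
      exact mul_le_mul (Real.rpow_le_rpow_of_nonpos hu (by linarith) (by linarith))
        (hG _ (by linarith) (by linarith)) (by positivity) (by positivity)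
  have hwE : a₃ + a₄ * (√u + √u ^ γ) ≤ (a₃ + 2 * a₄) * (1 + u) ^ k := by
    calc a₃ + a₄ * (√u + √u ^ γ) ≤ a₃ * (1 + u) ^ k + a₄ * (2 * (1 + u) ^ k) := by
          gcongr
          exact le_mul_of_one_le_right h₃ hP1
      _ = _ := by ring
  have hT1 : a₁ * ((√u + √u ^ γ) / u * (c + u) ^ α) ≤
      a₁ * 2 * L * (u ^ (σ - 1) * (1 + u) ^ (k + 1 + k)) := by
    calc a₁ * ((√u + √u ^ γ) / u * (c + u) ^ α)
        ≤ a₁ * (2 * (√u * (1 + u) ^ k) / u * (L * (1 + u) ^ k)) := by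
          gcongr
          exact hG α hα hkα
      _ = a₁ * 2 * L * ((√u / u) * (1 + u) ^ (k + k)) := by rw [pow_add]; ring
      _ ≤ a₁ * 2 * L * (u ^ (σ - 1) * (1 + u) * (1 + u) ^ (k + k)) := by gcongr
      _ = _ := by ring
  have hT2 : α * a₂ * ((a₃ + a₄ * (√u + √u ^ γ)) * (c + u) ^ (α - 1)) ≤
      α * a₂ * (a₃ + 2 * a₄) * L * (u ^ (σ - 1) * (1 + u) ^ (k + 1 + k)) := by
    calc α * a₂ * ((a₃ + a₄ * (√u + √u ^ γ)) * (c + u) ^ (α - 1))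
        = a₂ * (a₃ + a₄ * (√u + √u ^ γ)) * (α * (c + u) ^ (α - 1)) := by ring
      _ ≤ a₂ * ((a₃ + 2 * a₄) * (1 + u) ^ k) * (α * (u ^ (σ - 1) * (L * (1 + u) ^ k))) := by
          gcongr
      _ = α * a₂ * (a₃ + 2 * a₄) * L * (u ^ (σ - 1) * (1 + u) ^ (k + k)) := by
          rw [pow_add]; ring
      _ ≤ _ := by
          gcongr
          omega
  calc _ ≤ (a₁ * 2 * L * (u ^ (σ - 1) * (1 + u) ^ (k + 1 + k)) +
        α * a₂ * (a₃ + 2 * a₄) * L * (u ^ (σ - 1) * (1 + u) ^ (k + 1 + k))) *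
        ((a₃ + 2 * a₄) * (1 + u) ^ k) ^ n := by
        gcongr
    _ = _ := by rw [mul_pow, ← pow_mul, pow_add _ _ (k * n)]; ring


/-- The substitution r = √v, which turns the integral of the kernel condition into one in the
variable v = r² of the superposition. -/
theorem integrableOn_comp_sqrt {Φ : ℝ → ℝ} (h : IntegrableOn Φ (Ioi 0)) :
    IntegrableOn (fun v : ℝ => v ^ (-1 / 2 : ℝ) * Φ √v) (Ioi 0) ∧
      ∫ v in Ioi (0 : ℝ), v ^ (-1 / 2 : ℝ) * Φ √v = 2 * ∫ v in Ioi (0 : ℝ), Φ v := by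
  have h1 := (integrableOn_Ioi_comp_rpow_iff Φ (p := 1 / 2) (by norm_num)).2 h
  have h2 := integral_comp_rpow_Ioi Φ (p := 1 / 2) (by norm_num)
  have e : (fun v : ℝ => v ^ (-1 / 2 : ℝ) * Φ √v) =
      fun v : ℝ => 2 * ((|(1 / 2 : ℝ)| * v ^ ((1 / 2 : ℝ) - 1)) • Φ (v ^ (1 / 2 : ℝ))) := by
    ext v
    rw [Real.sqrt_eq_rpow, abs_of_pos (by norm_num), smul_eq_mul]
    norm_num
    ring
  rw [e]
  constructor
  · exact Integrable.const_mul h1 2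
  · rw [integral_const_mul, h2]

set_option maxHeartbeats 1000000 in
/-- The symbol `(c + u) ^ α * profile (√u) ^ N` is a superposition of the Bochner–Riesz symbols
`(1 - u / v)₊ ^ n`, with uniform bounds on the density. -/
theorem exists_superposition {n : ℕ} (hn : 0 < n) {γ : ℝ} (hγ : 1 ≤ γ) (M : ℝ) {B : ℝ} (hB : 1 ≤ B)
    {α : ℝ} (hα : 0 ≤ α) {Λ : ℝ} (hΛ : 0 ≤ Λ) {N : ℕ} (hN : n + 2 ≤ N) :
    ∃ C : ℝ, 0 ≤ C ∧ ∀ (g : ℝ → ℝ) (t : ℝ), 0 < t →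
      (∀ r, 0 ≤ r → 1 ≤ g r) → (∀ r, 0 ≤ r → g r ≤ B) →
      (∀ k ≤ n, DifferentiableOn ℝ (iteratedDeriv k (kernelProfile n γ g t)) (Ioi 0)) →
      IntegrableOn (iteratedDeriv (n + 1) (kernelProfile n γ g t)) (Ioi 0) →
      ∫ r in Ioi (0 : ℝ), |iteratedDeriv (n + 1) (kernelProfile n γ g t) r| ≤ M →
      ∀ c, 0 ≤ c → c ≤ Λ → ∃ ν : ℝ → ℝ, IntegrableOn (fun v => (1 + v) ^ n * ν v) (Ioi 0) ∧
        ∫ v in Ioi (0 : ℝ), (1 + v) ^ n * |ν v| ≤ C ∧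
        ∀ u, 0 < u → (c + u) ^ α * profile γ g t √u ^ N =
          ∫ v in Ioi (0 : ℝ), (max (1 - u / v) 0) ^ n * ν v := by
  obtain ⟨m, rfl⟩ : ∃ m, n = m + 1 := ⟨n - 1, by omega⟩
  obtain ⟨Cb, hCb, hb⟩ := exists_derivBound_one_sub_profile hn (zero_le_one.trans hγ) M
  obtain ⟨Cs, hCs, hs⟩ := DerivBound.comp_sqrt (m + 1)
  obtain ⟨C₁, hC₁, h₁⟩ := DerivBound.add_rpow (m + 1) 0
  obtain ⟨C₂, hC₂, h₂⟩ := DerivBound.add_rpow m α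
  obtain ⟨C₃, hC₃, h₃⟩ := DerivBound.add_rpow m (α - 1)
  -- One power of the profile is spent on the first derivative, which is computed by hand below; the
  -- remaining N - 1 ≥ m + 2 powers meet the requirement for m + 1 further derivatives.
  obtain ⟨CP, hCP, hP⟩ := DerivBound.pow_mul m (N - 1) (by omega)
  obtain ⟨σ, hσ0, hσ1, k, K, hK, hw⟩ := exists_weight_le γ hγ α hα Λ hΛ (m + 1)
    (N * 2 ^ (m + 1) * Cs * Cb * C₂) (2 ^ (m + 1) * C₃) (1 + C₁) (Cs * Cb) (by positivity)
    (by positivity) (by positivity) (by positivity)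
  -- The exponent is doubled because 1 + u ≤ (1 + √u)². The decay pays for the growth k of the
  -- weight, the factor (1 + v)^n in the conclusion, and two more powers for integrability.
  obtain ⟨Cp, hCp, hp⟩ := exists_profile_le hγ hB (2 * (k + (m + 1) + 2))
  set I₀ := ∫ v in Ioi (0 : ℝ), v ^ (σ - 1) * (1 + v) ^ (-2 : ℝ) with hI₀
  have hI₀0 : 0 ≤ I₀ := setIntegral_nonneg measurableSet_Ioi fun v hv => by
    have : (0 : ℝ) < v := hv
    positivity
  set K' := CP * K * Cp with hK'
  have hK'0 : 0 ≤ K' := by positivity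
  refine ⟨K' * (I₀ + 2 * |M|), by positivity, fun g t ht hg hgB hdiff hint hM c hc hcΛ => ?_⟩
  set Φ : ℝ → ℝ := fun r => |iteratedDeriv (m + 1 + 1) (kernelProfile (m + 1) γ g t) r| with hΦ
  set q : ℝ → ℝ := fun u => 1 + √u * Φ √u with hq
  have hq1 : ∀ u, 0 < u → 1 ≤ q u := fun u hu => by
    have : 0 ≤ √u * Φ √u := by positivity
    linarith
  have hq0 : ∀ u, 0 < u → 0 ≤ q u := fun u hu => zero_le_one.trans (hq1 u hu)
  set β : ℝ → ℝ := fun u => √u + √u ^ γ with hβ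
  have hβ0 : ∀ u, 0 ≤ β u := fun u => by positivity
  set E : ℝ → ℝ := fun u => profile γ g t √u with hE
  have hE0 : ∀ u, 0 < u → 0 ≤ E u := fun u _ => profile_nonneg _ _ _ _
  have hE1 : ∀ u, 0 < u → E u ≤ 1 := fun u _ => profile_le_one hg ht (Real.sqrt_nonneg u)
  set wE : ℝ → ℝ := fun u => 1 + C₁ + Cs * Cb * β u with hwE
  have hwE1 : ∀ u, 0 < u → 1 ≤ wE u := fun u _ => by
    have : 0 ≤ Cs * Cb * β u := mul_nonneg (by positivity) (hβ0 u)
    simp only [hwE]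
    linarith
  have hqs : ∀ r : ℝ, 0 < r → 1 ≤ 1 + r * Φ r := fun r hr => by
    have : 0 ≤ r * Φ r := by positivity
    linarith
  have hb' : DerivBound q (m + 1) (fun u => 1 - E u) fun u => Cs * (Cb * β u) :=
    hs _ hqs _ _ (hb g t ht hg hdiff hint hM)
  -- Here E = 1 - (1 - E), with the constant 1 treated as a power of exponent 0.
  have hED : DerivBound q (m + 1) E wE := by
    refine (((h₁ q hq1 0 le_rfl).add (hb'.const_mul (-1))).congr_fun fun u hu => ?_).mono hq0
      fun u hu => ?_
    · rw [zero_add, Real.rpow_zero]; ring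
    · rw [zero_add, Real.rpow_zero, abs_neg, abs_one]
      simp only [hwE]
      linarith
  obtain ⟨-, b', hb1, hb2⟩ := hb'
  have hE' : ∀ u, 0 < u → HasDerivAt E (-b' u) u := fun u hu => by
    have := (hb1 u hu).const_sub 1
    simpa using this
  set G : ℝ → ℝ := fun u => (c + u) ^ α with hG
  have hG' : ∀ u, 0 < u → HasDerivAt G (α * (c + u) ^ (α - 1)) u := fun u hu => by
    have h := ((hasDerivAt_id u).const_add c).rpow_const (p := α) (Or.inl (by simp; positivity))
    simpa [mul_comm, mul_assoc] using h
  -- Separating the first derivative matters at the origin: the product rule for weights would give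
  -- a non-integrable 1/u, whereas b', the derivative of 1 - E, is only of size (√u + √u^γ)/u.
  set H : ℝ → ℝ := fun u => (-N : ℝ) * (b' u * G u) + α * (E u * (c + u) ^ (α - 1)) with hH
  have hED' : DerivBound q m E wE := hED.of_succ hq1
  have hHD := ((DerivBound.mul hq1 hb2 (h₂ q hq1 c hc)).const_mul (-N : ℝ)).add
    ((DerivBound.mul hq1 hED' (h₃ q hq1 c hc)).const_mul α)
  have hFD := hP q E H wE _ hq1 hE0 hE1 hwE1 hED' hHD
  have hF' : ∀ u, 0 < u → HasDerivAt (fun u => E u ^ N * G u) (E u ^ (N - 1) * H u) u :=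
    fun u hu => by
      refine (((hE' u hu).fun_pow N).fun_mul (hG' u hu)).congr_deriv ?_
      have : E u ^ N = E u ^ (N - 1) * E u := by rw [← pow_succ, Nat.sub_add_cancel (by omega)]
      rw [this]
      ring
  have hWle : ∀ u, 0 < u → (CP * E u * (|(-N : ℝ)| * (2 ^ (m + 1) * (Cs * (Cb * β u) / u *
      (C₂ * (c + u) ^ α))) + |α| * (2 ^ (m + 1) * (wE u * (C₃ * (c + u) ^ (α - 1))))) *
      wE u ^ (m + 1)) ≤ K' * u ^ (σ - 1) / (1 + u) ^ (m + 1 + 2) := fun u hu => by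
    have h5 : E u * (1 + u) ^ (k + (m + 1) + 2) ≤ Cp := by
      refine le_trans ?_ (hp g t hg hgB ht √u (Real.sqrt_nonneg u))
      have : 1 + u ≤ (1 + √u) ^ 2 := by
        nlinarith [Real.sqrt_nonneg u, Real.sq_sqrt hu.le]
      rw [_root_.pow_mul]
      have := hE0 u hu
      gcongr
    rw [le_div_iff₀ (by positivity), abs_neg, abs_of_nonneg hα, Nat.abs_cast]
    have h6 := hw c hc hcΛ u hu
    have hEu := hE0 u hu
    calc _ = CP * E u * ((N * 2 ^ (m + 1) * Cs * Cb * C₂ * (β u / u * (c + u) ^ α) +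
          α * (2 ^ (m + 1) * C₃) * (wE u * (c + u) ^ (α - 1))) * wE u ^ (m + 1)) *
          (1 + u) ^ (m + 1 + 2) := by ring
      _ ≤ CP * E u * (K * u ^ (σ - 1) * (1 + u) ^ k) * (1 + u) ^ (m + 1 + 2) := by
        gcongr
      _ = CP * K * u ^ (σ - 1) * (E u * (1 + u) ^ (k + (m + 1) + 2)) := by ring
      _ ≤ CP * K * u ^ (σ - 1) * Cp := by gcongr
      _ = _ := by ring
  obtain ⟨D, hD0, hD1, hD2, hD3⟩ := (hFD.mono hq0 hWle).exists_seq
  set A : ℕ → ℝ → ℝ := fun j => Nat.casesOn j (fun u => E u ^ N * G u) D with hA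
  have hAd : ∀ j ≤ m + 1, ∀ u, 0 < u → HasDerivAt (A j) (A (j + 1) u) u := fun j hj u hu => by
    cases j with
    | zero => simpa [hA, hD0] using hF' u hu
    | succ j => simpa [hA] using hD1 j (by omega) u hu
  -- The summand 1 of q gives the integrable power. The summand √v Φ(√v) gives the integrand of the
  -- kernel condition, the surplus v^σ being absorbed by (1 + v)².
  have hdom : ∀ v, 0 < v → (1 + v) ^ (m + 1) * |v ^ (m + 1) * A (m + 1 + 1) v| ≤
      K' * (v ^ (σ - 1) * (1 + v) ^ (-2 : ℝ) + v ^ (-1 / 2 : ℝ) * Φ √v) := fun v hv => by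
    have h5 : |A (m + 1 + 1) v| ≤ _ := hD3 v hv
    have h6 : v ^ σ ≤ (1 + v) ^ 2 := by
      calc v ^ σ ≤ (1 + v) ^ σ := Real.rpow_le_rpow hv.le (by linarith) hσ0.le
        _ ≤ (1 + v) ^ ((2 : ℕ) : ℝ) :=
          Real.rpow_le_rpow_of_exponent_le (by linarith) (by push_cast; linarith)
        _ = _ := Real.rpow_natCast _ _
    have h7 : v ^ (σ - 1) * √v = v ^ (-1 / 2 : ℝ) * v ^ σ := by
      rw [Real.sqrt_eq_rpow, ← Real.rpow_add hv, ← Real.rpow_add hv]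
      congr 1
      ring
    have h8 : (1 + v) ^ (-2 : ℝ) = ((1 + v) ^ 2)⁻¹ := by
      rw [Real.rpow_neg (by positivity)]
      norm_cast
    have hΦ0 : 0 ≤ Φ √v := abs_nonneg _
    calc (1 + v) ^ (m + 1) * |v ^ (m + 1) * A (m + 1 + 1) v|
        = (1 + v) ^ (m + 1) * (v ^ (m + 1) * |A (m + 1 + 1) v|) := by
          rw [abs_mul, abs_of_nonneg (show 0 ≤ v ^ (m + 1) by positivity)]
      _ ≤ (1 + v) ^ (m + 1) * (v ^ (m + 1) *
          (K' * v ^ (σ - 1) / (1 + v) ^ (m + 1 + 2) * q v / v ^ (m + 1))) := by gcongr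
      _ = K' * (v ^ (σ - 1) * ((1 + v) ^ 2)⁻¹ + (v ^ (σ - 1) * √v) * ((1 + v) ^ 2)⁻¹ * Φ √v) := by
          simp only [hq]
          field_simp
          ring
      _ ≤ K' * (v ^ (σ - 1) * ((1 + v) ^ 2)⁻¹ + v ^ (-1 / 2 : ℝ) * Φ √v) := by
          rw [h7]
          gcongr
          rw [mul_assoc]
          refine mul_le_of_le_one_right (by positivity) ?_
          rw [← div_eq_mul_inv]
          exact div_le_one_of_le₀ h6 (by positivity)
      _ = _ := by rw [h8]
  obtain ⟨hi1, hi2⟩ := integrableOn_comp_sqrt (Φ := Φ) hint.abs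
  have hdomi := ((integrableOn_rpow_mul_one_add_rpow hσ0 hσ1).add hi1).const_mul K'
  -- The top derivative need not be continuous, but it is a derivative and therefore measurable.
  have hmeas : AEStronglyMeasurable (A (m + 1 + 1)) (volume.restrict (Ioi 0)) := by
    refine (aestronglyMeasurable_deriv (A (m + 1)) _).congr ?_
    exact (ae_restrict_mem measurableSet_Ioi).mono fun v hv => (hAd (m + 1) le_rfl v hv).deriv
  have hintA : IntegrableOn (fun v => (1 + v) ^ (m + 1) * (v ^ (m + 1) * A (m + 1 + 1) v))
      (Ioi 0) := by
    refine hdomi.mono' ?_ ((ae_restrict_mem measurableSet_Ioi).mono fun v hv => ?_)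
    · exact (by fun_prop : Continuous fun v : ℝ => (1 + v) ^ (m + 1)).aestronglyMeasurable.mul
        ((by fun_prop : Continuous fun v : ℝ => v ^ (m + 1)).aestronglyMeasurable.mul hmeas)
    · have hv0 : 0 < v := hv
      rw [Real.norm_eq_abs, abs_mul, abs_of_nonneg (show 0 ≤ (1 + v) ^ (m + 1) by positivity)]
      exact hdom v hv
  refine ⟨fun v => -(-1) ^ (m + 1) / ((m + 1).factorial : ℝ) * (v ^ (m + 1) * A (m + 1 + 1) v),
    ?_, ?_, fun u hu => ?_⟩
  · have := Integrable.const_mul hintA (-(-1) ^ (m + 1) / ((m + 1).factorial : ℝ))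
    refine this.congr (Filter.Eventually.of_forall fun v => ?_)
    simp only
    ring
  · have hfac : |(-(-1) ^ (m + 1) / ((m + 1).factorial : ℝ))| ≤ 1 := by
      rw [abs_div, abs_neg, abs_pow, abs_neg, abs_one, one_pow, Nat.abs_cast]
      refine div_le_one_of_le₀ ?_ (by positivity)
      exact_mod_cast Nat.one_le_iff_ne_zero.2 (m + 1).factorial_ne_zero
    calc _ ≤ ∫ v in Ioi (0 : ℝ), K' * (v ^ (σ - 1) * (1 + v) ^ (-2 : ℝ) +
          v ^ (-1 / 2 : ℝ) * Φ √v) := by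
          refine integral_mono_of_nonneg ?_ hdomi ?_
          · refine (ae_restrict_mem measurableSet_Ioi).mono fun v hv => ?_
            have hv0 : 0 < v := hv
            show (0 : ℝ) ≤ _
            positivity
          · refine (ae_restrict_mem measurableSet_Ioi).mono fun v hv => ?_
            have hv0 : 0 < v := hv
            refine le_trans ?_ (hdom v hv)
            simp only
            rw [abs_mul (-(-1) ^ (m + 1) / ((m + 1).factorial : ℝ))]
            gcongr
            exact mul_le_of_le_one_left (abs_nonneg _) hfac
      _ = K' * (I₀ + 2 * ∫ v in Ioi (0 : ℝ), Φ v) := by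
          rw [integral_const_mul, integral_add (integrableOn_rpow_mul_one_add_rpow hσ0 hσ1) hi1,
            hi2]
      _ ≤ _ := by
          gcongr
          exact hM.trans (le_abs_self M)
  · refine Eq.trans (mul_comm _ _) (eq_integral_of_decay hn hAd ?_ ?_ hu)
    · intro j hj
      cases j with
      | zero =>
        obtain ⟨l, hl⟩ := exists_nat_ge α
        obtain ⟨Cl, hCl, hpl⟩ := exists_profile_le hγ hB (2 * (l + 1))
        refine squeeze_zero' (Filter.Eventually.of_forall fun v => by positivity)
          (g := fun v => (1 + Λ) ^ l * Cl * v⁻¹) ?_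
          (by simpa using tendsto_inv_atTop_zero.const_mul ((1 + Λ) ^ l * Cl))
        filter_upwards [Filter.eventually_ge_atTop 1] with v hv
        have hv0 : 0 < v := by linarith
        have h5 : E v * (1 + v) ^ (l + 1) ≤ Cl := by
          refine le_trans ?_ (hpl g t hg hgB ht √v (Real.sqrt_nonneg v))
          have : 1 + v ≤ (1 + √v) ^ 2 := by
            nlinarith [Real.sqrt_nonneg v, Real.sq_sqrt hv0.le]
          rw [_root_.pow_mul]
          have := hE0 v hv0
          gcongr
        have h6 : G v ≤ (1 + Λ) ^ l * (1 + v) ^ l := by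
          calc (c + v) ^ α ≤ ((1 + Λ) * (1 + v)) ^ α :=
                Real.rpow_le_rpow (by linarith) (by nlinarith) hα
            _ ≤ ((1 + Λ) * (1 + v)) ^ (l : ℝ) :=
                Real.rpow_le_rpow_of_exponent_le (by nlinarith) hl
            _ = _ := by rw [Real.rpow_natCast, mul_pow]
        have hEv := hE0 v hv0
        have hGv : 0 ≤ G v := by positivity
        have h7 : E v ^ N ≤ E v := by
          calc E v ^ N ≤ E v ^ 1 := pow_le_pow_of_le_one hEv (hE1 v hv0) (by omega)
            _ = E v := pow_one _
        rw [pow_zero, one_mul, ← div_eq_mul_inv, le_div_iff₀ hv0]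
        change |E v ^ N * G v| * v ≤ _
        rw [abs_of_nonneg (by positivity)]
        calc E v ^ N * G v * v ≤ E v * ((1 + Λ) ^ l * (1 + v) ^ l) * (1 + v) := by
              gcongr
              linarith
          _ = (1 + Λ) ^ l * (E v * (1 + v) ^ (l + 1)) := by ring
          _ ≤ _ := by gcongr
      | succ j =>
        refine squeeze_zero' (g := fun v => K' * v⁻¹) ?_ ?_
          (by simpa using tendsto_inv_atTop_zero.const_mul K')
        · filter_upwards [Filter.eventually_ge_atTop 0] with v hv
          positivity
        · filter_upwards [Filter.eventually_ge_atTop 1] with v hv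
          have hv0 : 0 < v := by linarith
          have h5 : |A (j + 1) v| ≤ _ := hD2 j (by omega) v hv0
          have h6 : v * v ^ (σ - 1) ≤ 1 + v := by
            rw [Real.rpow_sub_one hv0.ne', mul_div_cancel₀ _ hv0.ne']
            calc v ^ σ ≤ v ^ (1 : ℝ) := Real.rpow_le_rpow_of_exponent_le hv hσ1
              _ ≤ 1 + v := by rw [Real.rpow_one]; linarith
          have h7 : (1 + v) * v ≤ (1 + v) ^ (m + 1 + 2) := by
            calc (1 + v) * v ≤ (1 + v) ^ 2 := by nlinarith
              _ ≤ _ := pow_le_pow_right₀ (by linarith) (by omega)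
          calc v ^ (j + 1) * |A (j + 1) v|
              ≤ v ^ (j + 1) * (K' * v ^ (σ - 1) / (1 + v) ^ (m + 1 + 2) / v ^ j) := by gcongr
            _ = K' * (v * v ^ (σ - 1)) / (1 + v) ^ (m + 1 + 2) := by
                field_simp
                ring
            _ ≤ K' * (1 + v) / ((1 + v) * v) := by gcongr
            _ = K' * v⁻¹ := by field_simp
    · refine Integrable.mono hintA ((by fun_prop : Continuous fun v : ℝ =>
        v ^ (m + 1)).aestronglyMeasurable.mul hmeas) ((ae_restrict_mem measurableSet_Ioi).mono
        fun v hv => ?_)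
      have hv0 : 0 < v := hv
      rw [Real.norm_eq_abs, Real.norm_eq_abs, abs_mul ((1 + v) ^ (m + 1)),
        abs_of_nonneg (show 0 ≤ (1 + v) ^ (m + 1) by positivity)]
      exact le_mul_of_one_le_left (abs_nonneg _) (one_le_pow₀ (by linarith))


/-! ### Laplace inversion on the line Re z = 1 -/

theorem integrableOn_pow_mul_exp_neg (n : ℕ) :
    IntegrableOn (fun w : ℝ => w ^ n * Real.exp (-w)) (Ioi 0) := by
  refine (Real.GammaIntegral_convergent (s := n + 1) (by positivity)).congr_fun (fun w hw => ?_)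
    measurableSet_Ioi
  simp only
  rw [add_sub_cancel_right, Real.rpow_natCast, mul_comm]

theorem norm_exp_neg_mul_ofReal {z : ℂ} (hz : z.re = 1) (w : ℝ) :
    ‖Complex.exp (-(z * w))‖ = Real.exp (-w) := by
  rw [Complex.norm_exp]
  simp [hz]

theorem integral_pow_mul_cexp_neg {z : ℂ} (hz : z.re = 1) (n : ℕ) :
    IntegrableOn (fun w : ℝ => (w : ℂ) ^ n * Complex.exp (-(z * w))) (Ioi 0) ∧
      ∫ w in Ioi (0 : ℝ), (w : ℂ) ^ n * Complex.exp (-(z * w)) = n.factorial / z ^ (n + 1) := by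
  have hz0 : z ≠ 0 := by rintro rfl; simp at hz
  have hint : ∀ n : ℕ,
      IntegrableOn (fun w : ℝ => (w : ℂ) ^ n * Complex.exp (-(z * w))) (Ioi 0) := fun n => by
    refine (integrableOn_pow_mul_exp_neg n).mono'
      (by fun_prop : Continuous fun w : ℝ => (w : ℂ) ^ n * Complex.exp (-(z * w))).aestronglyMeasurable
      ((ae_restrict_mem measurableSet_Ioi).mono fun w hw => ?_)
    have hw0 : 0 < w := hw
    rw [norm_mul, norm_pow, norm_exp_neg_mul_ofReal hz, Complex.norm_real, Real.norm_eq_abs,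
      abs_of_pos hw0]
  have hder : ∀ (n : ℕ) (w : ℝ), HasDerivAt (fun w : ℝ => (w : ℂ) ^ n * Complex.exp (-(z * w)))
      (n * (w : ℂ) ^ (n - 1) * Complex.exp (-(z * w)) -
        z * ((w : ℂ) ^ n * Complex.exp (-(z * w)))) w := fun n w => by
    have h1 : HasDerivAt (fun w : ℝ => (w : ℂ)) 1 w := Complex.ofRealCLM.hasDerivAt
    refine ((h1.fun_pow n).fun_mul ((h1.const_mul z).fun_neg.cexp)).congr_deriv ?_
    ring
  have hlim : ∀ n : ℕ, Filter.Tendsto (fun w : ℝ => (w : ℂ) ^ n * Complex.exp (-(z * w)))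
      Filter.atTop (nhds 0) := fun n => by
    refine squeeze_zero_norm' ?_ (Real.tendsto_pow_mul_exp_neg_atTop_nhds_zero n)
    filter_upwards [Filter.eventually_ge_atTop 0] with w hw
    rw [norm_mul, norm_pow, norm_exp_neg_mul_ofReal hz, Complex.norm_real, Real.norm_eq_abs,
      abs_of_nonneg hw]
  refine ⟨hint n, ?_⟩
  induction n with
  | zero =>
    have h := integral_Ioi_of_hasDerivAt_of_tendsto' (a := (0 : ℝ)) (fun w _ => hder 0 w)
      (by simpa [IntegrableOn] using (hint 0).const_mul (-z)) (hlim 0)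
    simp only [Nat.cast_zero, zero_mul, zero_sub, integral_neg, integral_const_mul] at h
    simp only [pow_zero, one_mul, Complex.ofReal_zero, mul_zero, neg_zero, Complex.exp_zero] at h
    simp only [pow_zero, one_mul, Nat.factorial_zero, Nat.cast_one, zero_add, pow_one]
    rw [eq_div_iff hz0]
    linear_combination -h
  | succ n ih =>
    have hi : IntegrableOn (fun w : ℝ => ((n + 1 : ℕ) : ℂ) * (w : ℂ) ^ (n + 1 - 1) *
        Complex.exp (-(z * w))) (Ioi 0) := by
      simpa [mul_assoc, IntegrableOn] using (hint n).const_mul ((n + 1 : ℕ) : ℂ)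
    have h := integral_Ioi_of_hasDerivAt_of_tendsto' (a := (0 : ℝ)) (fun w _ => hder (n + 1) w)
      (hi.sub ((hint (n + 1)).const_mul z)) (hlim (n + 1))
    rw [integral_sub hi ((hint (n + 1)).const_mul z), integral_const_mul] at h
    simp only [Nat.add_sub_cancel, mul_assoc, integral_const_mul] at h
    rw [ih] at h
    simp only [Complex.ofReal_zero, zero_pow (Nat.succ_ne_zero n), zero_mul, sub_zero] at h
    rw [Nat.factorial_succ, eq_div_iff (pow_ne_zero _ hz0)]
    have h2 : ((n + 1 : ℕ) : ℂ) * (n.factorial / z ^ (n + 1)) * z ^ (n + 1) =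
        (n + 1 : ℕ) * n.factorial := by
      field_simp
    push_cast at h h2 ⊢
    linear_combination (-z ^ (n + 1)) * h + h2

/-- The complex number `1 + 2 π i τ` on the Bromwich line. -/
noncomputable def bromwich (τ : ℝ) : ℂ := 1 + 2 * Real.pi * τ * Complex.I

@[simp] theorem bromwich_re (τ : ℝ) : (bromwich τ).re = 1 := by simp [bromwich]

theorem bromwich_ne_zero (τ : ℝ) : bromwich τ ≠ 0 := fun h => by
  have := bromwich_re τ
  simp [h] at this

theorem one_add_sq_le_norm_bromwich_sq (τ : ℝ) : 1 + τ ^ 2 ≤ ‖bromwich τ‖ ^ 2 := by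
  rw [Complex.sq_norm, Complex.normSq_apply]
  have h1 : (bromwich τ).im = 2 * Real.pi * τ := by simp [bromwich]
  rw [h1, bromwich_re]
  have h2 : 1 ≤ (2 * Real.pi) ^ 2 := by nlinarith [Real.pi_gt_three]
  nlinarith [mul_le_mul_of_nonneg_right h2 (sq_nonneg τ)]

theorem continuous_bromwich : Continuous bromwich := by
  unfold bromwich
  fun_prop

/-- Since |z| ≥ (1 + τ²)^{1/2}, the integrand is at most (1 + τ²)^{-3/4}. The exponent -3/2 is the
one that occurs in dimension 1 below. -/
theorem integrable_norm_bromwich_rpow {r : ℝ} (hr : r ≤ -(3 / 2)) :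
    Integrable fun τ => ‖bromwich τ‖ ^ r := by
  have h := integrable_rpow_neg_one_add_norm_sq (E := ℝ) (μ := volume) (r := 3 / 2)
    (by simp; norm_num)
  refine h.mono' ?_ (Filter.Eventually.of_forall fun τ => ?_)
  · exact ((continuous_bromwich.norm.rpow_const fun τ =>
      Or.inl (norm_ne_zero_iff.2 (bromwich_ne_zero τ)))).aestronglyMeasurable
  · have h1 := one_add_sq_le_norm_bromwich_sq τ
    have h0 : 0 < ‖bromwich τ‖ := norm_pos_iff.2 (bromwich_ne_zero τ)
    have h2 : 1 ≤ ‖bromwich τ‖ := by nlinarith [sq_nonneg τ]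
    rw [Real.norm_eq_abs, abs_of_nonneg (by positivity), Real.norm_eq_abs, sq_abs]
    calc ‖bromwich τ‖ ^ r ≤ ‖bromwich τ‖ ^ (-(3 / 2) : ℝ) :=
          Real.rpow_le_rpow_of_exponent_le h2 hr
      _ = (‖bromwich τ‖ ^ 2) ^ (-(3 / 2) / 2 : ℝ) := by
          rw [← Real.rpow_natCast, ← Real.rpow_mul h0.le]
          norm_num
      _ ≤ _ := Real.rpow_le_rpow_of_nonpos (by positivity) h1 (by norm_num)

/-- Inversion of the Laplace transform of `w ↦ w₊ ^ n`. -/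
theorem ofReal_max_pow_eq_integral {n : ℕ} (hn : 0 < n) (w : ℝ) :
    (((max w 0) ^ n : ℝ) : ℂ) =
      ∫ τ, n.factorial / bromwich τ ^ (n + 1) * Complex.exp (bromwich τ * w) := by
  -- Damping by e^{-w} makes w₊^n integrable and turns its Fourier transform into the Laplace
  -- transform n!/z^{n+1} on the line Re z = 1. Fourier inversion applies, and multiplying by e^w
  -- undoes the damping. Continuity at 0 uses n > 0.
  set f : ℝ → ℂ := fun w => (((max w 0) ^ n * Real.exp (-w) : ℝ) : ℂ) with hf
  have hfc : Continuous f := by fun_prop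
  have hfs : ∀ w, w ∉ Ioi (0 : ℝ) → f w = 0 := fun w hw => by
    have : max w 0 = 0 := max_eq_right (not_lt.1 hw)
    simp [hf, this, hn.ne']
  have hfi : Integrable f := by
    have h1 : IntegrableOn f (Ioi 0) := by
      refine IntegrableOn.congr_fun (f := fun w : ℝ => ((w ^ n * Real.exp (-w) : ℝ) : ℂ))
        (integrableOn_pow_mul_exp_neg n).ofReal (fun w hw => ?_) measurableSet_Ioi
      simp [hf, max_eq_left (le_of_lt (mem_Ioi.1 hw))]
    rwa [integrableOn_iff_integrable_of_support_subset] at h1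
    intro w hw
    by_contra h
    exact hw (hfs w h)
  have hF : ∀ τ, 𝓕 f τ = n.factorial / bromwich τ ^ (n + 1) := fun τ => by
    rw [Real.fourier_real_eq_integral_exp_smul, ← (integral_pow_mul_cexp_neg (bromwich_re τ) n).2,
      ← setIntegral_eq_integral_of_forall_compl_eq_zero (s := Ioi 0)
        (fun w hw => by rw [hfs w hw, smul_zero])]
    refine setIntegral_congr_fun measurableSet_Ioi fun w hw => ?_
    simp only [hf, max_eq_left (le_of_lt (mem_Ioi.1 hw)), smul_eq_mul]
    push_cast
    rw [mul_left_comm, ← Complex.exp_add]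
    congr 2
    simp only [bromwich]
    ring
  have hFi : Integrable (𝓕 f) := by
    have h1 := (integrable_norm_bromwich_rpow (r := -((n + 1 : ℕ) : ℝ)) (by
      have : (1 : ℝ) ≤ n := by exact_mod_cast hn
      push_cast
      linarith)).const_mul (n.factorial : ℝ)
    refine h1.mono' ?_ (Filter.Eventually.of_forall fun τ => ?_)
    · rw [funext hF]
      exact (continuous_const.div (continuous_bromwich.pow _) fun τ =>
        pow_ne_zero _ (bromwich_ne_zero τ)).aestronglyMeasurable
    · rw [hF, norm_div, norm_pow, Real.rpow_neg (norm_nonneg _), Real.rpow_natCast]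
      simp [div_eq_mul_inv]
  have hinv := congrFun (hfc.fourierInv_fourier_eq hfi hFi) w
  rw [Real.fourierInv_eq'] at hinv
  have hexp : Complex.exp w * Complex.exp (-w) = 1 := by rw [← Complex.exp_add]; simp
  calc (((max w 0) ^ n : ℝ) : ℂ) = Complex.exp w * f w := by
        simp only [hf]
        push_cast
        linear_combination -((max w 0 : ℝ) : ℂ) ^ n * hexp
    _ = _ := by
        rw [← hinv, ← integral_const_mul]
        refine integral_congr_ae (Filter.Eventually.of_forall fun τ => ?_)
        simp only [hF, smul_eq_mul]
        rw [← mul_assoc, ← Complex.exp_add, mul_comm]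
        congr 2
        simp [bromwich]
        ring


/-! ### Integrability of the Bochner–Riesz kernel -/

theorem integrable_exp_neg_mul_sq_norm (n : ℕ) {b : ℝ} (hb : 0 < b) :
    Integrable fun ξ : EuclideanSpace ℝ (Fin n) => Real.exp (-b * ‖ξ‖ ^ 2) := by
  have h := (GaussianFourier.integrable_cexp_neg_mul_sq_norm_add
    (V := EuclideanSpace ℝ (Fin n)) (b := (b : ℂ)) (by simpa using hb) 0 0).norm
  refine h.congr (Filter.Eventually.of_forall fun ξ => ?_)
  simp only [zero_mul, add_zero, Complex.norm_exp]
  congr 1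
  norm_cast

/-- The Bochner–Riesz symbol of order `n` on `ℝⁿ`. -/
noncomputable def bochnerRiesz (n : ℕ) (ξ : EuclideanSpace ℝ (Fin n)) : ℂ :=
  (((max (1 - ‖ξ‖ ^ 2) 0) ^ n : ℝ) : ℂ)

theorem continuous_bochnerRiesz (n : ℕ) : Continuous (bochnerRiesz n) := by
  unfold bochnerRiesz
  fun_prop

theorem integrable_bochnerRiesz {n : ℕ} (hn : 0 < n) : Integrable (bochnerRiesz n) := by
  -- The Gaussian e · exp(-‖ξ‖²) is at least 1 on the unit ball, where the symbol lives.
  refine ((integrable_exp_neg_mul_sq_norm n one_pos).const_mul (Real.exp 1)).mono'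
    (continuous_bochnerRiesz n).aestronglyMeasurable (Filter.Eventually.of_forall fun ξ => ?_)
  rw [bochnerRiesz, Complex.norm_real, Real.norm_eq_abs, abs_of_nonneg (by positivity),
    ← Real.exp_add]
  rcases le_total (‖ξ‖ ^ 2) 1 with h | h
  · calc (max (1 - ‖ξ‖ ^ 2) 0) ^ n ≤ 1 := by
          refine pow_le_one₀ (by positivity) (max_le ?_ zero_le_one)
          nlinarith [sq_nonneg ‖ξ‖]
      _ ≤ _ := Real.one_le_exp (by linarith)
  · rw [max_eq_right (by linarith), zero_pow hn.ne']
    positivity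

theorem norm_inv_bromwich_re (τ : ℝ) : ((bromwich τ)⁻¹).re = (‖bromwich τ‖ ^ 2)⁻¹ := by
  rw [Complex.inv_re, bromwich_re, Complex.sq_norm, one_div]

/-- Laplace inversion at w = 1 - ‖ξ‖² exhibits the symbol as a superposition of complex Gaussians
exp(-z‖ξ‖²) with Re z = 1, whose transforms are explicit. Fubini holds because |exp(-z‖ξ‖²)| =
exp(-‖ξ‖²) does not depend on τ. -/
theorem fourierInv_bochnerRiesz {n : ℕ} (hn : 0 < n) (x : EuclideanSpace ℝ (Fin n)) :
    𝓕⁻ (bochnerRiesz n) x = ∫ τ, n.factorial / bromwich τ ^ (n + 1) * Complex.exp (bromwich τ) *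
      ((Real.pi / bromwich τ) ^ (n / 2 : ℂ) *
        Complex.exp (-Real.pi ^ 2 * ‖x‖ ^ 2 / bromwich τ)) := by
  have hbr : ∀ ξ, bochnerRiesz n ξ = ∫ τ, n.factorial / bromwich τ ^ (n + 1) *
      Complex.exp (bromwich τ * (1 - ‖ξ‖ ^ 2 : ℝ)) := fun ξ => ofReal_max_pow_eq_integral hn _
  rw [Real.fourierInv_eq']
  simp_rw [hbr, smul_eq_mul, ← integral_const_mul]
  have hdom := (integrable_exp_neg_mul_sq_norm n one_pos).mul_prod
    ((integrable_norm_bromwich_rpow (r := -((n + 1 : ℕ) : ℝ)) (by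
      have : (1 : ℝ) ≤ n := by exact_mod_cast hn
      push_cast
      linarith)).const_mul (n.factorial * Real.exp 1 : ℝ))
  rw [integral_integral_swap]
  · refine integral_congr_ae (Filter.Eventually.of_forall fun τ => ?_)
    have hg := fourier_gaussian_innerProductSpace (V := EuclideanSpace ℝ (Fin n))
      (b := bromwich τ) (by simp) (-x)
    rw [← Real.fourierInv_eq_fourier_neg, Real.fourierInv_eq', norm_neg, finrank_euclideanSpace,
      Fintype.card_fin] at hg
    simp only [smul_eq_mul] at hg
    simp only
    rw [← hg, ← integral_const_mul]
    refine integral_congr_ae (Filter.Eventually.of_forall fun ξ => ?_)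
    simp only
    have : Complex.exp (bromwich τ * (1 - ‖ξ‖ ^ 2 : ℝ)) =
        Complex.exp (bromwich τ) * Complex.exp (-bromwich τ * ‖ξ‖ ^ 2) := by
      rw [← Complex.exp_add]
      congr 1
      push_cast
      ring
    rw [this]
    ring
  · refine hdom.mono' ?_ (Filter.Eventually.of_forall fun ⟨ξ, τ⟩ => ?_)
    · have hb := continuous_bromwich
      have : ∀ τ, bromwich τ ^ (n + 1) ≠ 0 := fun τ => pow_ne_zero _ (bromwich_ne_zero τ)
      refine Continuous.aestronglyMeasurable ?_
      simp only [Function.uncurry_def]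
      refine Continuous.mul (by fun_prop) (Continuous.mul ?_ (by fun_prop))
      exact continuous_const.div (by fun_prop) fun p => this _
    · simp only [Function.uncurry]
      rw [norm_mul, norm_mul, norm_div, Complex.norm_exp_ofReal_mul_I, one_mul, norm_pow,
        Complex.norm_exp, Real.rpow_neg (norm_nonneg _), Real.rpow_natCast, Complex.norm_natCast]
      have : (bromwich τ * (1 - ‖ξ‖ ^ 2 : ℝ)).re = 1 + -1 * ‖ξ‖ ^ 2 := by
        rw [Complex.re_mul_ofReal, bromwich_re]; ring
      rw [this, Real.exp_add]
      exact le_of_eq (by ring)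

/-- The transformed Gaussian has L¹ norm |z|^{n/2}, because Re(1/z) = 1/|z|² when Re z = 1. Against
the density |z|^{-(n+1)} this leaves |z|^{-1-n/2}, integrable in τ for n ≥ 1. -/
theorem integrable_fourierInv_bochnerRiesz {n : ℕ} (hn : 0 < n) :
    Integrable (𝓕⁻ (bochnerRiesz n)) := by
  set J : EuclideanSpace ℝ (Fin n) × ℝ → ℂ := fun p =>
    n.factorial / bromwich p.2 ^ (n + 1) * Complex.exp (bromwich p.2) *
      ((Real.pi / bromwich p.2) ^ (n / 2 : ℂ) *
        Complex.exp (-Real.pi ^ 2 * ‖p.1‖ ^ 2 / bromwich p.2)) with hJ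
  have hnorm : ∀ x τ, ‖J (x, τ)‖ = n.factorial * Real.exp 1 * (‖bromwich τ‖ ^ (n + 1))⁻¹ *
      (Real.pi / ‖bromwich τ‖) ^ (n / 2 : ℝ) *
        Real.exp (-(Real.pi ^ 2 / ‖bromwich τ‖ ^ 2) * ‖x‖ ^ 2) := fun x τ => by
    have h1 : (-(Real.pi : ℂ) ^ 2 * ‖x‖ ^ 2 / bromwich τ) =
        ((-Real.pi ^ 2 * ‖x‖ ^ 2 : ℝ) : ℂ) * (bromwich τ)⁻¹ := by
      push_cast; rw [div_eq_mul_inv]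
    have h2 : ((n : ℂ) / 2) = ((n / 2 : ℝ) : ℂ) := by push_cast; rfl
    simp only [hJ]
    rw [h1, h2, norm_mul, norm_mul, norm_mul, norm_div, norm_pow, Complex.norm_exp,
      Complex.norm_exp, Complex.norm_cpow_real, Complex.norm_natCast, bromwich_re,
      Complex.re_ofReal_mul, norm_inv_bromwich_re, norm_div, Complex.norm_real, Real.norm_eq_abs,
      abs_of_pos Real.pi_pos]
    rw [show -Real.pi ^ 2 * ‖x‖ ^ 2 * (‖bromwich τ‖ ^ 2)⁻¹ =
      -(Real.pi ^ 2 / ‖bromwich τ‖ ^ 2) * ‖x‖ ^ 2 by ring]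
    ring
  have hpos : ∀ τ, 0 < Real.pi ^ 2 / ‖bromwich τ‖ ^ 2 := fun τ => by
    have : 0 < ‖bromwich τ‖ := norm_pos_iff.2 (bromwich_ne_zero τ)
    positivity
  have hJm : Measurable J := by
    have hb := continuous_bromwich.measurable
    simp only [hJ]
    fun_prop
  have hJi : Integrable J (volume.prod volume) := by
    rw [integrable_prod_iff' hJm.aestronglyMeasurable]
    constructor
    · refine Filter.Eventually.of_forall fun τ => ?_
      refine (((integrable_exp_neg_mul_sq_norm n (hpos τ)).const_mul _).congr
        (Filter.Eventually.of_forall fun x => (hnorm x τ).symm)).mono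
        (hJm.comp (by fun_prop : Measurable fun x : EuclideanSpace ℝ (Fin n) =>
          (x, τ))).aestronglyMeasurable (Filter.Eventually.of_forall fun x => ?_)
      simp
    · have hr := (integrable_norm_bromwich_rpow (r := -(n + 1 : ℝ) + n / 2) (by
        have : (1 : ℝ) ≤ n := by exact_mod_cast hn
        linarith)).const_mul (n.factorial * Real.exp 1 : ℝ)
      refine hr.congr (Filter.Eventually.of_forall fun τ => ?_)
      simp only [hnorm]
      rw [integral_const_mul, GaussianFourier.integral_rexp_neg_mul_sq_norm (hpos τ),
        finrank_euclideanSpace, Fintype.card_fin]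
      have h0 : 0 < ‖bromwich τ‖ := norm_pos_iff.2 (bromwich_ne_zero τ)
      have hπ := Real.pi_pos
      rw [mul_assoc _ (_ ^ (n / 2 : ℝ)), ← Real.mul_rpow (by positivity) (by positivity)]
      have h3 : Real.pi / ‖bromwich τ‖ * (Real.pi / (Real.pi ^ 2 / ‖bromwich τ‖ ^ 2)) =
          ‖bromwich τ‖ := by field_simp
      rw [h3, Real.rpow_add h0, Real.rpow_neg h0.le, ← Nat.cast_succ, Real.rpow_natCast,
        Nat.succ_eq_add_one]
      ring
  refine hJi.integral_prod_left.congr (Filter.Eventually.of_forall fun x => ?_)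
  rw [fourierInv_bochnerRiesz hn]


/-! ### Kernels of superpositions -/

theorem continuous_fourierInv {n : ℕ} {f : EuclideanSpace ℝ (Fin n) → ℂ} (hf : Integrable f) :
    Continuous (𝓕⁻ f) := by
  rw [Real.fourierInv_eq_fourier_comp_neg]
  exact VectorFourier.fourierIntegral_continuous Real.continuous_fourierChar
    continuous_inner hf.comp_neg

theorem norm_fourierInv_le {n : ℕ} (f : EuclideanSpace ℝ (Fin n) → ℂ)
    (x : EuclideanSpace ℝ (Fin n)) : ‖𝓕⁻ f x‖ ≤ ∫ ξ, ‖f ξ‖ := by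
  rw [Real.fourierInv_eq']
  refine (norm_integral_le_integral_norm _).trans (le_of_eq ?_)
  simp only [norm_smul, Complex.norm_exp_ofReal_mul_I, one_mul]

theorem fourierInv_comp_smul {n : ℕ} (f : EuclideanSpace ℝ (Fin n) → ℂ) {a : ℝ} (ha : 0 < a)
    (x : EuclideanSpace ℝ (Fin n)) :
    𝓕⁻ (fun ξ => f (a • ξ)) x = (a ^ n)⁻¹ • 𝓕⁻ f (a⁻¹ • x) := by
  rw [Real.fourierInv_eq', Real.fourierInv_eq']
  have h := Measure.integral_comp_smul (volume : Measure (EuclideanSpace ℝ (Fin n)))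
    (fun ξ => Complex.exp ((2 * Real.pi * inner ℝ ξ (a⁻¹ • x) : ℝ) * Complex.I) • f ξ) a
  rw [finrank_euclideanSpace, Fintype.card_fin, abs_of_pos (by positivity)] at h
  rw [← h]
  simp only [inner_smul_left, inner_smul_right]
  refine integral_congr_ae (Filter.Eventually.of_forall fun ξ => ?_)
  simp only
  congr 5
  simp
  field_simp

/-- The kernel of a superposition of Bochner–Riesz symbols is integrable. -/
theorem integrable_fourierInv_superposition {n : ℕ} (hn : 0 < n) {ν : ℝ → ℝ}
    (hν : IntegrableOn (fun v => (1 + v) ^ n * ν v) (Ioi 0)) {c : ℝ} (hc : 0 < c)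
    {m : EuclideanSpace ℝ (Fin n) → ℂ} (hm : ∀ ξ, ξ ≠ 0 → m ξ =
      ((∫ v in Ioi (0 : ℝ), (max (1 - c ^ 2 * ‖ξ‖ ^ 2 / v) 0) ^ n * ν v : ℝ) : ℂ)) :
    Integrable (𝓕⁻ m) ∧ ∫ x, ‖𝓕⁻ m x‖ ≤
      (∫ v in Ioi (0 : ℝ), (1 + v) ^ n * |ν v|) * ∫ x, ‖𝓕⁻ (bochnerRiesz n) x‖ := by
  set W := bochnerRiesz n with hW
  set κ := 𝓕⁻ W with hκ
  have hWi : Integrable W := integrable_bochnerRiesz hn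
  have hκi : Integrable κ := integrable_fourierInv_bochnerRiesz hn
  have hWc : Continuous W := continuous_bochnerRiesz n
  have hκc : Continuous κ := continuous_fourierInv hWi
  set μ := (volume : Measure ℝ).restrict (Ioi 0) with hμ
  have hpow1 : ∀ v : ℝ, 0 < v → 1 ≤ (1 + v) ^ n := fun v hv => one_le_pow₀ (by linarith)
  have hνm : AEStronglyMeasurable ν μ := by
    have h1 : AEStronglyMeasurable (fun v : ℝ => ((1 + v) ^ n)⁻¹ * ((1 + v) ^ n * ν v)) μ :=
      (by fun_prop : Measurable fun v : ℝ => ((1 + v) ^ n)⁻¹).aestronglyMeasurable.mul hν.1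
    refine h1.congr ((ae_restrict_mem measurableSet_Ioi).mono fun v hv => ?_)
    have := hpow1 v hv
    simp only
    rw [inv_mul_cancel_left₀ (by positivity)]
  set a : ℝ → ℝ := fun v => c / √v with ha
  have ham : Measurable a := by fun_prop
  have ha0 : ∀ v, 0 < v → 0 < a v := fun v hv => by
    have := Real.sqrt_pos.2 hv
    positivity
  have hWa : ∀ v, 0 < v → ∀ ξ, W (a v • ξ) = (((max (1 - c ^ 2 * ‖ξ‖ ^ 2 / v) 0) ^ n : ℝ) : ℂ) :=
    fun v hv ξ => by
      rw [hW, bochnerRiesz, norm_smul, Real.norm_eq_abs, abs_of_pos (ha0 v hv), mul_pow, div_pow,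
        Real.sq_sqrt hv.le]
      rw [div_mul_eq_mul_div]
  have hmW : ∀ ξ, ξ ≠ 0 → m ξ = ∫ v, W (a v • ξ) * (ν v : ℂ) ∂μ := fun ξ hξ => by
    rw [hm ξ hξ, ← integral_complex_ofReal]
    refine setIntegral_congr_fun measurableSet_Ioi fun v hv => ?_
    rw [hWa v hv]
    push_cast
    rfl
  -- The dilated symbol has L¹ norm a(v)^{-n} ‖W‖₁, which grows like v^{n/2}. This growth, needed
  -- for Fubini in ξ, is the reason for the weight (1 + v)^n on ν.
  have hain : ∀ v, 0 < v → ((a v) ^ n)⁻¹ ≤ (c ^ n)⁻¹ * (1 + v) ^ n := fun v hv => by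
    have h1 := Real.sqrt_pos.2 hv
    have : √v ≤ 1 + v := by rw [Real.sqrt_le_left (by linarith)]; nlinarith
    rw [ha, div_pow, inv_div, div_eq_inv_mul]
    gcongr
  have hfub : Integrable (fun p : EuclideanSpace ℝ (Fin n) × ℝ => W (a p.2 • p.1) * (ν p.2 : ℂ))
      (volume.prod μ) := by
    have hmeas : AEStronglyMeasurable (fun p : EuclideanSpace ℝ (Fin n) × ℝ =>
        W (a p.2 • p.1) * (ν p.2 : ℂ)) (volume.prod μ) := by
      refine AEStronglyMeasurable.mul ?_ ?_
      · exact (hWc.measurable.comp (by fun_prop)).aestronglyMeasurable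
      · exact Complex.continuous_ofReal.comp_aestronglyMeasurable hνm.comp_snd
    rw [integrable_prod_iff' hmeas]
    constructor
    · refine (ae_restrict_mem measurableSet_Ioi).mono fun v hv => ?_
      exact (hWi.comp_smul (ha0 v hv).ne').mul_const (ν v : ℂ)
    · have hdom : Integrable (fun v => (c ^ n)⁻¹ * ((1 + v) ^ n * ν v) * ∫ ξ, ‖W ξ‖) μ :=
        (hν.const_mul _).mul_const _
      refine hdom.mono hmeas.norm.prod_swap.integral_prod_right'
        ((ae_restrict_mem measurableSet_Ioi).mono fun v hv => ?_)
      have hv0 : 0 < v := hv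
      have h1 : ∫ ξ, ‖W (a v • ξ) * (ν v : ℂ)‖ = ((a v) ^ n)⁻¹ * (∫ ξ, ‖W ξ‖) * |ν v| := by
        simp_rw [norm_mul, Complex.norm_real, Real.norm_eq_abs]
        rw [integral_mul_const,
          Measure.integral_comp_smul volume (fun ξ : EuclideanSpace ℝ (Fin n) => ‖W ξ‖) (a v),
          finrank_euclideanSpace, Fintype.card_fin,
          abs_of_pos (inv_pos.2 (pow_pos (ha0 v hv0) n)), smul_eq_mul]
      have hI : 0 ≤ ∫ ξ, ‖W ξ‖ := integral_nonneg fun _ => norm_nonneg _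
      have hav := ha0 v hv0
      rw [h1, Real.norm_eq_abs, Real.norm_eq_abs, abs_of_nonneg (by positivity), abs_mul, abs_mul,
        abs_mul, abs_of_nonneg hI, abs_of_pos (show 0 < (c ^ n)⁻¹ by positivity),
        abs_of_pos (show 0 < (1 + v) ^ n by positivity)]
      calc ((a v) ^ n)⁻¹ * (∫ ξ, ‖W ξ‖) * |ν v|
          ≤ ((c ^ n)⁻¹ * (1 + v) ^ n) * (∫ ξ, ‖W ξ‖) * |ν v| := by
            gcongr
            exact hain v hv0
        _ = _ := by ring
  -- The representation of m is only assumed away from the origin, a null set because n > 0.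
  have hne : ∀ᵐ ξ : EuclideanSpace ℝ (Fin n), ξ ≠ 0 := by
    have : Nontrivial (EuclideanSpace ℝ (Fin n)) :=
      Module.nontrivial_of_finrank_pos (R := ℝ) (by simpa using hn)
    exact Measure.ae_ne _ _
  set G : EuclideanSpace ℝ (Fin n) × ℝ → ℂ := fun p =>
    (((a p.2) ^ n)⁻¹ : ℝ) • κ ((a p.2)⁻¹ • p.1) * (ν p.2 : ℂ) with hG
  have hmG : ∀ x, 𝓕⁻ m x = ∫ v, G (x, v) ∂μ := fun x => by
    rw [Real.fourierInv_eq']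
    calc _ = ∫ ξ, ∫ v, Complex.exp ((2 * Real.pi * inner ℝ ξ x : ℝ) * Complex.I) *
          (W (a v • ξ) * (ν v : ℂ)) ∂μ := by
          refine integral_congr_ae (hne.mono fun ξ hξ => ?_)
          simp only
          rw [hmW ξ hξ, integral_const_mul, smul_eq_mul]
      _ = ∫ v, (∫ ξ, Complex.exp ((2 * Real.pi * inner ℝ ξ x : ℝ) * Complex.I) *
          (W (a v • ξ) * (ν v : ℂ))) ∂μ := by
          refine integral_integral_swap (f := fun ξ v =>
            Complex.exp ((2 * Real.pi * inner ℝ ξ x : ℝ) * Complex.I) *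
              (W (a v • ξ) * (ν v : ℂ))) (hfub.bdd_mul (c := 1) ?_ ?_)
          · exact (by fun_prop : Continuous fun p : EuclideanSpace ℝ (Fin n) × ℝ =>
              Complex.exp ((2 * Real.pi * inner ℝ p.1 x : ℝ) * Complex.I)).aestronglyMeasurable
          · refine Filter.Eventually.of_forall fun p => ?_
            rw [Complex.norm_exp_ofReal_mul_I]
      _ = _ := by
          refine setIntegral_congr_fun measurableSet_Ioi fun v hv => ?_
          have h1 := fourierInv_comp_smul W (ha0 v hv) x
          rw [Real.fourierInv_eq'] at h1
          simp only [hG]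
          rw [← h1, ← integral_mul_const]
          refine integral_congr_ae (Filter.Eventually.of_forall fun ξ => ?_)
          simp only [smul_eq_mul]
          ring
  -- On the kernel side the dilation is L¹-normalised, so no growth in v appears and the final bound
  -- is uniform in c.
  have hGnorm : ∀ v, 0 < v → ∫ x, ‖G (x, v)‖ = |ν v| * ∫ x, ‖κ x‖ := fun v hv => by
    have hav := ha0 v hv
    simp only [hG, norm_mul, norm_smul, Complex.norm_real, Real.norm_eq_abs]
    rw [integral_mul_const, integral_const_mul,
      Measure.integral_comp_smul volume (fun ξ : EuclideanSpace ℝ (Fin n) => ‖κ ξ‖) (a v)⁻¹,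
      finrank_euclideanSpace, Fintype.card_fin, smul_eq_mul, inv_pow, inv_inv,
      abs_of_pos (pow_pos hav n), abs_of_pos (inv_pos.2 (pow_pos hav n)),
      inv_mul_cancel_left₀ (by positivity), mul_comm]
  have hνi : Integrable ν μ := by
    refine Integrable.mono hν hνm ((ae_restrict_mem measurableSet_Ioi).mono fun v hv => ?_)
    rw [norm_mul]
    refine le_mul_of_one_le_left (norm_nonneg _) ((hpow1 v hv).trans (le_abs_self _))
  have hGm : AEStronglyMeasurable G (volume.prod μ) := by
    refine AEStronglyMeasurable.mul (AEStronglyMeasurable.fun_smul ?_ ?_) ?_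
    · exact (by fun_prop : Measurable fun p : EuclideanSpace ℝ (Fin n) × ℝ =>
        ((a p.2) ^ n)⁻¹).aestronglyMeasurable
    · exact (hκc.measurable.comp (by fun_prop)).aestronglyMeasurable
    · exact Complex.continuous_ofReal.comp_aestronglyMeasurable hνm.comp_snd
  have hGi : Integrable G (volume.prod μ) := by
    rw [integrable_prod_iff' hGm]
    constructor
    · refine (ae_restrict_mem measurableSet_Ioi).mono fun v hv => ?_
      exact ((hκi.comp_smul (inv_ne_zero (ha0 v hv).ne')).smul (((a v) ^ n)⁻¹ : ℝ)).mul_const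
        (ν v : ℂ)
    · exact (hνi.abs.mul_const (∫ x, ‖κ x‖)).congr
        ((ae_restrict_mem measurableSet_Ioi).mono fun v hv => (hGnorm v hv).symm)
  rw [show 𝓕⁻ m = fun x => ∫ v, G (x, v) ∂μ from funext hmG]
  refine ⟨hGi.integral_prod_left, ?_⟩
  calc ∫ x, ‖∫ v, G (x, v) ∂μ‖ ≤ ∫ x, ∫ v, ‖G (x, v)‖ ∂μ :=
        integral_mono hGi.integral_prod_left.norm hGi.norm.integral_prod_left
          fun x => norm_integral_le_integral_norm _
    _ = ∫ v, (∫ x, ‖G (x, v)‖) ∂μ := integral_integral_swap hGi.norm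
    _ = ∫ v, |ν v| * (∫ x, ‖κ x‖) ∂μ := setIntegral_congr_fun measurableSet_Ioi hGnorm
    _ = (∫ v, |ν v| ∂μ) * ∫ x, ‖κ x‖ := integral_mul_const _ _
    _ ≤ _ := by
        refine mul_le_mul_of_nonneg_right ?_ (integral_nonneg fun _ => norm_nonneg _)
        refine integral_mono_ae hνi.abs ?_ ((ae_restrict_mem measurableSet_Ioi).mono fun v hv => ?_)
        · refine hν.abs.congr ((ae_restrict_mem measurableSet_Ioi).mono fun v hv => ?_)
          have hv0 : (0 : ℝ) < v := hv
          simp only [abs_mul, abs_of_nonneg (show 0 ≤ (1 + v) ^ n by positivity)]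
        · exact le_mul_of_one_le_left (abs_nonneg _) (hpow1 v hv)


/-! ### L¹ bounds for the symbol and the kernel of J^{2α} e^{tL} -/

/-- The symbol of `J^{2α} e^{tL}`. -/
noncomputable def besselHeatSymbol (n : ℕ) (α γ : ℝ) (g : ℝ → ℝ) (t : ℝ)
    (ξ : EuclideanSpace ℝ (Fin n)) : ℂ :=
  (((1 + ‖ξ‖ ^ 2) ^ α * heatSymbol γ g t (2 * Real.pi * ‖ξ‖) : ℝ) : ℂ)

theorem measurable_besselHeatSymbol (n : ℕ) (α γ : ℝ) {g : ℝ → ℝ}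
    (hg : MonotoneOn g (Ici 0)) (t : ℝ) : Measurable (besselHeatSymbol n α γ g t) := by
  -- Clamping at 0 makes g monotone on the whole line, hence measurable.
  have h1 : Measurable fun r : ℝ => g (max r 0) := by
    refine Monotone.measurable fun a b hab => hg (le_max_right a 0) (le_max_right b 0) ?_
    exact max_le_max_right 0 hab
  have h2 : ∀ ξ : EuclideanSpace ℝ (Fin n), g (2 * Real.pi * ‖ξ‖) =
      g (max (2 * Real.pi * ‖ξ‖) 0) := fun ξ => by
    rw [max_eq_left (by positivity)]
  unfold besselHeatSymbol heatSymbol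
  simp_rw [h2]
  have h3 : Measurable fun ξ : EuclideanSpace ℝ (Fin n) => g (max (2 * Real.pi * ‖ξ‖) 0) :=
    h1.comp (by fun_prop : Measurable fun ξ : EuclideanSpace ℝ (Fin n) => 2 * Real.pi * ‖ξ‖)
  refine Complex.measurable_ofReal.comp (Measurable.mul (by fun_prop)
    (Real.measurable_exp.comp (Measurable.div ?_ h3).neg))
  fun_prop

/-- The semigroup property and scaling: the symbol in terms of the rescaled profile. -/
theorem besselHeatSymbol_eq (n : ℕ) (α : ℝ) {γ : ℝ} (hγ : 0 < γ) (g : ℝ → ℝ) {t : ℝ} {N : ℕ}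
    {τ : ℝ} (hτ : 0 < τ) (ht : N * τ = t) (ξ : EuclideanSpace ℝ (Fin n)) :
    besselHeatSymbol n α γ g t ξ =
      (((2 * Real.pi * τ ^ (1 / γ)) ^ (-(2 * α)) *
        (((2 * Real.pi * τ ^ (1 / γ)) ^ 2 + (2 * Real.pi * τ ^ (1 / γ)) ^ 2 * ‖ξ‖ ^ 2) ^ α *
          profile γ g τ (2 * Real.pi * τ ^ (1 / γ) * ‖ξ‖) ^ N) : ℝ) : ℂ) := by
  set l := 2 * Real.pi * τ ^ (1 / γ) with hl
  have hl0 : 0 < l := by positivity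
  rw [besselHeatSymbol, ← mul_assoc]
  congr 2
  · have h1 : l ^ 2 + l ^ 2 * ‖ξ‖ ^ 2 = l ^ 2 * (1 + ‖ξ‖ ^ 2) := by ring
    rw [h1, Real.mul_rpow (x := l ^ 2) (by positivity) (by positivity), ← Real.rpow_natCast l 2,
      ← Real.rpow_mul hl0.le, Nat.cast_two, ← mul_assoc, ← Real.rpow_add hl0, neg_add_cancel,
      Real.rpow_zero, one_mul]
  · rw [heatSymbol, profile, ← Real.exp_nat_mul]
    have h1 : l * ‖ξ‖ * τ ^ (-1 / γ) = 2 * Real.pi * ‖ξ‖ := by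
      have : τ ^ (1 / γ) * τ ^ (-1 / γ) = 1 := by
        rw [← Real.rpow_add hτ, ← add_div, add_neg_cancel, zero_div, Real.rpow_zero]
      rw [hl]
      linear_combination (2 * Real.pi * ‖ξ‖) * this
    have h2 : (l * ‖ξ‖) ^ γ = τ * (2 * Real.pi * ‖ξ‖) ^ γ := by
      rw [show l * ‖ξ‖ = τ ^ (1 / γ) * (2 * Real.pi * ‖ξ‖) by rw [hl]; ring,
        Real.mul_rpow (by positivity) (by positivity), ← Real.rpow_mul hτ.le,
        one_div_mul_cancel hγ.ne', Real.rpow_one]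
    rw [h1, h2, ← ht]
    congr 1
    ring

/-- The rapid decay of the profile beats the growth (c + r²)^α with n + 1 powers to spare, enough
for integrability over ℝⁿ. -/
theorem exists_norm_besselHeatSymbol_le (n : ℕ) {γ : ℝ} (hγ : 1 ≤ γ) {B : ℝ} (hB : 1 ≤ B)
    {α : ℝ} (hα : 0 ≤ α) {Λ : ℝ} (hΛ : 0 ≤ Λ) : ∃ C : ℝ, 0 ≤ C ∧ ∀ (g : ℝ → ℝ) (τ : ℝ), 0 < τ →
    (∀ r, 0 ≤ r → 1 ≤ g r) → (∀ r, 0 ≤ r → g r ≤ B) → ∀ c, 0 ≤ c → c ≤ Λ → ∀ N : ℕ, 0 < N →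
    ∀ r, 0 ≤ r → (c + r ^ 2) ^ α * profile γ g τ r ^ N ≤ C * (1 + r) ^ (-(n + 1 : ℝ)) := by
  obtain ⟨l, hl⟩ := exists_nat_ge α
  obtain ⟨Cl, hCl, hpl⟩ := exists_profile_le hγ hB (2 * l + (n + 1))
  refine ⟨(1 + Λ) ^ l * Cl, by positivity, fun g τ hτ hg hgB c hc hcΛ N hN r hr => ?_⟩
  have h1 := hpl g τ hg hgB hτ r hr
  have h0 := profile_nonneg γ g τ r
  have h2 : profile γ g τ r ^ N ≤ profile γ g τ r := by
    calc profile γ g τ r ^ N ≤ profile γ g τ r ^ 1 :=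
          pow_le_pow_of_le_one h0 (profile_le_one hg hτ hr) hN
      _ = _ := pow_one _
  have h3 : (c + r ^ 2) ^ α ≤ (1 + Λ) ^ l * (1 + r) ^ (2 * l) := by
    calc (c + r ^ 2) ^ α ≤ ((1 + Λ) * (1 + r) ^ 2) ^ α :=
          Real.rpow_le_rpow (by positivity)
            (by nlinarith [mul_nonneg hΛ hr, mul_nonneg hΛ (sq_nonneg r)]) hα
      _ ≤ ((1 + Λ) * (1 + r) ^ 2) ^ (l : ℝ) := by
          refine Real.rpow_le_rpow_of_exponent_le ?_ hl
          nlinarith [mul_nonneg hΛ hr, mul_nonneg hΛ (sq_nonneg r)]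
      _ = _ := by rw [Real.rpow_natCast, mul_pow, ← pow_mul]
  rw [Real.rpow_neg (by positivity), ← Nat.cast_succ, Real.rpow_natCast, ← div_eq_mul_inv,
    le_div_iff₀ (by positivity), Nat.succ_eq_add_one]
  calc (c + r ^ 2) ^ α * profile γ g τ r ^ N * (1 + r) ^ (n + 1)
      ≤ ((1 + Λ) ^ l * (1 + r) ^ (2 * l)) * profile γ g τ r * (1 + r) ^ (n + 1) := by gcongr
    _ = (1 + Λ) ^ l * (profile γ g τ r * (1 + r) ^ (2 * l + (n + 1))) := by ring
    _ ≤ _ := by gcongr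

/-- Bounds of the kernel of `J^{2α} e^{tL}` in `L¹`, and of its symbol in `L¹`. -/
theorem exists_kernel_bound {n : ℕ} (hn : 0 < n) {γ : ℝ} (hγ : 1 ≤ γ) {g : ℝ → ℝ}
    (hg_mono : MonotoneOn g (Ici 0)) (hg : ∀ r, 0 ≤ r → 1 ≤ g r) {B : ℝ}
    (hgB : ∀ r, 0 ≤ r → g r ≤ B) (hk : KernelCondition n γ g) {α : ℝ} (hα : 0 ≤ α) {T : ℝ}
    (hT : 0 < T) : ∃ C : ℝ, 0 < C ∧ ∀ t ∈ Ioc 0 T, Integrable (besselHeatSymbol n α γ g t) ∧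
      Integrable (𝓕⁻ (besselHeatSymbol n α γ g t)) ∧
      ∫ x, ‖𝓕⁻ (besselHeatSymbol n α γ g t) x‖ ≤ C * t ^ (-(2 * α / γ)) ∧
      ∫ ξ, ‖besselHeatSymbol n α γ g t ξ‖ ≤ C * t ^ (-((2 * α + n) / γ)) := by
  have hB : 1 ≤ B := (hg 0 le_rfl).trans (hgB 0 le_rfl)
  have hγ0 : 0 < γ := by linarith
  obtain ⟨M, hM⟩ := hk
  obtain ⟨N₀, hN₀⟩ := exists_nat_gt T
  -- N ≥ n + 2 leaves a factor of the profile after n + 1 derivatives; N > T puts τ = t/N in (0, 1),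
  -- where the kernel condition holds.
  set N : ℕ := max (n + 2) N₀ with hN
  have hNn : n + 2 ≤ N := le_max_left _ _
  have hNT : T < N := hN₀.trans_le (by exact_mod_cast le_max_right _ _)
  have hN0 : (0 : ℝ) < N := hT.trans hNT
  obtain ⟨C₁, hC₁, h₁⟩ := exists_superposition hn hγ M hB hα
    (show (0 : ℝ) ≤ (2 * Real.pi) ^ 2 by positivity) hNn
  obtain ⟨C₂, hC₂, h₂⟩ := exists_norm_besselHeatSymbol_le n hγ hB hα
    (show (0 : ℝ) ≤ (2 * Real.pi) ^ 2 by positivity)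
  set κ₁ := ∫ x, ‖𝓕⁻ (bochnerRiesz n) x‖ with hκ₁
  have hκ₁0 : 0 ≤ κ₁ := integral_nonneg fun _ => norm_nonneg _
  set I₁ := ∫ ξ : EuclideanSpace ℝ (Fin n), (1 + ‖ξ‖) ^ (-(n + 1 : ℝ)) with hI₁
  have hI₁i : Integrable fun ξ : EuclideanSpace ℝ (Fin n) => (1 + ‖ξ‖) ^ (-(n + 1 : ℝ)) :=
    integrable_one_add_norm (by simp)
  have hI₁0 : 0 ≤ I₁ := integral_nonneg fun _ => by positivity
  have hscale : ∀ t, 0 < t → ∀ e : ℝ, (2 * Real.pi * (t / N) ^ (1 / γ)) ^ (-e) =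
      (2 * Real.pi) ^ (-e) * N ^ (e / γ) * t ^ (-(e / γ)) := fun t ht e => by
    rw [Real.mul_rpow (by positivity) (by positivity), ← Real.rpow_mul (by positivity),
      Real.div_rpow ht.le hN0.le, show 1 / γ * -e = -(e / γ) by ring, Real.rpow_neg hN0.le,
      div_inv_eq_mul]
    ring
  set D₁ := (2 * Real.pi) ^ (-(2 * α)) * (N : ℝ) ^ (2 * α / γ) with hD₁
  set D₂ := (2 * Real.pi) ^ (-(2 * α + n)) * (N : ℝ) ^ ((2 * α + n) / γ) with hD₂
  have hD₁0 : 0 ≤ D₁ := by positivity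
  have hD₂0 : 0 ≤ D₂ := by positivity
  refine ⟨1 + D₁ * C₁ * κ₁ + D₂ * C₂ * I₁, by positivity, fun t ht => ?_⟩
  have ht0 : 0 < t := ht.1
  set τ := t / N with hτ
  have hτ0 : 0 < τ := by positivity
  have hτ1 : τ < 1 := by rw [hτ, div_lt_one hN0]; exact ht.2.trans_lt hNT
  have hNτ : N * τ = t := by rw [hτ]; field_simp
  set l := 2 * Real.pi * τ ^ (1 / γ) with hl
  have hl0 : 0 < l := by positivity
  -- Scaling turns 1 + ‖ξ‖² into l² + u with u = l²‖ξ‖². The shift l² stays in the fixed range [0,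
  -- (2π)²], so the constants above do not depend on t.
  have hl1 : l ≤ 2 * Real.pi := by
    have : τ ^ (1 / γ) ≤ 1 := Real.rpow_le_one hτ0.le hτ1.le (by positivity)
    have := Real.pi_pos
    nlinarith
  have hl2 : l ^ 2 ≤ (2 * Real.pi) ^ 2 := by gcongr
  have hs1 : l ^ (-(2 * α)) = D₁ * t ^ (-(2 * α / γ)) := hscale t ht0 _
  have hs2 : l ^ (-(2 * α)) * (l ^ n)⁻¹ = D₂ * t ^ (-((2 * α + n) / γ)) := by
    have := hscale t ht0 (2 * α + n)
    rw [← this, neg_add, Real.rpow_add (by positivity), Real.rpow_neg hl0.le (n : ℝ),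
      Real.rpow_natCast]
  set m := besselHeatSymbol n α γ g t with hm
  have hmeq : ∀ ξ, m ξ = ((l ^ (-(2 * α)) * ((l ^ 2 + l ^ 2 * ‖ξ‖ ^ 2) ^ α *
      profile γ g τ (l * ‖ξ‖) ^ N) : ℝ) : ℂ) := besselHeatSymbol_eq n α hγ0 g hτ0 hNτ
  have hmle : ∀ ξ, ‖m ξ‖ ≤ l ^ (-(2 * α)) * (C₂ * (1 + ‖l • ξ‖) ^ (-(n + 1 : ℝ))) := fun ξ => by
    have hpr := profile_nonneg γ g τ (l * ‖ξ‖)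
    rw [hmeq, Complex.norm_real, Real.norm_eq_abs, abs_of_nonneg (by positivity), norm_smul,
      Real.norm_eq_abs, abs_of_pos hl0]
    refine mul_le_mul_of_nonneg_left ?_ (by positivity)
    have := h₂ g τ hτ0 hg hgB (l ^ 2) (by positivity) hl2 N (by omega) (l * ‖ξ‖) (by positivity)
    rwa [mul_pow l ‖ξ‖ 2] at this
  have hdomi := ((hI₁i.comp_smul hl0.ne').const_mul C₂).const_mul (l ^ (-(2 * α)))
  have hmi : Integrable m := hdomi.mono'
    (measurable_besselHeatSymbol n α γ hg_mono t).aestronglyMeasurable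
    (Filter.Eventually.of_forall hmle)
  obtain ⟨hd, hi, hb⟩ := hM τ ⟨hτ0, hτ1⟩
  obtain ⟨ν, hν1, hν2, hν3⟩ := h₁ g τ hτ0 hg hgB hd hi hb (l ^ 2) (by positivity) hl2
  obtain ⟨hK1, hK2⟩ := integrable_fourierInv_superposition hn (ν := fun v => l ^ (-(2 * α)) * ν v)
    ((Integrable.const_mul hν1 (l ^ (-(2 * α)))).congr
      (Filter.Eventually.of_forall fun v => by simp only; ring)) hl0 (m := m) fun ξ hξ => by
      have hξ0 : 0 < ‖ξ‖ := norm_pos_iff.2 hξ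
      have h5 := hν3 (l ^ 2 * ‖ξ‖ ^ 2) (by positivity)
      have h6 : √(l ^ 2 * ‖ξ‖ ^ 2) = l * ‖ξ‖ := by
        rw [← mul_pow, Real.sqrt_sq (by positivity)]
      rw [h6] at h5
      rw [hmeq, h5, ← integral_const_mul]
      congr 1
      refine integral_congr_ae (Filter.Eventually.of_forall fun v => ?_)
      simp only
      ring
  refine ⟨hmi, hK1, hK2.trans ?_, ?_⟩
  · have h6 : ∫ v in Ioi (0 : ℝ), (1 + v) ^ n * |l ^ (-(2 * α)) * ν v| ≤ l ^ (-(2 * α)) * C₁ := by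
      calc _ = ∫ v in Ioi (0 : ℝ), l ^ (-(2 * α)) * ((1 + v) ^ n * |ν v|) := by
            refine integral_congr_ae (Filter.Eventually.of_forall fun v => ?_)
            simp only
            rw [abs_mul, abs_of_nonneg (by positivity)]
            ring
        _ = l ^ (-(2 * α)) * ∫ v in Ioi (0 : ℝ), (1 + v) ^ n * |ν v| := integral_const_mul _ _
        _ ≤ _ := by gcongr
    have htp : 0 ≤ t ^ (-(2 * α / γ)) := by positivity
    calc _ ≤ l ^ (-(2 * α)) * C₁ * κ₁ := by gcongr
      _ = (D₁ * C₁ * κ₁) * t ^ (-(2 * α / γ)) := by rw [hs1]; ring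
      _ ≤ _ := by
        gcongr
        have : 0 ≤ D₂ * C₂ * I₁ := by positivity
        linarith
  · have htp : 0 ≤ t ^ (-((2 * α + n) / γ)) := by positivity
    calc ∫ ξ, ‖m ξ‖ ≤ ∫ ξ : EuclideanSpace ℝ (Fin n),
          l ^ (-(2 * α)) * (C₂ * (1 + ‖l • ξ‖) ^ (-(n + 1 : ℝ))) :=
          integral_mono hmi.norm hdomi hmle
      _ = l ^ (-(2 * α)) * (C₂ * ((l ^ n)⁻¹ * I₁)) := by
          rw [integral_const_mul, integral_const_mul, Measure.integral_comp_smul volume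
            (fun ξ : EuclideanSpace ℝ (Fin n) => (1 + ‖ξ‖) ^ (-(n + 1 : ℝ))) l,
            finrank_euclideanSpace, Fintype.card_fin, smul_eq_mul, abs_of_pos (by positivity)]
      _ = (l ^ (-(2 * α)) * (l ^ n)⁻¹) * C₂ * I₁ := by ring
      _ = (D₂ * C₂ * I₁) * t ^ (-((2 * α + n) / γ)) := by rw [hs2]; ring
      _ ≤ _ := by
        gcongr
        have : 0 ≤ D₁ * C₁ * κ₁ := by positivity
        linarith


/-! ### Boundedness of g from the multiplier hypothesis -/

variable {n : ℕ}

theorem enorm_integral_smul_le {α : Type*} [MeasurableSpace α] {μ : Measure α} {p q : ℝ≥0∞}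
    [ENNReal.HolderConjugate p q] {f g : α → ℂ} (hf : AEStronglyMeasurable f μ)
    (hg : AEStronglyMeasurable g μ) :
    ‖∫ x, f x • g x ∂μ‖ₑ ≤ eLpNorm f p μ * eLpNorm g q μ := by
  refine (enorm_integral_le_lintegral_enorm _).trans ?_
  rw [← eLpNorm_one_eq_lintegral_enorm]
  have h := eLpNorm_smul_le_mul_eLpNorm (p := p) (q := q) (r := 1) hg hf
  exact h

/-- Translation becomes multiplication by a unimodular character, so L^p norms on the Fourier side
do not see it. This makes the bound below uniform in the centre of the bump. -/
theorem norm_fourier_compSubConstCLM (β : 𝓢(EuclideanSpace ℝ (Fin n), ℂ))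
    (c x : EuclideanSpace ℝ (Fin n)) :
    ‖(𝓕 (β.compSubConstCLM ℂ c)) x‖ = ‖(𝓕 β) x‖ := by
  have h := congrFun (VectorFourier.fourierIntegral_comp_add_right Real.fourierChar volume
    (innerₗ (EuclideanSpace ℝ (Fin n))) (β : EuclideanSpace ℝ (Fin n) → ℂ) (-c)) x
  have h2 : ((β : EuclideanSpace ℝ (Fin n) → ℂ) ∘ fun v => v + -c) =
      (β.compSubConstCLM ℂ c : EuclideanSpace ℝ (Fin n) → ℂ) := by
    ext v
    simp [sub_eq_add_neg]
  rw [h2] at h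
  rw [SchwartzMap.fourier_coe, SchwartzMap.fourier_coe]
  change ‖VectorFourier.fourierIntegral _ _ _ _ _‖ = ‖VectorFourier.fourierIntegral _ _ _ _ _‖
  rw [h, Circle.norm_smul]

theorem norm_fourierInv_compSubConstCLM (β : 𝓢(EuclideanSpace ℝ (Fin n), ℂ))
    (c x : EuclideanSpace ℝ (Fin n)) :
    ‖(𝓕⁻ (β.compSubConstCLM ℂ c)) x‖ = ‖(𝓕⁻ β) x‖ := by
  have h := norm_fourier_compSubConstCLM β c (-x)
  rw [SchwartzMap.fourier_coe, SchwartzMap.fourier_coe] at h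
  rw [SchwartzMap.fourierInv_coe, SchwartzMap.fourierInv_coe,
    Real.fourierInv_eq_fourier_neg, Real.fourierInv_eq_fourier_neg, h]

/-- A multiplier bounded on `L^p` has bounded averages against translates of a bump function. -/
theorem IsLpBoundedMultiplier.exists_bound {p : ℝ≥0∞} [Fact (1 ≤ p)] {a : ℝ → ℝ}
    (h : IsLpBoundedMultiplier n p a) (β : 𝓢(EuclideanSpace ℝ (Fin n), ℂ)) :
    ∃ B : ℝ, ∀ c : EuclideanSpace ℝ (Fin n),
      Integrable (fun ξ => (β (ξ - c)) * ((a (2 * Real.pi * ‖ξ‖) : ℂ) * β (ξ - c))) ∧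
      ‖∫ ξ, (β (ξ - c)) * ((a (2 * Real.pi * ‖ξ‖) : ℂ) * β (ξ - c))‖ ≤ B := by
  obtain ⟨A, hA⟩ := h
  set q : ℝ≥0∞ := (1 - p⁻¹)⁻¹
  have : ENNReal.HolderConjugate p q := ENNReal.HolderConjugate.inv_one_sub_inv' Fact.out
  have hqp : ENNReal.HolderConjugate q p := .symm
  refine ⟨(eLpNorm (𝓕 β : 𝓢(EuclideanSpace ℝ (Fin n), ℂ)) q volume).toReal *
    (‖A‖ * (eLpNorm (𝓕⁻ β : 𝓢(EuclideanSpace ℝ (Fin n), ℂ)) p volume).toReal), fun c => ?_⟩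
  set b := β.compSubConstCLM ℂ c
  obtain ⟨h1, h2⟩ := hA (𝓕⁻ b) b
  rw [FourierTransform.fourier_fourierInv_eq] at h1 h2
  refine ⟨h1, ?_⟩
  set u := A ((𝓕⁻ b).toLp p)
  -- The average of the symbol against b² is the pairing of 𝓕 b with G applied to 𝓕⁻ b, to which
  -- Hölder's inequality and the operator norm apply.
  have h3 : ∫ ξ, b ξ * ((a (2 * Real.pi * ‖ξ‖) : ℂ) * b ξ) = ∫ x, (𝓕 b) x • u x := by
    rw [← h2, TemperedDistribution.fourier_apply, Lp.toTemperedDistribution_apply]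
  change ‖∫ ξ, b ξ * ((a (2 * Real.pi * ‖ξ‖) : ℂ) * b ξ)‖ ≤ _
  rw [h3]
  have h4 : ‖∫ x, (𝓕 b) x • u x‖ₑ ≤
      eLpNorm (𝓕 b : 𝓢(EuclideanSpace ℝ (Fin n), ℂ)) q volume * eLpNorm u p volume := by
    exact enorm_integral_smul_le (𝓕 b : 𝓢(EuclideanSpace ℝ (Fin n), ℂ)).continuous.aestronglyMeasurable
      (Lp.aestronglyMeasurable u)
  have h5 : eLpNorm (𝓕 b : 𝓢(EuclideanSpace ℝ (Fin n), ℂ)) q volume =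
      eLpNorm (𝓕 β : 𝓢(EuclideanSpace ℝ (Fin n), ℂ)) q volume :=
    eLpNorm_congr_norm_ae (.of_forall (norm_fourier_compSubConstCLM β c))
  have h6 : eLpNorm (𝓕⁻ b : 𝓢(EuclideanSpace ℝ (Fin n), ℂ)) p volume =
      eLpNorm (𝓕⁻ β : 𝓢(EuclideanSpace ℝ (Fin n), ℂ)) p volume :=
    eLpNorm_congr_norm_ae (.of_forall (norm_fourierInv_compSubConstCLM β c))
  have h7 : ‖u‖ ≤ ‖A‖ * (eLpNorm (𝓕⁻ β : 𝓢(EuclideanSpace ℝ (Fin n), ℂ)) p volume).toReal := by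
    rw [← h6, ← SchwartzMap.norm_toLp]
    exact A.le_opNorm _
  rw [h5] at h4
  have h8 := ENNReal.toReal_mono
    (ENNReal.mul_ne_top ((𝓕 β : 𝓢(EuclideanSpace ℝ (Fin n), ℂ)).memLp q volume).2.ne (Lp.eLpNorm_ne_top u)) h4
  rw [toReal_enorm, ENNReal.toReal_mul, ← Lp.norm_def] at h8
  exact h8.trans (mul_le_mul_of_nonneg_left h7 ENNReal.toReal_nonneg)

/-- A nondecreasing radial multiplier that is bounded on `L^p` is a bounded function. -/
theorem IsLpBoundedMultiplier.bounded (hn : 0 < n) {p : ℝ≥0∞} [Fact (1 ≤ p)] {g : ℝ → ℝ}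
    (h : IsLpBoundedMultiplier n p g) (hg_mono : MonotoneOn g (Ici 0))
    (hg : ∀ r, 0 ≤ r → 1 ≤ g r) : ∃ B, ∀ r, 0 ≤ r → g r ≤ B := by
  let φ : ContDiffBump (0 : EuclideanSpace ℝ (Fin n)) := ⟨1, 2, one_pos, one_lt_two⟩
  have hc : HasCompactSupport (fun x => (φ x : ℂ)) :=
    φ.hasCompactSupport.comp_left (g := fun r : ℝ => (r : ℂ)) Complex.ofReal_zero
  have hs : ContDiff ℝ ((⊤ : ℕ∞) : WithTop ℕ∞) (fun x => (φ x : ℂ)) :=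
    Complex.ofRealCLM.contDiff.comp φ.contDiff
  set β := hc.toSchwartzMap hs
  obtain ⟨B, hB⟩ := h.exists_bound β
  set V := volume.real (Metric.closedBall (0 : EuclideanSpace ℝ (Fin n)) 1)
  have hV : 0 < V := ENNReal.toReal_pos (Metric.measure_closedBall_pos volume _ one_pos).ne'
    measure_closedBall_lt_top.ne
  refine ⟨B / V, fun r hr => ?_⟩
  -- With this centre, every point ξ of the unit ball around c satisfies 2π‖ξ‖ ≥ r, so the symbol is
  -- at least g r there, and the bump equals 1.
  set c : EuclideanSpace ℝ (Fin n) := EuclideanSpace.single ⟨0, hn⟩ (r / (2 * Real.pi) + 1)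
  have hpi := Real.pi_pos
  have hcn : ‖c‖ = r / (2 * Real.pi) + 1 := by
    rw [PiLp.norm_single, Real.norm_of_nonneg (by positivity)]
  obtain ⟨h1, h2⟩ := hB c
  have heq : (fun ξ => β (ξ - c) * ((g (2 * Real.pi * ‖ξ‖) : ℂ) * β (ξ - c))) =
      fun ξ => ((φ (ξ - c) ^ 2 * g (2 * Real.pi * ‖ξ‖) : ℝ) : ℂ) := by
    ext ξ
    change (φ (ξ - c) : ℂ) * (_ * (φ (ξ - c) : ℂ)) = _
    push_cast
    ring
  have hgn : ∀ ξ : EuclideanSpace ℝ (Fin n), 0 ≤ g (2 * Real.pi * ‖ξ‖) := fun ξ =>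
    zero_le_one.trans (hg _ (by positivity))
  rw [heq] at h1 h2
  rw [integral_complex_ofReal, Complex.norm_real, Real.norm_of_nonneg
    (integral_nonneg fun ξ => mul_nonneg (sq_nonneg _) (hgn ξ))] at h2
  have h3 : Integrable (fun ξ => φ (ξ - c) ^ 2 * g (2 * Real.pi * ‖ξ‖)) := by
    exact h1.re
  have h4 : ∫ ξ in Metric.closedBall c 1, g r ≤ ∫ ξ, φ (ξ - c) ^ 2 * g (2 * Real.pi * ‖ξ‖) := by
    refine le_trans ?_ (setIntegral_le_integral (s := Metric.closedBall c 1) h3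
      (.of_forall fun ξ => mul_nonneg (sq_nonneg _) (hgn ξ)))
    refine setIntegral_mono_on (integrableOn_const measure_closedBall_lt_top.ne) h3.integrableOn
      Metric.isClosed_closedBall.measurableSet fun ξ hξ => ?_
    rw [φ.one_of_mem_closedBall (by simpa [dist_eq_norm] using hξ)]
    simp only [one_pow, one_mul]
    have h5 : ‖c‖ ≤ ‖ξ‖ + 1 := by
      have := norm_sub_norm_le c ξ
      rw [mem_closedBall_iff_norm, norm_sub_rev] at hξ
      linarith
    have h6 : r / (2 * Real.pi) ≤ ‖ξ‖ := by linarith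
    refine hg_mono hr (mem_Ici.mpr (by positivity)) ?_
    rw [div_le_iff₀ (by positivity)] at h6
    linarith
  rw [setIntegral_const, smul_eq_mul, Measure.real, Measure.addHaar_closedBall_center,
    ← Measure.real] at h4
  rw [le_div_iff₀ hV, mul_comm]
  exact h4.trans h2


/-! ### Young's inequality and convolution operators -/

section Young

variable {G : Type*} [AddCommGroup G] [MeasurableSpace G] [MeasurableAdd₂ G] [MeasurableNeg G]
  {μ : Measure G} [μ.IsAddLeftInvariant] [μ.IsNegInvariant]

/-- Hölder's inequality for the measure `k (x - y) dy`. -/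
theorem lintegral_conv_le {k φ : G → ℝ≥0∞} (hk : Measurable k) (hφ : Measurable φ) {r : ℝ}
    (hr : 1 < r) (x : G) :
    ∫⁻ y, k (x - y) * φ y ∂μ ≤
      (∫⁻ y, k y ∂μ) ^ (1 - 1 / r) * (∫⁻ y, k (x - y) * φ y ^ r ∂μ) ^ (1 / r) := by
  have hr0 : 0 < r := by linarith
  have hconj : (Real.conjExponent r).HolderConjugate r := (Real.HolderConjugate.conjExponent hr).symm
  set s := Real.conjExponent r
  have hs0 : 0 < s := hconj.pos
  have hs : 1 / s = 1 - 1 / r := by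
    have := hconj.inv_add_inv_eq_one
    simp only [one_div]
    linarith
  have hkx : Measurable fun y => k (x - y) := hk.comp (measurable_const.sub measurable_id)
  -- Hölder with the kernel split as k = k^{1/s} k^{1/r}.
  have h := ENNReal.lintegral_mul_le_Lp_mul_Lq μ hconj
    (f := fun y => k (x - y) ^ (1 / s)) (g := fun y => k (x - y) ^ (1 / r) * φ y)
    (hkx.pow_const _).aemeasurable ((hkx.pow_const _).mul hφ).aemeasurable
  have e1 : ∀ y, ((fun y => k (x - y) ^ (1 / s)) * fun y => k (x - y) ^ (1 / r) * φ y) y =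
      k (x - y) * φ y := fun y => by
    simp only [Pi.mul_apply]
    rw [← mul_assoc, ← ENNReal.rpow_add_of_nonneg _ _ (by positivity) (by positivity), hs]
    simp
  have e2 : ∀ y, (k (x - y) ^ (1 / s)) ^ s = k (x - y) := fun y => by
    rw [← ENNReal.rpow_mul, one_div_mul_cancel hs0.ne', ENNReal.rpow_one]
  have e3 : ∀ y, (k (x - y) ^ (1 / r) * φ y) ^ r = k (x - y) * φ y ^ r := fun y => by
    rw [ENNReal.mul_rpow_of_nonneg _ _ hr0.le, ← ENNReal.rpow_mul, one_div_mul_cancel hr0.ne',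
      ENNReal.rpow_one]
  simp only [e1, e2, e3] at h
  rwa [lintegral_sub_left_eq_self (fun y => k y) x, hs] at h

/-- Young's convolution inequality, with the norm of the kernel interpolated between `L¹` and
`L^∞`. -/
theorem lintegral_conv_rpow_le [SFinite μ] {k φ : G → ℝ≥0∞} (hk : Measurable k) (hφ : Measurable φ)
    {M : ℝ≥0∞} (hM : ∀ x, k x ≤ M) {r q : ℝ} (hr : 1 < r) (hq : r ≤ q) :
    (∫⁻ x, (∫⁻ y, k (x - y) * φ y ∂μ) ^ q ∂μ) ^ (1 / q) ≤
      (∫⁻ y, k y ∂μ) ^ (1 - (1 / r - 1 / q)) * M ^ (1 / r - 1 / q) *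
        (∫⁻ y, φ y ^ r ∂μ) ^ (1 / r) := by
  have hr0 : 0 < r := by linarith
  have hq0 : 0 < q := by linarith
  have hr1 : 1 / r ≤ 1 := by rw [div_le_one hr0]; exact hr.le
  have hqr : 1 / q ≤ 1 / r := one_div_le_one_div_of_le hr0 hq
  have hqr' : 0 ≤ q / r - 1 := by rw [sub_nonneg, le_div_iff₀ hr0]; linarith
  set A := ∫⁻ y, k y ∂μ
  set Φ := ∫⁻ y, φ y ^ r ∂μ
  set W : G → ℝ≥0∞ := fun x => ∫⁻ y, k (x - y) * φ y ^ r ∂μ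
  have hmeas : Measurable fun z : G × G => k (z.1 - z.2) * φ z.2 ^ r :=
    (hk.comp (measurable_fst.sub measurable_snd)).mul ((hφ.comp measurable_snd).pow_const _)
  have hWm : Measurable W := hmeas.lintegral_prod_right'
  have hW1 : ∫⁻ x, W x ∂μ = A * Φ := by
    simp only [W]
    rw [lintegral_lintegral_swap hmeas.aemeasurable]
    simp only [Φ]
    rw [← lintegral_const_mul _ (hφ.pow_const _)]
    refine lintegral_congr fun y => ?_
    rw [lintegral_mul_const (f := fun x => k (x - y)) _ (hk.comp (measurable_id.sub_const y)),
      lintegral_sub_right_eq_self (fun x => k x) y]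
  have hW2 : ∀ x, W x ≤ M * Φ := fun x => by
    simp only [Φ]
    rw [← lintegral_const_mul _ (hφ.pow_const _)]
    exact lintegral_mono fun y => mul_le_mul_left (hM _) _
  -- After Hölder, W^{q/r} is split as W^{q/r-1} W: the first factor is bounded by (MΦ)^{q/r-1}, and
  -- the second is left to be integrated by Tonelli.
  have hpt : ∀ x, (∫⁻ y, k (x - y) * φ y ∂μ) ^ q ≤
      A ^ ((1 - 1 / r) * q) * (M * Φ) ^ (q / r - 1) * W x := fun x => by
    calc _ ≤ (A ^ (1 - 1 / r) * W x ^ (1 / r)) ^ q :=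
          ENNReal.rpow_le_rpow (lintegral_conv_le hk hφ hr x) hq0.le
      _ = A ^ ((1 - 1 / r) * q) * (W x ^ (q / r - 1) * W x) := by
          rw [ENNReal.mul_rpow_of_nonneg _ _ hq0.le, ← ENNReal.rpow_mul, ← ENNReal.rpow_mul]
          nth_rw 3 [← ENNReal.rpow_one (W x)]
          rw [← ENNReal.rpow_add_of_nonneg _ _ hqr' zero_le_one]
          congr 2
          ring
      _ ≤ _ := by
          rw [mul_assoc]
          gcongr
          exact hW2 x
  have hint : ∫⁻ x, (∫⁻ y, k (x - y) * φ y ∂μ) ^ q ∂μ ≤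
      A ^ ((1 - 1 / r) * q) * (M * Φ) ^ (q / r - 1) * (A * Φ) := by
    refine (lintegral_mono hpt).trans ?_
    rw [lintegral_const_mul _ hWm, hW1]
  refine (ENNReal.rpow_le_rpow hint (by positivity : 0 ≤ 1 / q)).trans (le_of_eq ?_)
  have hq1 : 0 ≤ 1 / q := by positivity
  have e : (A : ℝ≥0∞) ^ ((1 - 1 / r) * q) * (M * Φ) ^ (q / r - 1) * (A * Φ) =
      A ^ ((1 - 1 / r) * q + 1) * M ^ (q / r - 1) * Φ ^ (q / r) := by
    rw [ENNReal.mul_rpow_of_nonneg _ _ hqr', ENNReal.rpow_add_of_nonneg _ _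
      (mul_nonneg (by linarith) hq0.le) zero_le_one, ENNReal.rpow_one]
    have : Φ ^ (q / r) = Φ ^ (q / r - 1) * Φ := by
      nth_rw 3 [← ENNReal.rpow_one Φ]
      rw [← ENNReal.rpow_add_of_nonneg _ _ hqr' zero_le_one, sub_add_cancel]
    rw [this]
    ring
  rw [e, ENNReal.mul_rpow_of_nonneg _ _ hq1, ENNReal.mul_rpow_of_nonneg _ _ hq1,
    ← ENNReal.rpow_mul, ← ENNReal.rpow_mul, ← ENNReal.rpow_mul]
  have e1 : ((1 - 1 / r) * q + 1) * (1 / q) = 1 - (1 / r - 1 / q) := by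
    field_simp
    ring
  have e2 : (q / r - 1) * (1 / q) = 1 / r - 1 / q := by field_simp
  have e3 : q / r * (1 / q) = 1 / r := by field_simp
  rw [e1, e2, e3]

end Young

/-- Absolute convergence at every x, needed so that the convolution integral is additive in f. -/
theorem integrable_conv_mul {p₁ : ℝ≥0∞} {K : EuclideanSpace ℝ (Fin n) → ℂ} (hK : Continuous K)
    (hKi : Integrable K) {M : ℝ} (hM : ∀ x, ‖K x‖ ≤ M) (hp₁ : 1 < p₁) (hp₁' : p₁ < ⊤)
    (f : Lp ℂ p₁ (volume : Measure (EuclideanSpace ℝ (Fin n)))) (x : EuclideanSpace ℝ (Fin n)) :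
    Integrable fun y => K (x - y) * f y := by
  have hr : 1 < p₁.toReal := by
    rw [← ENNReal.toReal_one]
    exact (ENNReal.toReal_lt_toReal ENNReal.one_ne_top hp₁'.ne).mpr hp₁
  have hf := Lp.stronglyMeasurable f
  refine ⟨((hK.comp (by fun_prop)).aestronglyMeasurable).mul hf.aestronglyMeasurable, ?_⟩
  rw [hasFiniteIntegral_iff_enorm]
  simp only [enorm_mul]
  refine (lintegral_conv_le (k := fun x => ‖K x‖ₑ) hK.measurable.enorm hf.measurable.enorm
    hr x).trans_lt ?_
  have h1 : ∫⁻ y, ‖f y‖ₑ ^ p₁.toReal < ⊤ :=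
    lintegral_rpow_enorm_lt_top_of_eLpNorm_lt_top (by positivity) hp₁'.ne (Lp.eLpNorm_lt_top f)
  refine ENNReal.mul_lt_top (ENNReal.rpow_lt_top_of_nonneg ?_ hKi.2.ne)
    (ENNReal.rpow_lt_top_of_nonneg (by positivity) ?_)
  · rw [sub_nonneg, div_le_one (by linarith)]
    exact hr.le
  · have h2 : ∫⁻ y, ‖K (x - y)‖ₑ * ‖f y‖ₑ ^ p₁.toReal ≤
        ∫⁻ y, ENNReal.ofReal M * ‖f y‖ₑ ^ p₁.toReal := by
      refine lintegral_mono fun y => mul_le_mul_left ?_ _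
      rw [← ofReal_norm]
      exact ENNReal.ofReal_le_ofReal (hM _)
    rw [lintegral_const_mul _ (hf.measurable.enorm.pow_const _)] at h2
    exact (h2.trans_lt (ENNReal.mul_lt_top ENNReal.ofReal_lt_top h1)).ne

/-- Convolution with a bounded continuous integrable kernel, as an operator from `L^{p₁}` to
`L^{p₂}`. -/
theorem exists_convolution_operator {p₁ p₂ : ℝ≥0∞} [Fact (1 ≤ p₁)] [Fact (1 ≤ p₂)]
    {K : EuclideanSpace ℝ (Fin n) → ℂ} (hK : Continuous K)
    (hKi : Integrable K) {M : ℝ} (hM : ∀ x, ‖K x‖ ≤ M) (hp₁ : 1 < p₁) (hp : p₁ ≤ p₂)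
    (hp₂ : p₂ < ⊤) :
    ∃ S : Lp ℂ p₁ (volume : Measure (EuclideanSpace ℝ (Fin n))) →L[ℂ]
        Lp ℂ p₂ (volume : Measure (EuclideanSpace ℝ (Fin n))),
      (∀ f, S f =ᵐ[volume] fun x => ∫ y, K (x - y) * f y) ∧
      ‖S‖ ≤ (∫ x, ‖K x‖) ^ (1 - (1 / p₁.toReal - 1 / p₂.toReal)) *
        M ^ (1 / p₁.toReal - 1 / p₂.toReal) := by
  have hp₁' : p₁ < ⊤ := hp.trans_lt hp₂
  have hM0 : 0 ≤ M := (norm_nonneg _).trans (hM 0)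
  have hr : 1 < p₁.toReal := by
    rw [← ENNReal.toReal_one]
    exact (ENNReal.toReal_lt_toReal ENNReal.one_ne_top hp₁'.ne).mpr hp₁
  have hrq : p₁.toReal ≤ p₂.toReal := ENNReal.toReal_mono hp₂.ne hp
  set r := p₁.toReal
  set q := p₂.toReal
  have hr0 : 0 < r := by linarith
  have hq0 : 0 < q := by linarith
  have hθ : 0 ≤ 1 / r - 1 / q := by
    rw [sub_nonneg]
    exact one_div_le_one_div_of_le hr0 hrq
  have hθ' : 0 ≤ 1 - (1 / r - 1 / q) := by
    have h1 : 1 / r ≤ 1 := by rw [div_le_one hr0]; exact hr.le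
    have h2 : 0 ≤ 1 / q := by positivity
    linarith
  have hint := integrable_conv_mul hK hKi hM hp₁ hp₁'
  set D := (∫ x, ‖K x‖) ^ (1 - (1 / r - 1 / q)) * M ^ (1 / r - 1 / q)
  have hD : 0 ≤ D := by positivity
  have hp₁0 : p₁ ≠ 0 := (zero_lt_one.trans hp₁).ne'
  have hp₂0 : p₂ ≠ 0 := (zero_lt_one.trans (hp₁.trans_le hp)).ne'
  have hbound : ∀ f : Lp ℂ p₁ (volume : Measure (EuclideanSpace ℝ (Fin n))),
      eLpNorm (fun x => ∫ y, K (x - y) * f y) p₂ volume ≤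
        ENNReal.ofReal D * eLpNorm f p₁ volume := fun f => by
    have hf := Lp.stronglyMeasurable f
    rw [eLpNorm_eq_lintegral_rpow_enorm_toReal hp₂0 hp₂.ne,
      eLpNorm_eq_lintegral_rpow_enorm_toReal hp₁0 hp₁'.ne]
    have h1 := lintegral_conv_rpow_le (μ := volume) (k := fun x => ‖K x‖ₑ)
      (φ := fun y => ‖f y‖ₑ) (M := ENNReal.ofReal M) hK.measurable.enorm hf.measurable.enorm
      (fun x => by rw [← ofReal_norm]; exact ENNReal.ofReal_le_ofReal (hM _)) hr hrq
    have h2 : (∫⁻ x, ‖K x‖ₑ) = ENNReal.ofReal (∫ x, ‖K x‖) :=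
      (ofReal_integral_norm_eq_lintegral_enorm hKi).symm
    have h3 : 0 ≤ ∫ x, ‖K x‖ := integral_nonneg fun _ => norm_nonneg _
    rw [h2, ENNReal.ofReal_rpow_of_nonneg h3 hθ', ENNReal.ofReal_rpow_of_nonneg hM0 hθ,
      ← ENNReal.ofReal_mul (by positivity)] at h1
    refine le_trans ?_ h1
    gcongr with x
    refine (enorm_integral_le_lintegral_enorm _).trans (le_of_eq ?_)
    simp only [enorm_mul]
  have hmem : ∀ f : Lp ℂ p₁ (volume : Measure (EuclideanSpace ℝ (Fin n))),
      MemLp (fun x => ∫ y, K (x - y) * f y) p₂ volume := fun f => by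
    have hf := Lp.stronglyMeasurable f
    refine ⟨?_, (hbound f).trans_lt
      (ENNReal.mul_lt_top ENNReal.ofReal_lt_top (Lp.eLpNorm_lt_top f))⟩
    have h1 : StronglyMeasurable fun z : EuclideanSpace ℝ (Fin n) × EuclideanSpace ℝ (Fin n) =>
        K (z.1 - z.2) * f z.2 :=
      (hK.comp (by fun_prop)).stronglyMeasurable.mul (hf.comp_measurable measurable_snd)
    exact h1.integral_prod_right'.aestronglyMeasurable
  let S₀ : Lp ℂ p₁ (volume : Measure (EuclideanSpace ℝ (Fin n))) →ₗ[ℂ]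
      Lp ℂ p₂ (volume : Measure (EuclideanSpace ℝ (Fin n))) :=
    { toFun := fun f => (hmem f).toLp
      map_add' := fun f g => by
        rw [← MemLp.toLp_add, MemLp.toLp_eq_toLp_iff]
        refine .of_forall fun x => ?_
        simp only [Pi.add_apply]
        rw [← integral_add (hint f x) (hint g x)]
        refine integral_congr_ae ?_
        filter_upwards [Lp.coeFn_add f g] with y hy
        rw [hy, Pi.add_apply, mul_add]
      map_smul' := fun c f => by
        rw [RingHom.id_apply, ← MemLp.toLp_const_smul, MemLp.toLp_eq_toLp_iff]
        refine .of_forall fun x => ?_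
        simp only [Pi.smul_apply, smul_eq_mul]
        rw [← integral_const_mul]
        refine integral_congr_ae ?_
        filter_upwards [Lp.coeFn_smul c f] with y hy
        rw [hy, Pi.smul_apply, smul_eq_mul]
        ring }
  refine ⟨S₀.mkContinuous D fun f => ?_, fun f => (hmem f).coeFn_toLp,
    LinearMap.mkContinuous_norm_le _ hD _⟩
  change ‖(hmem f).toLp‖ ≤ _
  rw [Lp.norm_toLp, Lp.norm_def, ← ENNReal.toReal_ofReal hD, ← ENNReal.toReal_mul]
  exact ENNReal.toReal_mono
    (ENNReal.mul_ne_top ENNReal.ofReal_ne_top (Lp.eLpNorm_ne_top f)) (hbound f)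


/-! ### Identification of the multiplier and transfer to Sobolev spaces -/

theorem integral_fourier_mul {f g : EuclideanSpace ℝ (Fin n) → ℂ} (hf : Integrable f)
    (hg : Integrable g) : ∫ x, 𝓕 f x * g x = ∫ x, f x * 𝓕 g x := by
  have h := VectorFourier.integral_fourierIntegral_smul_eq_flip
    (L := innerₗ (EuclideanSpace ℝ (Fin n))) (μ := volume) (ν := volume)
    Real.continuous_fourierChar continuous_inner hf hg
  rw [flip_innerₗ] at h
  exact h

theorem integral_fourierInv_mul {f g : EuclideanSpace ℝ (Fin n) → ℂ} (hf : Integrable f)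
    (hg : Integrable g) : ∫ x, 𝓕⁻ f x * g x = ∫ x, f x * 𝓕⁻ g x := by
  rw [Real.fourierInv_eq_fourier_comp_neg g, ← integral_fourier_mul hf hg.comp_neg,
    ← integral_neg_eq_self]
  refine integral_congr_ae (.of_forall fun x => ?_)
  simp only [Real.fourierInv_eq_fourier_neg, neg_neg]

/-- Convolution with `𝓕⁻ m` is the Fourier multiplier with symbol `m`. -/
theorem integral_fourierInv_sub_mul {m χ : EuclideanSpace ℝ (Fin n) → ℂ} (hm : Integrable m)
    (hχ : Integrable χ) (x : EuclideanSpace ℝ (Fin n)) :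
    ∫ y, 𝓕⁻ m (x - y) * χ y = 𝓕⁻ (fun ξ => m ξ * 𝓕 χ ξ) x := by
  set e : EuclideanSpace ℝ (Fin n) → ℂ :=
    fun ξ => Complex.exp (((2 * Real.pi * inner ℝ ξ x : ℝ) : ℂ) * Complex.I) with he
  have hen : ∀ ξ, ‖e ξ‖ = 1 := fun ξ => Complex.norm_exp_ofReal_mul_I _
  have hec : Continuous e := by
    simp only [he]
    fun_prop
  have hem : Integrable fun ξ => e ξ * m ξ :=
    hm.bdd_mul hec.aestronglyMeasurable (.of_forall fun ξ => (hen ξ).le)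
  -- For fixed x, the reflected and translated kernel is the Fourier transform of the modulated
  -- symbol, so the multiplication formula can move 𝓕 onto χ.
  have h1 : ∀ y, 𝓕⁻ m (x - y) = 𝓕 (fun ξ => e ξ * m ξ) y := fun y => by
    rw [Real.fourierInv_eq', Real.fourier_eq']
    refine integral_congr_ae (.of_forall fun ξ => ?_)
    simp only [smul_eq_mul, he]
    rw [← mul_assoc, ← Complex.exp_add, inner_sub_right]
    congr 2
    push_cast
    ring
  simp only [h1]
  rw [integral_fourier_mul hem hχ, Real.fourierInv_eq']
  refine integral_congr_ae (.of_forall fun ξ => ?_)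
  simp only [smul_eq_mul, he]
  ring

/-- The `L^p` representative of a Schwartz function in `H^{s,p}`. -/
theorem SobolevSpace.lpRep_ofSchwartz {s : ℝ} {p : ℝ≥0∞} [Fact (1 ≤ p)]
    (φ : 𝓢(EuclideanSpace ℝ (Fin n), ℂ)) :
    lpRep (ofSchwartz φ : SobolevSpace n s p) = (SchwartzMap.fourierMultiplierCLM ℂ
      (fun x : EuclideanSpace ℝ (Fin n) => (1 + ‖x‖ ^ 2) ^ (s / 2)) φ).toLp p := by
  apply lp_ext
  rw [← lpRep_spec]
  change besselPotential _ _ s (φ : 𝓢'(EuclideanSpace ℝ (Fin n), ℂ)) = _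
  rw [besselPotential, Lp.toTemperedDistribution_toLp_eq,
    fourierMultiplierCLM_toTemperedDistributionCLM_eq (by fun_prop)]
  congr 1
  exact SchwartzMap.fourierMultiplierCLM_ofReal ℂ
    (Function.hasTemperateGrowth_one_add_norm_sq_rpow _ (s / 2)) φ

/-- Conjugate an operator `L^{p₁} → L^{p₂}` with Bessel potentials to an operator
`H^{s₁,p₁} → H^{s₂,p₂}`. -/
theorem SobolevSpace.exists_lift {s₁ s₂ : ℝ} {p₁ p₂ : ℝ≥0∞} [Fact (1 ≤ p₁)] [Fact (1 ≤ p₂)]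
    (S : Lp ℂ p₁ (volume : Measure (EuclideanSpace ℝ (Fin n))) →L[ℂ]
      Lp ℂ p₂ (volume : Measure (EuclideanSpace ℝ (Fin n)))) :
    ∃ A : SobolevSpace n s₁ p₁ →L[ℂ] SobolevSpace n s₂ p₂,
      (∀ f, lpRep (A f) = S (lpRep f)) ∧ ‖A‖ ≤ ‖S‖ := by
  have key : ∀ u : Lp ℂ p₂ (volume : Measure (EuclideanSpace ℝ (Fin n))),
      ∃ v : SobolevSpace n s₂ p₂, lpRep v = u := fun u => by
    have hu : besselPotential (EuclideanSpace ℝ (Fin n)) ℂ s₂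
        (besselPotential (EuclideanSpace ℝ (Fin n)) ℂ (-s₂)
          (u : 𝓢'(EuclideanSpace ℝ (Fin n), ℂ))) = u := by simp
    refine ⟨⟨besselPotential (EuclideanSpace ℝ (Fin n)) ℂ (-s₂) u, u, hu⟩, lp_ext ?_⟩
    exact (lpRep_spec _).symm.trans hu
  -- R inverts `lpRep`, which is onto because J^{-s₂} maps L^{p₂} into H^{s₂,p₂}. Linearity of the
  -- lifted operator follows from injectivity of `lpRep`.
  choose R hR using key
  let A₀ : SobolevSpace n s₁ p₁ →ₗ[ℂ] SobolevSpace n s₂ p₂ :=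
    { toFun := fun f => R (S (lpRep f))
      map_add' := fun f g => lpRep_injective (by simp only [map_add, hR])
      map_smul' := fun c f => lpRep_injective (by simp only [map_smul, hR, RingHom.id_apply]) }
  refine ⟨A₀.mkContinuous ‖S‖ fun f => ?_, fun f => hR _,
    LinearMap.mkContinuous_norm_le _ (norm_nonneg _) _⟩
  rw [norm_def, norm_def]
  change ‖lpRep (R (S (lpRep f)))‖ ≤ _
  rw [hR]
  exact S.le_opNorm _

/-- The Bessel weights of J^{-s₂}, J^{s₂-s₁} and J^{s₁} cancel, so conjugation returns exactly the
symbol of e^{tL}. -/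
theorem besselHeatSymbol_mul_rpow (s₁ s₂ γ : ℝ) (g : ℝ → ℝ) (t : ℝ)
    (ξ : EuclideanSpace ℝ (Fin n)) :
    (((1 + ‖ξ‖ ^ 2) ^ (-s₂ / 2) : ℝ) : ℂ) * besselHeatSymbol n ((s₂ - s₁) / 2) γ g t ξ *
      (((1 + ‖ξ‖ ^ 2) ^ (s₁ / 2) : ℝ) : ℂ) = (heatSymbol γ g t (2 * Real.pi * ‖ξ‖) : ℂ) := by
  have h : (1 + ‖ξ‖ ^ 2) ^ (-s₂ / 2) * (1 + ‖ξ‖ ^ 2) ^ ((s₂ - s₁) / 2) *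
      (1 + ‖ξ‖ ^ 2) ^ (s₁ / 2) = 1 := by
    rw [← Real.rpow_add (by positivity), ← Real.rpow_add (by positivity)]
    convert Real.rpow_zero _ using 2
    ring
  unfold besselHeatSymbol
  rw [← Complex.ofReal_mul, ← Complex.ofReal_mul]
  congr 1
  linear_combination (heatSymbol γ g t (2 * Real.pi * ‖ξ‖)) * h

theorem integrable_mul_heatSymbol_mul {γ : ℝ} {g : ℝ → ℝ} (hg_mono : MonotoneOn g (Ici 0))
    (hg : ∀ r, 0 ≤ r → 1 ≤ g r) {t : ℝ} (ht : 0 < t) (ψ χ : 𝓢(EuclideanSpace ℝ (Fin n), ℂ)) :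
    Integrable fun ξ => ψ ξ * ((heatSymbol γ g t (2 * Real.pi * ‖ξ‖) : ℂ) * χ ξ) := by
  have hm : Measurable fun ξ : EuclideanSpace ℝ (Fin n) =>
      (heatSymbol γ g t (2 * Real.pi * ‖ξ‖) : ℂ) := by
    have h := measurable_besselHeatSymbol n 0 γ hg_mono t
    unfold besselHeatSymbol at h
    simpa using h
  have hb : ∀ ξ : EuclideanSpace ℝ (Fin n),
      ‖(heatSymbol γ g t (2 * Real.pi * ‖ξ‖) : ℂ)‖ ≤ 1 := fun ξ => by
    have hg1 := hg (2 * Real.pi * ‖ξ‖) (by positivity)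
    rw [Complex.norm_real, heatSymbol, Real.norm_of_nonneg (Real.exp_nonneg _),
      Real.exp_le_one_iff, neg_nonpos]
    positivity
  have h2 : ∀ ξ, ‖ψ ξ‖ ≤ SchwartzMap.seminorm ℝ 0 0 ψ := ψ.norm_le_seminorm ℝ
  exact (χ.integrable.bdd_mul hm.aestronglyMeasurable (.of_forall hb)).bdd_mul
    ψ.continuous.aestronglyMeasurable (.of_forall h2)

/-- Convolution with the inverse Fourier transform of `besselHeatSymbol`, conjugated with Bessel
potentials, is the Fourier multiplier with symbol `heatSymbol`. -/
theorem isSobolevMultiplier_of_convolution {γ : ℝ} {g : ℝ → ℝ} (hg_mono : MonotoneOn g (Ici 0))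
    (hg : ∀ r, 0 ≤ r → 1 ≤ g r) {t : ℝ} (ht : 0 < t) {s₁ s₂ : ℝ} {p₁ p₂ : ℝ≥0∞}
    [Fact (1 ≤ p₁)] [Fact (1 ≤ p₂)]
    (hm : Integrable (besselHeatSymbol n ((s₂ - s₁) / 2) γ g t))
    {S : Lp ℂ p₁ (volume : Measure (EuclideanSpace ℝ (Fin n))) →L[ℂ]
      Lp ℂ p₂ (volume : Measure (EuclideanSpace ℝ (Fin n)))}
    (hS : ∀ f, S f =ᵐ[volume] fun x =>
      ∫ y, 𝓕⁻ (besselHeatSymbol n ((s₂ - s₁) / 2) γ g t) (x - y) * f y)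
    {A : SobolevSpace n s₁ p₁ →L[ℂ] SobolevSpace n s₂ p₂}
    (hA : ∀ f, SobolevSpace.lpRep (A f) = S (SobolevSpace.lpRep f)) :
    IsSobolevMultiplier (heatSymbol γ g t) A := by
  intro φ ψ
  refine ⟨integrable_mul_heatSymbol_mul hg_mono hg ht ψ (𝓕 φ), ?_⟩
  set m := besselHeatSymbol n ((s₂ - s₁) / 2) γ g t
  set f : SobolevSpace n s₁ p₁ := SobolevSpace.ofSchwartz φ
  set χ : 𝓢(EuclideanSpace ℝ (Fin n), ℂ) := SchwartzMap.fourierMultiplierCLM ℂ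
    (fun x : EuclideanSpace ℝ (Fin n) => (1 + ‖x‖ ^ 2) ^ (s₁ / 2)) φ with hχ
  have hw : (fun x : EuclideanSpace ℝ (Fin n) =>
      (((1 + ‖x‖ ^ 2) ^ (-s₂ / 2) : ℝ) : ℂ)).HasTemperateGrowth := by fun_prop
  set η : 𝓢(EuclideanSpace ℝ (Fin n), ℂ) := SchwartzMap.smulLeftCLM ℂ
    (fun x : EuclideanSpace ℝ (Fin n) => (((1 + ‖x‖ ^ 2) ^ (-s₂ / 2) : ℝ) : ℂ)) ψ with hη
  have hχf : ∀ ξ, 𝓕 (χ : EuclideanSpace ℝ (Fin n) → ℂ) ξ =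
      (((1 + ‖ξ‖ ^ 2) ^ (s₁ / 2) : ℝ) : ℂ) * (𝓕 φ) ξ := fun ξ => by
    rw [← SchwartzMap.fourier_coe, hχ, SchwartzMap.fourierMultiplierCLM_apply,
      FourierTransform.fourier_fourierInv_eq, SchwartzMap.smulLeftCLM_apply_apply
        (Function.hasTemperateGrowth_one_add_norm_sq_rpow _ _), Complex.real_smul]
  have h1 : SobolevSpace.toDistribution (A f) =
      besselPotential (EuclideanSpace ℝ (Fin n)) ℂ (-s₂)
        (S (SobolevSpace.lpRep f) : 𝓢'(EuclideanSpace ℝ (Fin n), ℂ)) := by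
    rw [← hA, ← SobolevSpace.lpRep_spec]
    simp
  set N : EuclideanSpace ℝ (Fin n) → ℂ := fun ξ => m ξ * 𝓕 (χ : EuclideanSpace ℝ (Fin n) → ℂ) ξ
    with hNdef
  have hS' : S (SobolevSpace.lpRep f) =ᵐ[volume] 𝓕⁻ N := by
    refine (hS _).trans (.of_forall fun x => ?_)
    rw [hNdef, ← integral_fourierInv_sub_mul hm χ.integrable]
    refine integral_congr_ae ?_
    filter_upwards [χ.coeFn_toLp p₁ volume] with y hy
    rw [← hy, SobolevSpace.lpRep_ofSchwartz]
  have hN : Integrable N := by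
    rw [hNdef, ← SchwartzMap.fourier_coe]
    exact hm.mul_bdd (𝓕 χ : 𝓢(EuclideanSpace ℝ (Fin n), ℂ)).continuous.aestronglyMeasurable
      (.of_forall ((𝓕 χ : 𝓢(EuclideanSpace ℝ (Fin n), ℂ)).norm_le_seminorm ℝ))
  rw [h1, fourier_besselPotential_eq_smulLeftCLM_fourier_apply,
    TemperedDistribution.smulLeftCLM_apply_apply, ← hη, TemperedDistribution.fourier_apply,
    Lp.toTemperedDistribution_apply]
  -- The weight of J^{-s₂} has been moved onto the test function η. The multiplication formula then
  -- takes 𝓕⁻ off N and cancels it against 𝓕 η, leaving the product of the three symbols.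
  calc ∫ x, (𝓕 η) x • S (SobolevSpace.lpRep f) x
      = ∫ x, 𝓕⁻ N x * (𝓕 η : 𝓢(EuclideanSpace ℝ (Fin n), ℂ)) x := by
        refine integral_congr_ae ?_
        filter_upwards [hS'] with x hx
        rw [hx, smul_eq_mul, mul_comm]
    _ = ∫ x, N x * η x := by
        rw [integral_fourierInv_mul hN (𝓕 η : 𝓢(EuclideanSpace ℝ (Fin n), ℂ)).integrable,
          ← SchwartzMap.fourierInv_coe, FourierTransform.fourierInv_fourier_eq]
    _ = _ := by
        refine integral_congr_ae (.of_forall fun ξ => ?_)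
        simp only [hNdef]
        rw [← besselHeatSymbol_mul_rpow s₁ s₂ γ g t ξ, hχf, hη,
          SchwartzMap.smulLeftCLM_apply_apply hw, smul_eq_mul]
        ring

end FractionalHeat

theorem proposition5p8 (n : ℕ) (hn : 0 < n) (γ : ℝ) (hγ : 1 < γ)
    (g : ℝ → ℝ) (hg_mono : MonotoneOn g (Set.Ici 0)) (hg_one : ∀ r, 0 ≤ r → 1 ≤ g r)
    (hg_kernel : FractionalHeat.KernelCondition n γ g)
    (p : ENNReal) [Fact (1 ≤ p)] (hp_one : 1 < p) (hp_top : p < ⊤)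
    (hg_mult : FractionalHeat.IsLpBoundedMultiplier n p g)
    (s₁ s₂ : ℝ) (hs : s₁ ≤ s₂)
    (p₁ p₂ : ENNReal) [Fact (1 ≤ p₁)] [Fact (1 ≤ p₂)]
    (hp₁ : 1 < p₁) (hp : p₁ ≤ p₂) (hp₂ : p₂ < ⊤) (T : ℝ) (hT : 0 < T) :
    ∃ C : ℝ, ∀ t ∈ Set.Ioc 0 T,
      ∃ A : FractionalHeat.SobolevSpace n s₁ p₁ →L[ℂ] FractionalHeat.SobolevSpace n s₂ p₂,
        FractionalHeat.IsSobolevMultiplier (FractionalHeat.heatSymbol γ g t) A ∧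
        ‖A‖ ≤ C * t ^ (-((s₂ - s₁ + n / p₁.toReal - n / p₂.toReal) / γ)) := by
  obtain ⟨B, hB⟩ := hg_mult.bounded hn hg_mono hg_one
  obtain ⟨C, hC, hker⟩ := FractionalHeat.exists_kernel_bound hn hγ.le hg_mono hg_one hB hg_kernel
    (α := (s₂ - s₁) / 2) (by linarith) hT
  refine ⟨C, fun t ht => ?_⟩
  obtain ⟨hm, hK, hK1, hm1⟩ := hker t ht
  obtain ⟨S, hS, hSn⟩ := FractionalHeat.exists_convolution_operator
    (FractionalHeat.continuous_fourierInv hm) hK (FractionalHeat.norm_fourierInv_le _) hp₁ hp hp₂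
  obtain ⟨A, hA, hAn⟩ := FractionalHeat.SobolevSpace.exists_lift (s₁ := s₁) (s₂ := s₂) S
  refine ⟨A, FractionalHeat.isSobolevMultiplier_of_convolution hg_mono hg_one ht.1 hm hS hA,
    hAn.trans (hSn.trans ?_)⟩
  have hr : 1 ≤ p₁.toReal := by
    rw [← ENNReal.toReal_one]
    exact ENNReal.toReal_mono (hp.trans_lt hp₂).ne hp₁.le
  have hrq : p₁.toReal ≤ p₂.toReal := ENNReal.toReal_mono hp₂.ne hp
  set θ := 1 / p₁.toReal - 1 / p₂.toReal with hθ
  have hθ0 : 0 ≤ θ := by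
    rw [hθ, sub_nonneg]
    exact one_div_le_one_div_of_le (by linarith) hrq
  have hθ1 : 0 ≤ 1 - θ := by
    have h1 : 1 / p₁.toReal ≤ 1 := by rw [div_le_one (by linarith)]; exact hr
    have h2 : 0 ≤ 1 / p₂.toReal := by positivity
    linarith
  have ht0 := ht.1
  -- The L¹ bound of the kernel enters with power 1 - θ and the sup bound, through ‖m‖₁, with power
  -- θ. The constants recombine to C and the exponents of t to -(2α + nθ)/γ.
  refine (mul_le_mul (Real.rpow_le_rpow (by positivity) hK1 hθ1)
    (Real.rpow_le_rpow (by positivity) hm1 hθ0) (by positivity) (by positivity)).trans (le_of_eq ?_)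
  rw [Real.mul_rpow hC.le (by positivity), Real.mul_rpow hC.le (by positivity),
    ← Real.rpow_mul ht0.le, ← Real.rpow_mul ht0.le, mul_mul_mul_comm, ← Real.rpow_add hC,
    ← Real.rpow_add ht0, sub_add_cancel, Real.rpow_one]
  congr 2
  rw [hθ]
  ring
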